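/- **Setting.** Let $C=(Y,Z,A)$ take values in $\mathcal Y\times\mathcal Z\times\mathcal A$ and have density $q_c$ with respect to a product $dy\,dz\,da$ of $\sigma$-finite reference measures. Here $Y$ is observed, $Z$ is latent, $A$ is auxiliary; write $X=(Y,Z)$ and $B=(Y,A)$. Let $p_c(y,z,a;\beta)$, $\beta=(\theta,\varphi)\in\mathcal B\subset\mathbb R^{d+f}$, be a candidate family of densities, and let $q_x,q_y,q_{z|y}$ and $p_x,p_y,p_b,p_{z|y}$ denote the marginal and conditional densities derived from $q_c$ and $p_c$; the marginal $p_x=\int p_c\,da$ is assumed to depend on $\theta$ only. $E$ is the expectation under the truth, and $\nabla,\nabla^2$ are the gradient and Hessian in $\beta$. **Regularity conditions (of the type of White, 1982).** (i) $\mathcal B$ is compact and convex. (ii) For each of the three pairs $(r,p_r)\in\{(b,p_b),(x,p_x),(y,p_y)\}$: $p_r(r;\beta)$ is positive, measurable in $r$ and continuous in $\beta\in\mathcal B$; $\sup_{\beta\in\mathcal B}|\log p_r(r;\beta)|$ is bounded by a function of $r$ that is integrable under the true law; on the interior of $\mathcal B$, $\log p_r(r;\beta)$ is twice continuously differentiable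 in $\beta$, its first derivatives are measurable in $r$, and all $|\partial_i\partial_j\log p_r|$ and $|\partial_i\log p_r\cdot\partial_j\log p_r|$ are bounded, uniformly in $\beta$, by a function of $r$ that is integrable under the true law. (iii) $E[\log p_b(B;\beta)]$ has a unique maximizer $\bar\beta=(\bar\theta,\bar\varphi)$ over $\mathcal B$, it lies in the interior of $\mathcal B$, and $I_b=-E[\nabla^2\log p_b(B;\bar\beta)]$ is nonsingular. Put $$J_b=E[\nabla\log p_b(B;\bar\beta)\nabla^\top\log p_b(B;\bar\beta)],\quad K_{b,y}=E[\nabla\log p_b(B;\bar\beta)\nabla^\top\log p_y(Y;\bar\theta)],\quad I_{z|y}=-E[\nabla^2\log p_{z|y}(Z|Y;\bar\theta)].$$ Let $C_1,C_2,\dots$ be i.i.d. copies of $C$. For each $n$ let $\hat\beta_b=(\hat\theta_b,\hat\varphi_b)$ be a measurable maximizer over $\mathcal B$ of $\frac1n\sum_{i=1}^n\log p_b(B_i;\beta)$, a function of $B_1,\dots,B_n$. Let $\ell_y(\theta)=\frac1n\sum_{i=1}^n\log p_y(Y_i;\theta)$, $\mathcal L_x(\theta)=-\int q_x(x)\log p_x(x;\theta)\,dx$,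 $\mathcal R_x(\hat\theta_b)=E[\mathcal L_x(\hat\theta_b)]$ and $C(q_x)=\int q_x(x)\log q_{z|y}(z|y)\,dx$. **Theorem.** Assume in addition that the latent part is correctly specified: $q_{z|y}(z|y)=p_{z|y}(z|y;\bar\theta)$ for almost every $(y,z)$ with $q_y(y)>0$. Then the criterion $$\widehat{\mathrm{risk}}_{x;b}=-2n\,\ell_y(\hat\theta_b)+2\,\mathrm{tr}(I_b^{-1}K_{b,y})+\mathrm{tr}(I_{z|y}I_b^{-1}J_bI_b^{-1})$$ has finite expectation, $\mathcal R_x(\hat\theta_b)$ and $C(q_x)$ are finite, and, as $n\to\infty$, $$E[\widehat{\mathrm{risk}}_{x;b}]=2n\,\mathcal R_x(\hat\theta_b)+2n\,C(q_x)+o(1).$$ Moreover, if $Z$ and $A$ are trivial (their domains are one-point spaces, so that $X=B=Y$), then $\hat\beta_b$ maximizes $\ell_y$ over $\mathcal B$, $\bar\beta$ is the unique maximizer of $E[\log p_y(Y;\cdot)]$ over $\mathcal B$, and $\widehat{\mathrm{risk}}_{x;b}$ equals Takeuchi's criterion $\mathrm{TIC}=-2n\,\ell_y(\hat\theta_y)+2\,\mathrm{tr}(I_y^{-1}J_y)$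 with $\hat\theta_y=\hat\theta_b$, $I_y=-E[\nabla^2\log p_y(Y;\bar\theta)]$ and $J_y=E[\nabla\log p_y(Y;\bar\theta)\nabla^\top\log p_y(Y;\bar\theta)]$. -/

import Mathlib

open MeasureTheory ProbabilityTheory Filter Topology

noncomputable section

/-- The parameter `β = (θ, φ)`: `θ` has `d` coordinates, the nuisance parameter `φ` has `f`. -/
abbrev Param (d f : ℕ) : Type := EuclideanSpace ℝ (Fin d ⊕ Fin f)

/-- The part `θ` of `β = (θ, φ)`. -/
def Param.theta {d f : ℕ} (β : Param d f) : EuclideanSpace ℝ (Fin d) :=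
  WithLp.toLp 2 fun i => β (Sum.inl i)

/-- The `i`-th partial derivative of `g` at `β`. -/
def partialDeriv {ι : Type*} [Fintype ι] [DecidableEq ι] (g : EuclideanSpace ℝ ι → ℝ) (i : ι)
    (β : EuclideanSpace ℝ ι) : ℝ :=
  fderiv ℝ g β (EuclideanSpace.single i 1)

/-- The second partial derivative `∂²g / ∂β_i ∂β_j` at `β`. -/
def partialDeriv₂ {ι : Type*} [Fintype ι] [DecidableEq ι] (g : EuclideanSpace ℝ ι → ℝ) (i j : ι)
    (β : EuclideanSpace ℝ ι) : ℝ :=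
  partialDeriv (partialDeriv g j) i β

/-- `q` is a probability density with respect to `μ`. (A non-integrable function has Bochner
integral `0`, so the last clause includes integrability.) -/
structure IsProbDensity {U : Type*} [MeasurableSpace U] (μ : Measure U) (q : U → ℝ) : Prop where
  measurable : Measurable q
  nonneg : ∀ u, 0 ≤ q u
  integral_eq_one : ∫ u, q u ∂μ = 1

/-- Smoothness and domination conditions on a parametric family `p` of positive densities on `U`,
relative to the true law `G` and the parameter set `B`: measurability in `u` and continuity in
`β`, a `G`-integrable bound on `log p`, twice continuous differentiability of `log p` in `β`, and
a `G`-integrable bound on the second derivatives and on the products of first derivatives. -/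
structure IsDominatedFamily {U : Type*} [MeasurableSpace U] {ι : Type*} [Fintype ι]
    [DecidableEq ι] (G : Measure U) (B : Set (EuclideanSpace ℝ ι))
    (p : U → EuclideanSpace ℝ ι → ℝ) : Prop where
  pos : ∀ u, ∀ β ∈ B, 0 < p u β
  measurable : ∀ β ∈ B, Measurable fun u => p u β
  continuousOn : ∀ u, ContinuousOn (p u) B
  log_dominated : ∃ m : U → ℝ, Integrable m G ∧ ∀ u, ∀ β ∈ B, |Real.log (p u β)| ≤ m u
  contDiffOn : ∀ u, ContDiffOn ℝ 2 (fun β => Real.log (p u β)) (interior B)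
  measurable_deriv : ∀ β ∈ interior B, ∀ i,
    Measurable fun u => partialDeriv (fun β' => Real.log (p u β')) i β
  deriv_dominated : ∃ H : U → ℝ, Integrable H G ∧ ∀ u, ∀ β ∈ interior B, ∀ i j,
    |partialDeriv₂ (fun β' => Real.log (p u β')) i j β| ≤ H u ∧
    |partialDeriv (fun β' => Real.log (p u β')) i β *
      partialDeriv (fun β' => Real.log (p u β')) j β| ≤ H u

/-- The setting: `C = (Y, Z, A)` takes values in `𝒴 × 𝒵 × 𝒜`, where `Y` is observed, `Z` is latent
and `A` is auxiliary. `muY`, `muZ`, `muA` are the reference measures (written `dy`, `dz`, `da`),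
`q` is the true density of `C` and `p · β` the candidate density; the marginal candidate density
of `X = (Y, Z)` depends on `β = (θ, φ)` through `θ` only. -/
structure AuxModel (d f : ℕ) (𝒴 𝒵 𝒜 : Type*) [MeasurableSpace 𝒴] [MeasurableSpace 𝒵]
    [MeasurableSpace 𝒜] where
  muY : Measure 𝒴
  muZ : Measure 𝒵
  muA : Measure 𝒜
  sigmaFiniteY : SigmaFinite muY
  sigmaFiniteZ : SigmaFinite muZ
  sigmaFiniteA : SigmaFinite muA
  /-- the parameter space of `β` -/
  paramSet : Set (Param d f)
  /-- the true density `q_c` -/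
  q : 𝒴 × 𝒵 × 𝒜 → ℝ
  /-- the candidate density `p_c(c; β)` -/
  p : 𝒴 × 𝒵 × 𝒜 → Param d f → ℝ
  isDensity_q : IsProbDensity (muY.prod (muZ.prod muA)) q
  isDensity_p : ∀ β ∈ paramSet, IsProbDensity (muY.prod (muZ.prod muA)) fun c => p c β
  marginal_theta : ∀ β ∈ paramSet, ∀ β' ∈ paramSet, β.theta = β'.theta →
    ∀ y z, ∫ a, p (y, z, a) β ∂muA = ∫ a, p (y, z, a) β' ∂muA

namespace AuxModel

variable {d f : ℕ} {𝒴 𝒵 𝒜 : Type*} [MeasurableSpace 𝒴] [MeasurableSpace 𝒵] [MeasurableSpace 𝒜]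

/-- `B = (Y, A)` as a function of `C = (Y, Z, A)`. -/
def toB (c : 𝒴 × 𝒵 × 𝒜) : 𝒴 × 𝒜 := (c.1, c.2.2)

/-- `X = (Y, Z)` as a function of `C = (Y, Z, A)`. -/
def toX (c : 𝒴 × 𝒵 × 𝒜) : 𝒴 × 𝒵 := (c.1, c.2.1)

variable (M : AuxModel d f 𝒴 𝒵 𝒜)

/-- The true law of `C`; the expectation `E` is taken under it. -/
def law : Measure (𝒴 × 𝒵 × 𝒜) :=
  (M.muY.prod (M.muZ.prod M.muA)).withDensity fun c => ENNReal.ofReal (M.q c)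

/-- `q_x(y, z) = ∫ q_c(y, z, a) da`. -/
def qX (x : 𝒴 × 𝒵) : ℝ := ∫ a, M.q (x.1, x.2, a) ∂M.muA

/-- `q_y(y) = ∫ q_x(y, z) dz`. -/
def qY (y : 𝒴) : ℝ := ∫ z, M.qX (y, z) ∂M.muZ

/-- `q_{z|y}(z | y)`. -/
def qZY (x : 𝒴 × 𝒵) : ℝ := M.qX x / M.qY x.1

/-- `p_x(y, z; θ) = ∫ p_c(y, z, a; β) da`, as a function of `β`. -/
def pX (x : 𝒴 × 𝒵) (β : Param d f) : ℝ := ∫ a, M.p (x.1, x.2, a) β ∂M.muA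

/-- `p_y(y; θ) = ∫ p_x(y, z; θ) dz`, as a function of `β`. -/
def pY (y : 𝒴) (β : Param d f) : ℝ := ∫ z, M.pX (y, z) β ∂M.muZ

/-- `p_b(y, a; β) = ∫ p_c(y, z, a; β) dz`. -/
def pB (b : 𝒴 × 𝒜) (β : Param d f) : ℝ := ∫ z, M.p (b.1, z, b.2) β ∂M.muZ

/-- `p_{z|y}(z | y; θ)`, as a function of `β`. -/
def pZY (x : 𝒴 × 𝒵) (β : Param d f) : ℝ := M.pX x β / M.pY x.1 β

/-- `I_b = -E[∇² log p_b(b; β)]`. -/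
def matIb (β : Param d f) : Matrix (Fin d ⊕ Fin f) (Fin d ⊕ Fin f) ℝ :=
  Matrix.of fun i j =>
    -∫ c, partialDeriv₂ (fun β' => Real.log (M.pB (toB c) β')) i j β ∂M.law

/-- `J_b = E[∇ log p_b(b; β) ∇ᵀ log p_b(b; β)]`. -/
def matJb (β : Param d f) : Matrix (Fin d ⊕ Fin f) (Fin d ⊕ Fin f) ℝ :=
  Matrix.of fun i j =>
    ∫ c, partialDeriv (fun β' => Real.log (M.pB (toB c) β')) i β *
      partialDeriv (fun β' => Real.log (M.pB (toB c) β')) j β ∂M.law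

/-- `K_{b,y} = E[∇ log p_b(b; β) ∇ᵀ log p_y(y; θ)]`. -/
def matKby (β : Param d f) : Matrix (Fin d ⊕ Fin f) (Fin d ⊕ Fin f) ℝ :=
  Matrix.of fun i j =>
    ∫ c, partialDeriv (fun β' => Real.log (M.pB (toB c) β')) i β *
      partialDeriv (fun β' => Real.log (M.pY c.1 β')) j β ∂M.law

/-- `I_{z|y} = -E[∇² log p_{z|y}(z | y; θ)]`. -/
def matIzy (β : Param d f) : Matrix (Fin d ⊕ Fin f) (Fin d ⊕ Fin f) ℝ :=
  Matrix.of fun i j =>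
    -∫ c, partialDeriv₂ (fun β' => Real.log (M.pZY (toX c) β')) i j β ∂M.law

/-- `I_y = -E[∇² log p_y(y; θ)]`. -/
def matIy (β : Param d f) : Matrix (Fin d ⊕ Fin f) (Fin d ⊕ Fin f) ℝ :=
  Matrix.of fun i j =>
    -∫ c, partialDeriv₂ (fun β' => Real.log (M.pY c.1 β')) i j β ∂M.law

/-- `J_y = E[∇ log p_y(y; θ) ∇ᵀ log p_y(y; θ)]`. -/
def matJy (β : Param d f) : Matrix (Fin d ⊕ Fin f) (Fin d ⊕ Fin f) ℝ :=
  Matrix.of fun i j =>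
    ∫ c, partialDeriv (fun β' => Real.log (M.pY c.1 β')) i β *
      partialDeriv (fun β' => Real.log (M.pY c.1 β')) j β ∂M.law

/-- The regularity conditions: compact convex parameter space; smoothness and domination for the
candidate families of `B`, `X` and `Y`; a unique maximizer `βbar` of `E[log p_b(b; β)]`, which is
interior to the parameter space; nonsingular `I_b`. -/
structure Regular (βbar : Param d f) : Prop where
  isCompact : IsCompact M.paramSet
  convex : Convex ℝ M.paramSet
  familyB : IsDominatedFamily (M.law.map toB) M.paramSet M.pB
  familyX : IsDominatedFamily (M.law.map toX) M.paramSet M.pX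
  familyY : IsDominatedFamily (M.law.map Prod.fst) M.paramSet M.pY
  mem_interior : βbar ∈ interior M.paramSet
  unique_max : ∀ β ∈ M.paramSet, β ≠ βbar →
    ∫ c, Real.log (M.pB (toB c) β) ∂M.law < ∫ c, Real.log (M.pB (toB c) βbar) ∂M.law
  nonsingular : (M.matIb βbar).det ≠ 0

/-- Correct specification of the latent part: `q_{z|y}(z | y) = p_{z|y}(z | y; θbar)` (for almost
every `(y, z)` with `q_y(y) > 0`, where the true conditional density is defined). -/
def LatentCorrect (βbar : Param d f) : Prop :=
  ∀ᵐ x ∂(M.muY.prod M.muZ), 0 < M.qY x.1 → M.qZY x = M.pZY x βbar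

/-- `ℓ_b(β)`, the log-likelihood of `b_1, …, b_n`, divided by `n`. -/
def ellB {n : ℕ} (b : Fin n → 𝒴 × 𝒜) (β : Param d f) : ℝ :=
  (1 / (n : ℝ)) * ∑ i, Real.log (M.pB (b i) β)

/-- `ℓ_y(θ)`, the log-likelihood of the parts `y_1, …, y_n` of `b_1, …, b_n`, divided by `n`. -/
def ellY {n : ℕ} (b : Fin n → 𝒴 × 𝒜) (β : Param d f) : ℝ :=
  (1 / (n : ℝ)) * ∑ i, Real.log (M.pY (b i).1 β)

/-- `betaHat` is the maximum likelihood estimator of `β` from `b_1, …, b_n`, for every `n`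
(a measurable choice of maximizers of `ℓ_b`). -/
structure IsMLE (betaHat : ∀ n : ℕ, (Fin n → 𝒴 × 𝒜) → Param d f) : Prop where
  measurable : ∀ n, Measurable (betaHat n)
  mem : ∀ n b, betaHat n b ∈ M.paramSet
  isMaxOn : ∀ n b, IsMaxOn (M.ellB b) M.paramSet (betaHat n b)

/-- The loss `L_x(θ) = -∫ q_x(x) log p_x(x; θ) dx`, as a function of `β`. -/
def lossX (β : Param d f) : ℝ := -∫ c, Real.log (M.pX (toX c) β) ∂M.law

/-- `C(q_x) = ∫ q_x(x) log q_{z|y}(z | y) dx`. -/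
def constC : ℝ := ∫ c, Real.log (M.qZY (toX c)) ∂M.law

/-- The criterion
`-2 n ℓ_y(θ̂) + 2 tr(I_b⁻¹ K_{b,y}) + tr(I_{z|y} I_b⁻¹ J_b I_b⁻¹)` at the estimate `β̂ = βest`. -/
def criterion (βbar : Param d f) {n : ℕ} (b : Fin n → 𝒴 × 𝒜) (βest : Param d f) : ℝ :=
  -2 * (n : ℝ) * M.ellY b βest + 2 * ((M.matIb βbar)⁻¹ * M.matKby βbar).trace
    + (M.matIzy βbar * (M.matIb βbar)⁻¹ * M.matJb βbar * (M.matIb βbar)⁻¹).trace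

/-- Takeuchi's criterion `TIC = -2 n ℓ_y(θ̂) + 2 tr(I_y⁻¹ J_y)` at the estimate `β̂ = βest`. -/
def tic (βbar : Param d f) {n : ℕ} (b : Fin n → 𝒴 × 𝒜) (βest : Param d f) : ℝ :=
  -2 * (n : ℝ) * M.ellY b βest + 2 * ((M.matIy βbar)⁻¹ * M.matJy βbar).trace

end AuxModel

end

/-! Let `LX` and `LY` be the means of `log p_x` and `log p_y` as functions of the parameter, and let
`Φ s` be the excess of `LX - LY` at `βbar + s` over its value at `βbar`. Correct specification of
the latent part gives `C(q_x) = LX βbar - LY βbar`. Let `G_n` be the centred sum of the increments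
`log p_y(Y_i; β̂) - log p_y(Y_i; βbar)`, and let `τ₁`, `τ₂` be the two traces of the criterion. Up
to a sum of mean zero, the criterion minus `2 n L_x(β̂) + 2 n C(q_x)` equals `2 τ₁ + τ₂ - 2 G_n + 2
n Φ(β̂ - βbar)`. It remains to show `E[G_n] → τ₁` and `E[n Φ(β̂ - βbar)] → -τ₂ / 2`.

Both limits come from `√n (β̂ - βbar) ≈ I_b⁻¹ S` with `S` the normalized score of `B`. To first
order `G_n` is the inner product of the normalized score of `Y` with `I_b⁻¹ S`, whose mean is
`tr(I_b⁻¹ K_{b,y})`. The function `Φ` has no linear term: by the information inequality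
(`integral_log_pZY_le`) the point `βbar`, defined through `B` alone, also maximizes the mean of `log
p_{z|y}`. So `Φ` is `-1/2` times the quadratic form of `I_{z|y}` up to `o(‖s‖ ^ 2)`
(`latent_expansion`), and `√n (β̂ - βbar)` has limiting second moments `I_b⁻¹ J_b I_b⁻¹`.

The difficulty is that expectations, not merely distributions, must converge, while the envelope `H`
of second derivatives and of squared first derivatives is only integrable. What is needed is
asymptotic uniform integrability of `n ‖β̂ - βbar‖ ^ 2` (`sqTailsSmall_scaled`). Observations with
`H ≤ n` form sums with fourth moments bounded at each scale; finite nets, whose size does not depend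
on the scale, and peeling into dyadic shells bound the empirical process by a small multiple of the
squared scaled distance (`exists_bound_on_ball`, `exists_bound_outside_ball`). Observations with `H
> n` enter through `tailSum`, which tends to zero in mean square (`tendsto_integral_tailSum_sq`).

With tails controlled, comparing the empirical criterion with its quadratic approximation on bounded
sets gives mean square linearization (`tendsto_integral_scaled_sub_sq`). The two limits are then
`tendsto_integral_centeredSum` and `tendsto_integral_quadratic`. -/

/-- `U 0, U 1, …` are independent with common law `ν`. -/
structure IsIIDSample {Ω 𝒰 : Type*} [MeasurableSpace Ω] [MeasurableSpace 𝒰] (P : Measure Ω)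
    (ν : Measure 𝒰) (U : ℕ → Ω → 𝒰) : Prop where
  measurable : ∀ i, Measurable (U i)
  indep : iIndepFun U P
  law : ∀ i, P.map (U i) = ν

/-- The centred sum `∑_{i < n} (φ (U i) - ∫ φ dν)`. -/
noncomputable def centeredSum {Ω 𝒰 : Type*} [MeasurableSpace 𝒰] (ν : Measure 𝒰) (U : ℕ → Ω → 𝒰)
    (φ : 𝒰 → ℝ) (n : ℕ) (ω : Ω) : ℝ :=
  ∑ i ∈ Finset.range n, (φ (U i ω) - ∫ u, φ u ∂ν)

/-! ### Moments of centred sums of i.i.d. variables. -/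

section CenteredSum

variable {Ω 𝒰 : Type*} [MeasurableSpace 𝒰] {ν : Measure 𝒰} {U : ℕ → Ω → 𝒰}

lemma centeredSum_zero (φ : 𝒰 → ℝ) (ω : Ω) : centeredSum ν U φ 0 ω = 0 := by
  simp [centeredSum]

lemma centeredSum_succ (φ : 𝒰 → ℝ) (n : ℕ) (ω : Ω) :
    centeredSum ν U φ (n + 1) ω = centeredSum ν U φ n ω + (φ (U n ω) - ∫ u, φ u ∂ν) := by
  simp only [centeredSum, Finset.sum_range_succ]

lemma centeredSum_eq_sub (φ : 𝒰 → ℝ) (n : ℕ) (ω : Ω) :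
    centeredSum ν U φ n ω = ∑ i ∈ Finset.range n, φ (U i ω) - n * ∫ u, φ u ∂ν := by
  simp [centeredSum, Finset.sum_sub_distrib]

lemma centeredSum_add {φ ψ : 𝒰 → ℝ} (hφ : Integrable φ ν) (hψ : Integrable ψ ν) (n : ℕ) (ω : Ω) :
    centeredSum ν U (fun u => φ u + ψ u) n ω
      = centeredSum ν U φ n ω + centeredSum ν U ψ n ω := by
  simp only [centeredSum_eq_sub, integral_add hφ hψ, Finset.sum_add_distrib]
  ring

lemma centeredSum_sub {φ ψ : 𝒰 → ℝ} (hφ : Integrable φ ν) (hψ : Integrable ψ ν) (n : ℕ) (ω : Ω) :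
    centeredSum ν U (fun u => φ u - ψ u) n ω
      = centeredSum ν U φ n ω - centeredSum ν U ψ n ω := by
  simp only [centeredSum_eq_sub, integral_sub hφ hψ, Finset.sum_sub_distrib]
  ring

lemma centeredSum_const_mul (c : ℝ) (φ : 𝒰 → ℝ) (n : ℕ) (ω : Ω) :
    centeredSum ν U (fun u => c * φ u) n ω = c * centeredSum ν U φ n ω := by
  simp only [centeredSum_eq_sub, integral_const_mul, ← Finset.mul_sum]
  ring

lemma centeredSum_finset_sum {κ : Type*} (s : Finset κ) {φ : κ → 𝒰 → ℝ}
    (hφ : ∀ k ∈ s, Integrable (φ k) ν) (n : ℕ) (ω : Ω) :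
    centeredSum ν U (fun u => ∑ k ∈ s, φ k u) n ω = ∑ k ∈ s, centeredSum ν U (φ k) n ω := by
  simp only [centeredSum_eq_sub, integral_finsetSum s hφ, Finset.sum_sub_distrib, Finset.mul_sum]
  rw [Finset.sum_comm]

lemma abs_centeredSum_le {φ ψ : 𝒰 → ℝ} (hψ : Integrable ψ ν) (h : ∀ u, |φ u| ≤ ψ u) (n : ℕ)
    (ω : Ω) :
    |centeredSum ν U φ n ω| ≤ ∑ i ∈ Finset.range n, ψ (U i ω) + n * ∫ u, ψ u ∂ν := by
  rw [centeredSum_eq_sub]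
  refine (abs_sub _ _).trans (add_le_add ?_ ?_)
  · exact (Finset.abs_sum_le_sum_abs _ _).trans (Finset.sum_le_sum fun i _ => h _)
  · rw [abs_mul, Nat.abs_cast]
    gcongr
    exact (abs_integral_le_integral_abs).trans
      (integral_mono_of_nonneg (ae_of_all _ fun _ => abs_nonneg _) hψ (ae_of_all _ h))

/-- Replaces a whole family of summands by one dominating function at the price of its mean: both
the sum and its centring are dominated, and recentring the sum of `ψ` costs another `n ∫ ψ`. -/
lemma abs_centeredSum_le_centeredSum {φ ψ : 𝒰 → ℝ} (hψ : Integrable ψ ν)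
    (h : ∀ u, |φ u| ≤ ψ u) (n : ℕ) (ω : Ω) :
    |centeredSum ν U φ n ω| ≤ |centeredSum ν U ψ n ω| + 2 * (n * ∫ u, ψ u ∂ν) := by
  have h1 := abs_centeredSum_le (U := U) hψ h n ω
  have h2 := le_abs_self (centeredSum ν U ψ n ω)
  rw [centeredSum_eq_sub] at h2
  rw [centeredSum_eq_sub ψ]
  linarith

namespace IsIIDSample

variable [MeasurableSpace Ω] {P : Measure Ω} (hU : IsIIDSample P ν U)
include hU

lemma measurePreserving (i : ℕ) : MeasurePreserving (U i) P ν :=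
  ⟨hU.measurable i, hU.law i⟩

lemma measurable_centeredSum {φ : 𝒰 → ℝ} (hφ : Measurable φ) (n : ℕ) :
    Measurable (centeredSum ν U φ n) := by
  unfold centeredSum
  exact Finset.measurable_sum _ fun i _ => (hφ.comp (hU.measurable i)).sub_const _

lemma integral_comp {φ : 𝒰 → ℝ} (hφ : Measurable φ) (i : ℕ) :
    ∫ ω, φ (U i ω) ∂P = ∫ u, φ u ∂ν := by
  rw [← hU.law i, integral_map (hU.measurable i).aemeasurable hφ.aestronglyMeasurable]

lemma integrable_comp {φ : 𝒰 → ℝ} (hφ : Integrable φ ν) (i : ℕ) :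
    Integrable (fun ω => φ (U i ω)) P :=
  (hU.measurePreserving i).integrable_comp_of_integrable hφ

lemma memLp_comp {φ : 𝒰 → ℝ} {p : ENNReal} (hφ : MemLp φ p ν) (i : ℕ) :
    MemLp (fun ω => φ (U i ω)) p P :=
  hφ.comp_measurePreserving (hU.measurePreserving i)

lemma ae_comp {p : 𝒰 → Prop} (hp : ∀ᵐ u ∂ν, p u) : ∀ᵐ ω ∂P, ∀ i, p (U i ω) :=
  ae_all_iff.2 fun i => (hU.measurePreserving i).quasiMeasurePreserving.ae hp

variable [IsProbabilityMeasure P]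

lemma memLp_centeredSum {φ : 𝒰 → ℝ} {p : ENNReal} (hφ : MemLp φ p ν) (n : ℕ) :
    MemLp (centeredSum ν U φ n) p P := by
  unfold centeredSum
  exact memLp_finsetSum _ fun i _ => (hU.memLp_comp hφ i).sub (memLp_const _)

lemma integrable_centeredSum {φ : 𝒰 → ℝ} (hφ : Integrable φ ν) (n : ℕ) :
    Integrable (centeredSum ν U φ n) P := by
  rw [← memLp_one_iff_integrable] at hφ ⊢
  exact hU.memLp_centeredSum hφ n

lemma integral_centeredSum {φ : 𝒰 → ℝ} (hm : Measurable φ) (hφ : Integrable φ ν) (n : ℕ) :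
    ∫ ω, centeredSum ν U φ n ω ∂P = 0 := by
  unfold centeredSum
  rw [integral_finsetSum _ fun i _ => (hU.integrable_comp hφ i).sub' (integrable_const _)]
  refine Finset.sum_eq_zero fun i _ => ?_
  rw [integral_sub (hU.integrable_comp hφ i) (integrable_const _), hU.integral_comp hm]
  simp

omit [IsProbabilityMeasure P] in
-- The sum uses the indices below `n` only, so it is a function of a block of variables independent
-- of `U n`. The moment recursions below rest on this.
lemma indepFun_centeredSum {φ : 𝒰 → ℝ} (hφ : Measurable φ) (n : ℕ) :
    IndepFun (centeredSum ν U φ n) (U n) P := by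
  have h := hU.indep.indepFun_finset (Finset.range n) {n} (by simp) hU.measurable
  have h1 : Measurable fun x : (i : Finset.range n) → 𝒰 =>
      ∑ i : Finset.range n, (φ (x i) - ∫ u, φ u ∂ν) :=
    Finset.measurable_sum _ fun i _ => (hφ.comp (measurable_pi_apply i)).sub_const _
  have h2 : Measurable fun x : (i : ({n} : Finset ℕ)) → 𝒰 => x ⟨n, by simp⟩ :=
    measurable_pi_apply _
  have h3 := h.comp h1 h2
  refine (show centeredSum ν U φ n = _ from ?_) ▸ h3
  ext ω
  simp only [centeredSum, Function.comp]
  exact (Finset.sum_attach (Finset.range n) fun i => φ (U i ω) - ∫ u, φ u ∂ν).symm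

omit [IsProbabilityMeasure P] in
lemma integral_mul_next {φ : 𝒰 → ℝ} (hφ : Measurable φ) (n : ℕ) {a : ℝ → ℝ} (ha : Measurable a)
    {b : 𝒰 → ℝ} (hb : Measurable b) :
    ∫ ω, a (centeredSum ν U φ n ω) * b (U n ω) ∂P
      = (∫ ω, a (centeredSum ν U φ n ω) ∂P) * ∫ u, b u ∂ν := by
  have h := (hU.indepFun_centeredSum hφ n).comp ha hb
  rw [← hU.integral_comp hb n]
  exact h.integral_fun_mul_eq_mul_integral
    (ha.comp (hU.measurable_centeredSum hφ n)).aestronglyMeasurable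
    (hb.comp (hU.measurable n)).aestronglyMeasurable

/-- The covariance of two centred sums. -/
lemma integral_centeredSum_mul {φ ψ : 𝒰 → ℝ} (hφm : Measurable φ) (hψm : Measurable ψ)
    (hφ : MemLp φ 2 ν) (hψ : MemLp ψ 2 ν) (n : ℕ) :
    ∫ ω, centeredSum ν U φ n ω * centeredSum ν U ψ n ω ∂P
      = n * (∫ u, φ u * ψ u ∂ν - (∫ u, φ u ∂ν) * ∫ u, ψ u ∂ν) := by
  have : IsProbabilityMeasure ν := by
    rw [← hU.law 0]; exact Measure.isProbabilityMeasure_map (hU.measurable 0).aemeasurable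
  have iφ : Integrable φ ν := hφ.integrable one_le_two
  have iψ : Integrable ψ ν := hψ.integrable one_le_two
  induction n with
  | zero => simp [centeredSum_zero]
  | succ n ih =>
    simp only [centeredSum_succ]
    have mφ := hU.memLp_centeredSum hφ n
    have mψ := hU.memLp_centeredSum hψ n
    have xφ : MemLp (fun ω => φ (U n ω) - ∫ u, φ u ∂ν) 2 P :=
      (hU.memLp_comp hφ n).sub (memLp_const _)
    have xψ : MemLp (fun ω => ψ (U n ω) - ∫ u, ψ u ∂ν) 2 P :=
      (hU.memLp_comp hψ n).sub (memLp_const _)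
    have e1 : ∫ ω, centeredSum ν U φ n ω * (ψ (U n ω) - ∫ u, ψ u ∂ν) ∂P = 0 := by
      have := hU.integral_mul_next hφm n (a := id) measurable_id (b := fun u => ψ u - ∫ u, ψ u ∂ν)
        (hψm.sub_const _)
      rw [integral_sub iψ (integrable_const _)] at this
      simpa using this
    have e2 : ∫ ω, centeredSum ν U ψ n ω * (φ (U n ω) - ∫ u, φ u ∂ν) ∂P = 0 := by
      have := hU.integral_mul_next hψm n (a := id) measurable_id (b := fun u => φ u - ∫ u, φ u ∂ν)
        (hφm.sub_const _)
      rw [integral_sub iφ (integrable_const _)] at this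
      simpa using this
    have e3 : ∫ ω, (φ (U n ω) - ∫ u, φ u ∂ν) * (ψ (U n ω) - ∫ u, ψ u ∂ν) ∂P
        = ∫ u, φ u * ψ u ∂ν - (∫ u, φ u ∂ν) * ∫ u, ψ u ∂ν := by
      rw [hU.integral_comp (φ := fun u => (φ u - ∫ u, φ u ∂ν) * (ψ u - ∫ u, ψ u ∂ν))
        ((hφm.sub_const _).mul (hψm.sub_const _))]
      have : ∀ u, (φ u - ∫ u, φ u ∂ν) * (ψ u - ∫ u, ψ u ∂ν) = φ u * ψ u - (∫ u, φ u ∂ν) * ψ u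
          - (∫ u, ψ u ∂ν) * φ u + (∫ u, φ u ∂ν) * ∫ u, ψ u ∂ν := fun u => by ring
      simp_rw [this]
      have i1 : Integrable (fun u => φ u * ψ u) ν := hφ.integrable_mul hψ
      rw [integral_add ((i1.sub' (iψ.const_mul _)).sub' (iφ.const_mul _)) (integrable_const _),
        integral_sub (i1.sub' (iψ.const_mul _)) (iφ.const_mul _),
        integral_sub i1 (iψ.const_mul _), integral_const_mul, integral_const_mul]
      simp
      ring
    have : ∀ ω, (centeredSum ν U φ n ω + (φ (U n ω) - ∫ u, φ u ∂ν))
        * (centeredSum ν U ψ n ω + (ψ (U n ω) - ∫ u, ψ u ∂ν))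
        = centeredSum ν U φ n ω * centeredSum ν U ψ n ω
          + centeredSum ν U φ n ω * (ψ (U n ω) - ∫ u, ψ u ∂ν)
          + centeredSum ν U ψ n ω * (φ (U n ω) - ∫ u, φ u ∂ν)
          + (φ (U n ω) - ∫ u, φ u ∂ν) * (ψ (U n ω) - ∫ u, ψ u ∂ν) := fun ω => by ring
    simp_rw [this]
    have j1 : Integrable (fun ω => centeredSum ν U φ n ω * centeredSum ν U ψ n ω) P := mφ.integrable_mul mψ
    have j2 : Integrable (fun ω => centeredSum ν U φ n ω * (ψ (U n ω) - ∫ u, ψ u ∂ν)) P := mφ.integrable_mul xψ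
    have j3 : Integrable (fun ω => centeredSum ν U ψ n ω * (φ (U n ω) - ∫ u, φ u ∂ν)) P := mψ.integrable_mul xφ
    have j4 : Integrable (fun ω =>
        (φ (U n ω) - ∫ u, φ u ∂ν) * (ψ (U n ω) - ∫ u, ψ u ∂ν)) P := xφ.integrable_mul xψ
    rw [integral_add ((j1.fun_add j2).fun_add j3) j4, integral_add (j1.fun_add j2) j3]
    rw [integral_add j1 j2]
    rw [ih, e1, e2, e3]
    push_cast
    ring

lemma integral_centeredSum_sq_le {φ : 𝒰 → ℝ} (hφm : Measurable φ) (hφ : MemLp φ 2 ν) (n : ℕ) :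
    ∫ ω, centeredSum ν U φ n ω ^ 2 ∂P ≤ n * ∫ u, φ u ^ 2 ∂ν := by
  simp_rw [sq]
  rw [hU.integral_centeredSum_mul hφm hφm hφ hφ]
  gcongr
  nlinarith [mul_self_nonneg (∫ u, φ u ∂ν)]

/-- The fourth moment of a centred sum of bounded variables. -/
lemma integral_centeredSum_pow_four {φ : 𝒰 → ℝ} (hφm : Measurable φ) {M : ℝ}
    (hM : ∀ u, |φ u| ≤ M) (n : ℕ) :
    ∫ ω, centeredSum ν U φ n ω ^ 4 ∂P
      ≤ n * (16 * ∫ u, φ u ^ 4 ∂ν) + 6 * n ^ 2 * (∫ u, φ u ^ 2 ∂ν) ^ 2 := by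
  have : IsProbabilityMeasure ν := by
    rw [← hU.law 0]; exact Measure.isProbabilityMeasure_map (hU.measurable 0).aemeasurable
  have hb : ∀ p, MemLp φ p ν := fun p =>
    (memLp_top_of_bound hφm.aestronglyMeasurable M (ae_of_all _ hM)).mono_exponent le_top
  set m := ∫ u, φ u ∂ν with hm
  have mM : |m| ≤ M := by
    refine abs_integral_le_integral_abs.trans ?_
    calc ∫ u, |φ u| ∂ν ≤ ∫ _, M ∂ν :=
          integral_mono_of_nonneg (ae_of_all _ fun _ => abs_nonneg _) (integrable_const _)
            (ae_of_all _ hM)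
      _ = M := by simp
  have hM0 : 0 ≤ M := (abs_nonneg _).trans mM
  have hx : ∀ u, |φ u - m| ≤ 2 * M := fun u => (abs_sub _ _).trans (by linarith [hM u])
  have hs : ∀ n ω, |centeredSum ν U φ n ω| ≤ n * (2 * M) := fun n ω => by
    refine (Finset.abs_sum_le_sum_abs _ _).trans ?_
    refine (Finset.sum_le_sum fun i _ => hx _).trans (by simp)
  have bint : ∀ (g : Ω → ℝ) (K : ℝ), Measurable g → (∀ ω, |g ω| ≤ K) → Integrable g P :=
    fun g K hg hK => (integrable_const K).mono' hg.aestronglyMeasurable (ae_of_all _ hK)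
  have bintν : ∀ (g : 𝒰 → ℝ) (K : ℝ), Measurable g → (∀ ω, |g ω| ≤ K) → Integrable g ν :=
    fun g K hg hK => (integrable_const K).mono' hg.aestronglyMeasurable (ae_of_all _ hK)
  have hxm : Measurable fun u => φ u - m := hφm.sub_const _
  have ibp : ∀ k : ℕ, Integrable (fun u => (φ u - m) ^ k) ν := fun k =>
    bintν _ ((2 * M) ^ k) (hxm.pow_const k) fun u => by
      rw [abs_pow]; exact pow_le_pow_left₀ (abs_nonneg _) (hx u) k
  have iφp : ∀ k : ℕ, Integrable (fun u => φ u ^ k) ν := fun k =>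
    bintν _ (M ^ k) (hφm.pow_const k) fun u => by
      rw [abs_pow]; exact pow_le_pow_left₀ (abs_nonneg _) (hM u) k
  have x1 : ∫ u, (φ u - m) ∂ν = 0 := by
    rw [integral_sub ((hb 1).integrable le_rfl) (integrable_const _)]; simp [hm]
  have x2 : ∫ u, (φ u - m) ^ 2 ∂ν ≤ ∫ u, φ u ^ 2 ∂ν := by
    have : ∀ u, (φ u - m) ^ 2 = φ u ^ 2 - 2 * m * φ u + m ^ 2 := fun u => by ring
    simp_rw [this]
    rw [integral_add ((iφp 2).sub' (((hb 1).integrable le_rfl).const_mul _)) (integrable_const _),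
      integral_sub (iφp 2) (((hb 1).integrable le_rfl).const_mul _), integral_const_mul]
    simp
    rw [← hm]; nlinarith [sq_nonneg m]
  have x20 : 0 ≤ ∫ u, (φ u - m) ^ 2 ∂ν := integral_nonneg fun u => sq_nonneg _
  -- Two variances are nonnegative: that of `φ` gives `m ^ 2 ≤ ∫ φ ^ 2`, that of `φ ^ 2` gives `(∫ φ
  -- ^ 2) ^ 2 ≤ ∫ φ ^ 4`.
  have m4 : m ^ 4 ≤ ∫ u, φ u ^ 4 ∂ν := by
    have v1 : m ^ 2 ≤ ∫ u, φ u ^ 2 ∂ν := by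
      have : ∀ u, (φ u - m) ^ 2 = φ u ^ 2 - 2 * m * φ u + m ^ 2 := fun u => by ring
      simp_rw [this] at x20
      rw [integral_add ((iφp 2).sub' (((hb 1).integrable le_rfl).const_mul _)) (integrable_const _),
        integral_sub (iφp 2) (((hb 1).integrable le_rfl).const_mul _), integral_const_mul] at x20
      simp at x20
      rw [← hm] at x20; nlinarith [sq_nonneg m]
    set v := ∫ u, φ u ^ 2 ∂ν
    have v2 : 0 ≤ ∫ u, (φ u ^ 2 - v) ^ 2 ∂ν := integral_nonneg fun u => sq_nonneg _
    have : ∀ u, (φ u ^ 2 - v) ^ 2 = φ u ^ 4 - 2 * v * φ u ^ 2 + v ^ 2 := fun u => by ring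
    simp_rw [this] at v2
    rw [integral_add ((iφp 4).sub' ((iφp 2).const_mul _)) (integrable_const _),
        integral_sub (iφp 4) ((iφp 2).const_mul _), integral_const_mul] at v2
    simp at v2
    nlinarith [sq_nonneg m, v2]
  have x4 : ∫ u, (φ u - m) ^ 4 ∂ν ≤ 16 * ∫ u, φ u ^ 4 ∂ν := by
    have : ∀ u, (φ u - m) ^ 4 ≤ 8 * φ u ^ 4 + 8 * m ^ 4 := fun u => by
      nlinarith [sq_nonneg (φ u + m), sq_nonneg (φ u ^ 2 - m ^ 2), sq_nonneg (φ u * m),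
        sq_nonneg ((φ u + m) ^ 2), sq_nonneg ((φ u + m) * (φ u - m)), mul_nonneg (sq_nonneg (φ u + m)) (sq_nonneg (φ u - m)), sq_nonneg (φ u ^ 2 + m ^ 2 - 2 * φ u * m)]
    calc _ ≤ ∫ u, (8 * φ u ^ 4 + 8 * m ^ 4) ∂ν :=
          integral_mono (ibp 4) (((iφp 4).const_mul _).fun_add (integrable_const _)) this
      _ = 8 * ∫ u, φ u ^ 4 ∂ν + 8 * m ^ 4 := by
          rw [integral_add ((iφp 4).const_mul _) (integrable_const _), integral_const_mul]; simp
      _ ≤ _ := by linarith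
  -- Expand the fourth power of old sum plus new term. The products containing the first power of
  -- either vanish, both being centred, and the cross term `6 n v ^ 2` fits into the growth of `6 n
  -- ^ 2 v ^ 2`.
  have key : ∫ ω, centeredSum ν U φ n ω ^ 4 ∂P
      ≤ n * (∫ u, (φ u - m) ^ 4 ∂ν) + 6 * n ^ 2 * (∫ u, (φ u - m) ^ 2 ∂ν) ^ 2 := by
    induction n with
    | zero => simp [centeredSum_zero]
    | succ n ih =>
      have hsm := hU.measurable_centeredSum (ν := ν) hφm n
      have e : ∀ j k : ℕ, ∫ ω, centeredSum ν U φ n ω ^ j * (φ (U n ω) - m) ^ k ∂P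
          = (∫ ω, centeredSum ν U φ n ω ^ j ∂P) * ∫ u, (φ u - m) ^ k ∂ν := fun j k =>
        hU.integral_mul_next hφm n (a := fun x => x ^ j) (measurable_id.pow_const j)
          (b := fun u => (φ u - m) ^ k) (hxm.pow_const k)
      have i : ∀ j k : ℕ,
          Integrable (fun ω => centeredSum ν U φ n ω ^ j * (φ (U n ω) - m) ^ k) P := fun j k =>
        bint _ ((n * (2 * M)) ^ j * (2 * M) ^ k)
          ((hsm.pow_const j).mul ((hxm.comp (hU.measurable n)).pow_const k)) fun ω => by
            rw [abs_mul, abs_pow, abs_pow]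
            exact mul_le_mul (pow_le_pow_left₀ (abs_nonneg _) (hs n ω) j)
              (pow_le_pow_left₀ (abs_nonneg _) (hx _) k) (by positivity) (by positivity)
      have hexp : ∀ ω, centeredSum ν U φ (n + 1) ω ^ 4
          = centeredSum ν U φ n ω ^ 4 * (φ (U n ω) - m) ^ 0
            + 4 * (centeredSum ν U φ n ω ^ 3 * (φ (U n ω) - m) ^ 1)
            + 6 * (centeredSum ν U φ n ω ^ 2 * (φ (U n ω) - m) ^ 2)
            + 4 * (centeredSum ν U φ n ω ^ 1 * (φ (U n ω) - m) ^ 3)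
            + centeredSum ν U φ n ω ^ 0 * (φ (U n ω) - m) ^ 4 := fun ω => by
        rw [centeredSum_succ]; ring
      simp_rw [hexp]
      have i4 := i 4 0
      have i3 := (i 3 1).const_mul 4
      have i2 := (i 2 2).const_mul 6
      have i1 := (i 1 3).const_mul 4
      have i0 := i 0 4
      rw [integral_add (((i4.fun_add i3).fun_add i2).fun_add i1) i0, integral_add ((i4.fun_add i3).fun_add i2) i1,
        integral_add (i4.fun_add i3) i2]
      rw [integral_add i4 i3]
      simp only [integral_const_mul, e]
      have s1 : ∫ ω, centeredSum ν U φ n ω ^ 1 ∂P = 0 := by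
        simpa using hU.integral_centeredSum hφm ((hb 1).integrable le_rfl) n
      have s2 : ∫ ω, centeredSum ν U φ n ω ^ 2 ∂P ≤ n * ∫ u, (φ u - m) ^ 2 ∂ν := by
        simp_rw [sq]
        rw [hU.integral_centeredSum_mul hφm hφm (hb 2) (hb 2)]
        have : ∀ u, (φ u - m) * (φ u - m) = φ u * φ u - 2 * m * φ u + m ^ 2 := fun u => by ring
        simp_rw [this]
        have i5 : Integrable (fun u => φ u * φ u) ν := (hb 2).integrable_mul (hb 2)
        rw [integral_add (i5.sub' (((hb 1).integrable le_rfl).const_mul _))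
            (integrable_const _),
          integral_sub i5 (((hb 1).integrable le_rfl).const_mul _), integral_const_mul]
        simp
        rw [← hm]
        gcongr
        nlinarith
      have s3 := mul_le_mul_of_nonneg_right s2 x20
      have x1' : ∫ u, (φ u - m) ^ 1 ∂ν = 0 := by simpa using x1
      rw [x1', s1]
      simp only [pow_zero, integral_const, probReal_univ, smul_eq_mul, mul_one, mul_zero, add_zero,
        zero_mul, one_mul]
      push_cast
      generalize ∫ u, (φ u - m) ^ 2 ∂ν = v at *
      nlinarith [mul_nonneg (Nat.cast_nonneg (α := ℝ) n) (sq_nonneg v), sq_nonneg v]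
  refine key.trans ?_
  gcongr

end IsIIDSample

end CenteredSum

/-! ### Truncation of the envelope at the sample size. -/

section Truncation

variable {Ω 𝒰 : Type*} [MeasurableSpace 𝒰] {ν : Measure 𝒰} {U : ℕ → Ω → 𝒰}

/-- `φ` restricted to the points where the envelope `H` is at most `n`. -/
noncomputable def truncBelow (H : 𝒰 → ℝ) (n : ℕ) (φ : 𝒰 → ℝ) : 𝒰 → ℝ :=
  {u | H u ≤ n}.indicator φ

/-- `φ` restricted to the points where the envelope `H` exceeds `n`. -/
noncomputable def truncAbove (H : 𝒰 → ℝ) (n : ℕ) (φ : 𝒰 → ℝ) : 𝒰 → ℝ :=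
  {u | (n : ℝ) < H u}.indicator φ

omit [MeasurableSpace 𝒰] in
lemma truncBelow_add_truncAbove (H : 𝒰 → ℝ) (n : ℕ) (φ : 𝒰 → ℝ) (u : 𝒰) :
    truncBelow H n φ u + truncAbove H n φ u = φ u := by
  by_cases h : H u ≤ n
  · simp [truncBelow, truncAbove, h, not_lt.2 h]
  · simp [truncBelow, truncAbove, h, not_le.1 h]

lemma measurable_truncBelow {H φ : 𝒰 → ℝ} (hH : Measurable H) (hφ : Measurable φ) (n : ℕ) :
    Measurable (truncBelow H n φ) :=
  hφ.indicator (measurableSet_le hH measurable_const)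

lemma measurable_truncAbove {H φ : 𝒰 → ℝ} (hH : Measurable H) (hφ : Measurable φ) (n : ℕ) :
    Measurable (truncAbove H n φ) :=
  hφ.indicator (measurableSet_lt measurable_const hH)

lemma integrable_truncBelow {H φ : 𝒰 → ℝ} (hH : Measurable H) (hφ : Integrable φ ν) (n : ℕ) :
    Integrable (truncBelow H n φ) ν :=
  hφ.indicator (measurableSet_le hH measurable_const)

lemma integrable_truncAbove {H φ : 𝒰 → ℝ} (hH : Measurable H) (hφ : Integrable φ ν) (n : ℕ) :
    Integrable (truncAbove H n φ) ν :=
  hφ.indicator (measurableSet_lt measurable_const hH)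

lemma centeredSum_trunc {H φ : 𝒰 → ℝ} (hH : Measurable H) (hφ : Integrable φ ν) (n m : ℕ) (ω : Ω) :
    centeredSum ν U φ m ω
      = centeredSum ν U (truncBelow H n φ) m ω + centeredSum ν U (truncAbove H n φ) m ω := by
  rw [← centeredSum_add (integrable_truncBelow hH hφ n) (integrable_truncAbove hH hφ n)]
  simp_rw [truncBelow_add_truncAbove]

omit [MeasurableSpace 𝒰] in
lemma abs_truncBelow_le {H φ ψ : 𝒰 → ℝ} {n : ℕ} (h : ∀ u, |φ u| ≤ ψ u) (u : 𝒰) :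
    |truncBelow H n φ u| ≤ truncBelow H n ψ u := by
  by_cases hu : H u ≤ n
  · simp [truncBelow, hu, h u]
  · simp [truncBelow, hu]

omit [MeasurableSpace 𝒰] in
lemma abs_truncAbove_le {H φ ψ : 𝒰 → ℝ} {n : ℕ} (h : ∀ u, |φ u| ≤ ψ u) (u : 𝒰) :
    |truncAbove H n φ u| ≤ truncAbove H n ψ u := by
  by_cases hu : (n : ℝ) < H u
  · simp [truncAbove, hu, h u]
  · simp [truncAbove, hu]

omit [MeasurableSpace 𝒰] in
lemma truncBelow_const_mul (H φ : 𝒰 → ℝ) (n : ℕ) (c : ℝ) :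
    truncBelow H n (fun u => c * φ u) = fun u => c * truncBelow H n φ u := by
  ext u; by_cases hu : H u ≤ n <;> simp [truncBelow, hu]

omit [MeasurableSpace 𝒰] in
lemma truncAbove_const_mul (H φ : 𝒰 → ℝ) (n : ℕ) (c : ℝ) :
    truncAbove H n (fun u => c * φ u) = fun u => c * truncAbove H n φ u := by
  ext u; by_cases hu : (n : ℝ) < H u <;> simp [truncAbove, hu]

omit [MeasurableSpace 𝒰] in
-- On `{H ≤ n}` the factor `√(H / n)` is at most `1`. The first bound makes the second moment `O(a ^
-- 2 / n)`; multiplied by the second bound it makes the fourth moment `O(a ^ 4 / n)`, although `H`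
-- is merely integrable.
lemma truncBelow_sqrt_bound {H φ : 𝒰 → ℝ} {n : ℕ} (hn : 1 ≤ n) (hH0 : ∀ u, 0 ≤ H u) {a : ℝ}
    (h : ∀ u, |φ u| ≤ a * √(H u / n)) (u : 𝒰) :
    truncBelow H n φ u ^ 2 ≤ a ^ 2 * H u / n ∧ truncBelow H n φ u ^ 2 ≤ a ^ 2 := by
  have hn' : (0 : ℝ) < n := by exact_mod_cast hn
  by_cases hu : H u ≤ n
  · have h1 : φ u ^ 2 ≤ a ^ 2 * (H u / n) := by
      rw [← Real.sq_sqrt (div_nonneg (hH0 u) hn'.le), ← mul_pow, ← sq_abs]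
      exact pow_le_pow_left₀ (abs_nonneg _) (h u) 2
    have h2 : H u / n ≤ 1 := (div_le_one hn').2 hu
    simp only [truncBelow, Set.indicator, Set.mem_ofPred_eq, hu, if_true]
    exact ⟨by rwa [mul_div_assoc], h1.trans (by nlinarith [sq_nonneg a])⟩
  · simp only [truncBelow, Set.indicator, Set.mem_ofPred_eq, hu, if_false]
    rw [zero_pow two_ne_zero]
    have := hH0 u
    constructor <;> positivity

end Truncation

namespace IsIIDSample

variable {Ω 𝒰 : Type*} [MeasurableSpace Ω] [MeasurableSpace 𝒰] {P : Measure Ω}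
  [IsProbabilityMeasure P] {ν : Measure 𝒰} {U : ℕ → Ω → 𝒰} (hU : IsIIDSample P ν U)
  {H : 𝒰 → ℝ} (hHm : Measurable H) (hHi : Integrable H ν) (hH0 : ∀ u, 0 ≤ H u)

include hU in
lemma isProbabilityMeasure : IsProbabilityMeasure ν := by
  rw [← hU.law 0]; exact Measure.isProbabilityMeasure_map (hU.measurable 0).aemeasurable

include hU hHm hHi hH0

/-- Fourth moment of a centred sum of truncated variables with a square-integrable envelope. -/
lemma integral_centeredSum_truncBelow_pow_four {φ : 𝒰 → ℝ} (hφ : Measurable φ) {n : ℕ}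
    (hn : 1 ≤ n) {a : ℝ} (ha : 0 ≤ a) (h : ∀ u, |φ u| ≤ a * √(H u / n)) :
    Integrable (fun ω => centeredSum ν U (truncBelow H n φ) n ω ^ 4) P ∧
    ∫ ω, centeredSum ν U (truncBelow H n φ) n ω ^ 4 ∂P
      ≤ (16 * ∫ u, H u ∂ν + 6 * (∫ u, H u ∂ν) ^ 2) * a ^ 4 := by
  have := hU.isProbabilityMeasure
  have hn' : (0 : ℝ) < n := by exact_mod_cast hn
  have hb := truncBelow_sqrt_bound hn hH0 h
  have hm := measurable_truncBelow hHm hφ n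
  have hM : ∀ u, |truncBelow H n φ u| ≤ a := fun u => abs_le_of_sq_le_sq (hb u).2 ha
  have hmem : ∀ p, MemLp (truncBelow H n φ) p ν := fun p =>
    (memLp_top_of_bound hm.aestronglyMeasurable a (ae_of_all _ hM)).mono_exponent le_top
  constructor
  · have := (hU.memLp_centeredSum (hmem 4) n).integrable_norm_pow (p := 4) (by norm_num)
    simpa [Even.pow_abs (show Even 4 by decide)] using this
  refine (hU.integral_centeredSum_pow_four hm hM n).trans ?_
  have i1 : ∫ u, truncBelow H n φ u ^ 2 ∂ν ≤ a ^ 2 / n * ∫ u, H u ∂ν := by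
    rw [← integral_const_mul]
    refine integral_mono_of_nonneg (ae_of_all _ fun _ => sq_nonneg _) (hHi.const_mul _)
      (ae_of_all _ fun u => ?_)
    have := (hb u).1
    simp only; rwa [div_mul_eq_mul_div]
  have i2 : ∫ u, truncBelow H n φ u ^ 4 ∂ν ≤ a ^ 4 / n * ∫ u, H u ∂ν := by
    rw [← integral_const_mul]
    refine integral_mono_of_nonneg (ae_of_all _ fun u => (by positivity : 0 ≤ truncBelow H n φ u ^ 4))
      (hHi.const_mul _) (ae_of_all _ fun u => ?_)
    calc truncBelow H n φ u ^ 4 = truncBelow H n φ u ^ 2 * truncBelow H n φ u ^ 2 := by ring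
      _ ≤ (a ^ 2 * H u / n) * a ^ 2 :=
        mul_le_mul (hb u).1 (hb u).2 (sq_nonneg _) (by have := hH0 u; positivity)
      _ = a ^ 4 / n * H u := by ring
  have i0 : 0 ≤ ∫ u, truncBelow H n φ u ^ 2 ∂ν := integral_nonneg fun _ => sq_nonneg _
  -- The powers of `n` cancel, so the bound is uniform in `n`; this is why the truncation level is
  -- the sample size.
  calc _ ≤ n * (16 * (a ^ 4 / n * ∫ u, H u ∂ν))
        + 6 * n ^ 2 * (a ^ 2 / n * ∫ u, H u ∂ν) ^ 2 := by gcongr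
    _ = _ := by field_simp

end IsIIDSample

/-! ### Negligibility of the observations with large envelope. -/

section Tail

variable {Ω 𝒰 : Type*} [MeasurableSpace 𝒰]

/-- The contribution of the observations whose envelope exceeds `n`. -/
noncomputable def tailSum (ν : Measure 𝒰) (U : ℕ → Ω → 𝒰) (H : 𝒰 → ℝ) (n : ℕ) (ω : Ω) : ℝ :=
  (√n)⁻¹ * ∑ i ∈ Finset.range n, truncAbove H n (fun u => √(H u)) (U i ω)
    + √n * ∫ u, truncAbove H n (fun u => √(H u)) u ∂ν

variable {ν : Measure 𝒰} {U : ℕ → Ω → 𝒰} {H : 𝒰 → ℝ}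

omit [MeasurableSpace 𝒰] in
lemma truncAbove_sqrt_nonneg (n : ℕ) (u : 𝒰) : 0 ≤ truncAbove H n (fun u => √(H u)) u :=
  Set.indicator_nonneg (fun _ _ => Real.sqrt_nonneg _) _

lemma tailSum_nonneg (n : ℕ) (ω : Ω) : 0 ≤ tailSum ν U H n ω :=
  add_nonneg (mul_nonneg (by positivity) (Finset.sum_nonneg fun _ _ => truncAbove_sqrt_nonneg _ _))
    (mul_nonneg (by positivity) (integral_nonneg fun _ => truncAbove_sqrt_nonneg _ _))

lemma memLp_sqrt (hHm : Measurable H) (hHi : Integrable H ν) (hH0 : ∀ u, 0 ≤ H u) :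
    MemLp (fun u => √(H u)) 2 ν := by
  rw [memLp_two_iff_integrable_sq hHm.sqrt.aestronglyMeasurable]
  simpa only [Real.sq_sqrt (hH0 _)] using hHi

lemma tendsto_integral_truncAbove (hHm : Measurable H) (hHi : Integrable H ν) :
    Tendsto (fun n => ∫ u, truncAbove H n H u ∂ν) atTop (𝓝 0) := by
  rw [show (0 : ℝ) = ∫ _, (0 : ℝ) ∂ν by simp]
  refine tendsto_integral_of_dominated_convergence (fun u => |H u|)
    (fun n => (measurable_truncAbove hHm hHm n).aestronglyMeasurable) hHi.abs
    (fun n => ae_of_all _ fun u => ?_) (ae_of_all _ fun u => ?_)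
  · exact norm_indicator_le_norm_self (s := {u | (n : ℝ) < H u}) H u
  · refine tendsto_const_nhds.congr' ?_
    filter_upwards [eventually_ge_atTop ⌈H u⌉₊] with n hn
    have : H u ≤ n := (Nat.le_ceil _).trans (by exact_mod_cast hn)
    simp [truncAbove, this]

variable [MeasurableSpace Ω] {P : Measure Ω} [IsProbabilityMeasure P]

lemma memLp_tailSum (hU : IsIIDSample P ν U) (hHm : Measurable H) (hHi : Integrable H ν)
    (hH0 : ∀ u, 0 ≤ H u) (n : ℕ) : MemLp (tailSum ν U H n) 2 P := by
  have h : MemLp (truncAbove H n fun u => √(H u)) 2 ν :=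
    (memLp_sqrt hHm hHi hH0).indicator (measurableSet_lt measurable_const hHm)
  exact ((memLp_finsetSum _ fun i _ => hU.memLp_comp h i).const_mul _).add (memLp_const _)

lemma integrable_tailSum_sq (hU : IsIIDSample P ν U) (hHm : Measurable H) (hHi : Integrable H ν)
    (hH0 : ∀ u, 0 ≤ H u) (n : ℕ) : Integrable (fun ω => tailSum ν U H n ω ^ 2) P :=
  (memLp_tailSum hU hHm hHi hH0 n).integrable_sq

/-- Where `H > n` one has `√n √H ≤ H`, so the mean term is at most the tail integral of `H`. The
second moment of the normalized centred sum is at most the same tail integral. Integrability of `H`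
therefore suffices. -/
lemma tendsto_integral_tailSum_sq (hU : IsIIDSample P ν U) (hHm : Measurable H)
    (hHi : Integrable H ν) (hH0 : ∀ u, 0 ≤ H u) :
    Tendsto (fun n => ∫ ω, tailSum ν U H n ω ^ 2 ∂P) atTop (𝓝 0) := by
  have := hU.isProbabilityMeasure
  have ht := tendsto_integral_truncAbove hHm hHi
  have h2 : Tendsto (fun n => 2 * ∫ u, truncAbove H n H u ∂ν
      + 8 * (∫ u, truncAbove H n H u ∂ν) ^ 2) atTop (𝓝 0) := by
    simpa using (ht.const_mul 2).add ((ht.pow 2).const_mul 8)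
  refine squeeze_zero' (Eventually.of_forall fun n => integral_nonneg fun _ => sq_nonneg _) ?_ h2
  filter_upwards [eventually_ge_atTop 1] with n hn
  have hn' : (0 : ℝ) < n := by exact_mod_cast hn
  set ψ := truncAbove H n fun u => √(H u) with hψ
  have ψm : Measurable ψ := measurable_truncAbove hHm hHm.sqrt n
  have ψ2 : MemLp ψ 2 ν :=
    (memLp_sqrt hHm hHi hH0).indicator (measurableSet_lt measurable_const hHm)
  have ψsq : ∀ u, ψ u ^ 2 = truncAbove H n H u := fun u => by
    by_cases h : (n : ℝ) < H u <;> simp [hψ, truncAbove, h, Real.sq_sqrt (hH0 u)]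
  have ψle : ∀ u, √n * ψ u ≤ truncAbove H n H u := fun u => by
    by_cases h : (n : ℝ) < H u
    · simp only [hψ, truncAbove, Set.indicator, Set.mem_ofPred_eq, h, if_true]
      calc √n * √(H u) ≤ √(H u) * √(H u) := by gcongr
        _ = H u := Real.mul_self_sqrt (hH0 u)
    · simp [hψ, truncAbove, h]
  have hint : 0 ≤ ∫ u, ψ u ∂ν := integral_nonneg fun _ => truncAbove_sqrt_nonneg _ _
  have hmean : √n * ∫ u, ψ u ∂ν ≤ ∫ u, truncAbove H n H u ∂ν := by
    rw [← integral_const_mul]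
    exact integral_mono ((ψ2.integrable one_le_two).const_mul _) (integrable_truncAbove hHm hHi n)
      ψle
  have hR : ∀ ω, tailSum ν U H n ω ^ 2
      ≤ 2 / n * centeredSum ν U ψ n ω ^ 2 + 8 * (√n * ∫ u, ψ u ∂ν) ^ 2 := fun ω => by
    -- `tailSum` adds the mean to an uncentred sum, hence the factor `2` once the sum is centred.
    have e : tailSum ν U H n ω = (√n)⁻¹ * centeredSum ν U ψ n ω + 2 * (√n * ∫ u, ψ u ∂ν) := by
      rw [tailSum, centeredSum_eq_sub, ← hψ]
      have : (√n)⁻¹ * n = √n := by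
        rw [inv_mul_eq_div, div_eq_iff (by positivity), Real.mul_self_sqrt hn'.le]
      linear_combination (∫ u, ψ u ∂ν) * this
    have e2 : ((√n)⁻¹ * centeredSum ν U ψ n ω) ^ 2 = 1 / n * centeredSum ν U ψ n ω ^ 2 := by
      rw [mul_pow, inv_pow, Real.sq_sqrt hn'.le, one_div]
    rw [e, show (2 : ℝ) / n = 2 * (1 / n) by ring, mul_assoc, ← e2]
    nlinarith [sq_nonneg ((√n)⁻¹ * centeredSum ν U ψ n ω - 2 * (√n * ∫ u, ψ u ∂ν))]
  have i1 : Integrable (fun ω => 2 / n * centeredSum ν U ψ n ω ^ 2) P :=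
    (hU.memLp_centeredSum ψ2 n).integrable_sq.const_mul _
  calc ∫ ω, tailSum ν U H n ω ^ 2 ∂P
      ≤ ∫ ω, (2 / n * centeredSum ν U ψ n ω ^ 2 + 8 * (√n * ∫ u, ψ u ∂ν) ^ 2) ∂P :=
        integral_mono (integrable_tailSum_sq hU hHm hHi hH0 n) (i1.fun_add (integrable_const _)) hR
    _ = 2 / n * (∫ ω, centeredSum ν U ψ n ω ^ 2 ∂P) + 8 * (√n * ∫ u, ψ u ∂ν) ^ 2 := by
        rw [integral_add i1 (integrable_const _), integral_const_mul]; simp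
    _ ≤ 2 / n * (n * ∫ u, ψ u ^ 2 ∂ν) + 8 * (√n * ∫ u, ψ u ∂ν) ^ 2 := by
        gcongr; exact hU.integral_centeredSum_sq_le ψm ψ2 n
    _ = 2 * ∫ u, truncAbove H n H u ∂ν + 8 * (√n * ∫ u, ψ u ∂ν) ^ 2 := by
        simp_rw [ψsq]; field_simp
    _ ≤ _ := by gcongr

end Tail

/-! ### Uniform bounds for the empirical process of a smooth family. -/

/-- Smoothness of the increments `f u s` (with `f u 0 = 0`) of a family of functions on `T ∋ 0`,
with score `D u` at `0` and an integrable envelope `H`. -/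
structure SmoothFamily {𝒰 ι : Type*} [MeasurableSpace 𝒰] [Fintype ι] (ν : Measure 𝒰)
    (T : Set (EuclideanSpace ℝ ι)) (f : 𝒰 → EuclideanSpace ℝ ι → ℝ)
    (D : 𝒰 → EuclideanSpace ℝ ι) (H : 𝒰 → ℝ) : Prop where
  env_meas : Measurable H
  env_int : Integrable H ν
  env_nonneg : ∀ u, 0 ≤ H u
  score_meas : Measurable D
  score_le : ∀ u, ‖D u‖ ≤ √(H u)
  meas : ∀ s ∈ T, Measurable fun u => f u s
  zero : ∀ u, f u 0 = 0
  lip : ∀ u, ∀ s ∈ T, ∀ t ∈ T, |f u s - f u t| ≤ √(H u) * ‖s - t‖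
  lip_sub_linear : ∀ u, ∀ s ∈ T, ∀ t ∈ T, ∀ r, ‖s‖ ≤ r → ‖t‖ ≤ r →
    |f u s - f u t - inner ℝ (D u) (s - t)| ≤ H u * r * ‖s - t‖

/-- Every subset of a ball of radius `ρ` has a finite `2 η ρ`-net of a cardinality that depends on
`η` only. -/
lemma exists_uniform_net {E : Type*} [NormedAddCommGroup E] [NormedSpace ℝ E]
    [FiniteDimensional ℝ E] {η : ℝ} (hη : 0 < η) :
    ∃ F : Finset E, ∀ (S : Set E) (ρ : ℝ), 0 < ρ → S.Nonempty → (∀ s ∈ S, ‖s‖ ≤ ρ) →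
      ∃ rep : E → E, (∀ y, rep y ∈ S) ∧ ∀ s ∈ S, ∃ y ∈ F, ‖s - rep y‖ ≤ 2 * η * ρ := by
  obtain ⟨F, -, hFf, hF⟩ := (isCompact_closedBall (0 : E) 1).finite_cover_balls hη
  refine ⟨hFf.toFinset, fun S ρ hρ ⟨s₀, hs₀⟩ hS => ?_⟩
  classical
  refine ⟨fun y => if h : ∃ s ∈ S, ‖ρ⁻¹ • s - y‖ ≤ η then h.choose else s₀, fun y => ?_,
    fun s hs => ?_⟩
  · by_cases h : ∃ s ∈ S, ‖ρ⁻¹ • s - y‖ ≤ η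
    · simp only [h, dif_pos]; exact h.choose_spec.1
    · simp only [h, dif_neg, not_false_eq_true]; exact hs₀
  · have h1 : ρ⁻¹ • s ∈ Metric.closedBall (0 : E) 1 := by
      rw [mem_closedBall_zero_iff, norm_smul, norm_inv, Real.norm_of_nonneg hρ.le,
        inv_mul_le_iff₀ hρ, mul_one]
      exact hS s hs
    obtain ⟨y, hy, hsy⟩ := Set.mem_iUnion₂.1 (hF h1)
    rw [mem_ball_iff_norm] at hsy
    have h : ∃ s ∈ S, ‖ρ⁻¹ • s - y‖ ≤ η := ⟨s, hs, hsy.le⟩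
    refine ⟨y, hFf.mem_toFinset.2 hy, ?_⟩
    simp only [h, dif_pos]
    have h2 := h.choose_spec.2
    have h3 : ‖ρ⁻¹ • (s - h.choose)‖ ≤ 2 * η := by
      rw [show ρ⁻¹ • (s - h.choose) = (ρ⁻¹ • s - y) - (ρ⁻¹ • h.choose - y) by
        rw [smul_sub]; abel]
      exact (norm_sub_le _ _).trans (by linarith)
    rwa [norm_smul, norm_inv, Real.norm_of_nonneg hρ.le, inv_mul_le_iff₀ hρ, mul_comm] at h3

/-- Either `|x| ≤ b` or `|x| b ^ 3 ≤ x ^ 4`. It splits a random sum at scale `a` into a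
deterministic part `b = θ a ^ 2` and a part of expectation `O(a ^ 4 / b ^ 3) = O(1 / a ^ 2)`, which
is summable over dyadic scales. -/
lemma abs_le_add_pow_four_div {x b : ℝ} (hb : 0 < b) : |x| ≤ b + x ^ 4 / b ^ 3 := by
  have h4 : 0 ≤ x ^ 4 / b ^ 3 := by positivity
  rcases le_or_gt |x| b with h | h
  · linarith
  · have : |x| ≤ x ^ 4 / b ^ 3 := by
      rw [le_div_iff₀ (by positivity)]
      calc |x| * b ^ 3 ≤ |x| * |x| ^ 3 := by gcongr
        _ = x ^ 4 := by rw [← Even.pow_abs (show Even 4 by decide)]; ring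
    linarith

lemma EuclideanSpace.abs_apply_le_norm {ι : Type*} [Fintype ι] (x : EuclideanSpace ℝ ι) (k : ι) :
    |x k| ≤ ‖x‖ := by
  simpa using PiLp.norm_apply_le x k

lemma EuclideanSpace.norm_le_sum_abs {ι : Type*} [Fintype ι] (x : EuclideanSpace ℝ ι) :
    ‖x‖ ≤ ∑ k, |x k| := by
  rw [EuclideanSpace.norm_eq]
  refine Real.sqrt_le_iff.2 ⟨Finset.sum_nonneg fun _ _ => abs_nonneg _, ?_⟩
  simp only [Real.norm_eq_abs]
  exact Finset.sum_sq_le_sq_sum_of_nonneg fun _ _ => abs_nonneg _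

/-- The envelope `min (a √(H / n)) (H a² / n)` of second-order remainders at scaled distance `a`. -/
noncomputable def remainderEnvelope {𝒰 : Type*} (H : 𝒰 → ℝ) (n : ℕ) (a : ℝ) (u : 𝒰) : ℝ :=
  min (a * √(H u / n)) (H u * a ^ 2 / n)

lemma remainderEnvelope_nonneg {𝒰 : Type*} {H : 𝒰 → ℝ} (hH : ∀ u, 0 ≤ H u) (n : ℕ) {a : ℝ}
    (ha : 0 ≤ a) (u : 𝒰) : 0 ≤ remainderEnvelope H n a u :=
  le_min (by positivity) (by have := hH u; positivity)

lemma measurable_remainderEnvelope {𝒰 : Type*} [MeasurableSpace 𝒰] {H : 𝒰 → ℝ} (hH : Measurable H)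
    (n : ℕ) (a : ℝ) : Measurable (remainderEnvelope H n a) :=
  ((hH.div_const _).sqrt.const_mul _).min ((hH.mul_const _).div_const _)

namespace SmoothFamily

variable {Ω 𝒰 ι : Type*} [MeasurableSpace Ω] [MeasurableSpace 𝒰] [Fintype ι] {P : Measure Ω}
  [IsProbabilityMeasure P] {ν : Measure 𝒰} {U : ℕ → Ω → 𝒰}
  {T : Set (EuclideanSpace ℝ ι)} {f : 𝒰 → EuclideanSpace ℝ ι → ℝ}
  {D : 𝒰 → EuclideanSpace ℝ ι} {H : 𝒰 → ℝ} (hf : SmoothFamily ν T f D H)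

include hf

lemma memLp_sqrt_env : MemLp (fun u => √(H u)) 2 ν :=
  memLp_sqrt hf.env_meas hf.env_int hf.env_nonneg

lemma abs_le (h0 : (0 : EuclideanSpace ℝ ι) ∈ T) (u : 𝒰) {s : EuclideanSpace ℝ ι} (hs : s ∈ T) :
    |f u s| ≤ ‖s‖ * √(H u) := by
  simpa [hf.zero, mul_comm] using hf.lip u s hs 0 h0

lemma memLp (h0 : (0 : EuclideanSpace ℝ ι) ∈ T) {s : EuclideanSpace ℝ ι} (hs : s ∈ T) :
    MemLp (fun u => f u s) 2 ν :=
  (hf.memLp_sqrt_env.const_mul ‖s‖).mono' (hf.meas s hs).aestronglyMeasurable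
    (ae_of_all _ fun u => by simpa using hf.abs_le h0 u hs)

lemma measurable_score_apply (k : ι) : Measurable fun u => D u k :=
  (EuclideanSpace.proj (𝕜 := ℝ) k).continuous.measurable.comp hf.score_meas

lemma abs_score_apply_le (u : 𝒰) (k : ι) : |D u k| ≤ √(H u) :=
  (EuclideanSpace.abs_apply_le_norm _ _).trans (hf.score_le u)

lemma memLp_score_apply (k : ι) : MemLp (fun u => D u k) 2 ν :=
  hf.memLp_sqrt_env.mono' (hf.measurable_score_apply k).aestronglyMeasurable
    (ae_of_all _ fun u => hf.abs_score_apply_le u k)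

lemma integral_env_nonneg : 0 ≤ ∫ u, H u ∂ν := integral_nonneg hf.env_nonneg

/-- The modulus of the second-order remainders on the ball of scaled radius `a`. -/
lemma abs_centeredSum_truncBelow_le (hU : IsIIDSample P ν U) (h0 : (0 : EuclideanSpace ℝ ι) ∈ T)
    {η : ℝ} (hη : 0 < η) (hη1 : η ≤ 1) {n : ℕ} (hn : 1 ≤ n) {a : ℝ} (ha : 0 < a)
    {s s' : EuclideanSpace ℝ ι} (hs : s ∈ T) (hs'T : s' ∈ T) (hsa : √n * ‖s‖ ≤ a)
    (hsa' : √n * ‖s'‖ ≤ a) (hsy : ‖s - s'‖ ≤ 2 * η * (a / √n)) (ω : Ω) :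
    |centeredSum ν U (truncBelow H n fun u => f u s) n ω|
      ≤ |centeredSum ν U (truncBelow H n fun u => f u s') n ω|
        + ∑ k, 2 * |centeredSum ν U (truncBelow H n fun u => a / √n * D u k) n ω|
        + 4 * |centeredSum ν U (truncBelow H n (remainderEnvelope H n a)) n ω|
        + 8 * η * (∫ u, H u ∂ν) * a ^ 2 := by
  have := hU.isProbabilityMeasure
  set h := ∫ u, H u ∂ν with hh
  have hn' : (0 : ℝ) < n := by exact_mod_cast hn
  have hsn : 0 < √(n : ℝ) := Real.sqrt_pos.2 hn'
  have sq_n : √(n : ℝ) * √n = n := Real.mul_self_sqrt hn'.le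
  have sqd : ∀ u, √(H u / n) = √(H u) / √n := fun u => Real.sqrt_div' _ hn'.le
  let Z₁ : Ω → ℝ := centeredSum ν U (truncBelow H n fun u => f u s') n
  let Z₂ : ι → Ω → ℝ := fun k => centeredSum ν U (truncBelow H n fun u => a / √n * D u k) n
  set q : 𝒰 → ℝ := remainderEnvelope H n a with hq
  let Z₃ : Ω → ℝ := centeredSum ν U (truncBelow H n q) n
  have q0 : ∀ u, 0 ≤ q u := remainderEnvelope_nonneg hf.env_nonneg n ha.le
  have qm : Measurable q := measurable_remainderEnvelope hf.env_meas n a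
  have iD : ∀ k, Integrable (fun u => D u k) ν := fun k =>
    (hf.memLp_score_apply k).integrable one_le_two
  have if1 : ∀ t ∈ T, Integrable (fun u => f u t) ν := fun t ht =>
    (hf.memLp h0 ht).integrable one_le_two
  -- The increment from `s'` to `s` splits into a linear part, controlled by the finitely many
  -- coordinate sums `Z₂`, and the remainder `ρ`, dominated by a small multiple of one envelope `q`
  -- for all pairs at once.
  let ρ : 𝒰 → ℝ := fun u => f u s - f u s' - inner ℝ (D u) (s - s')
  have inner_eq : ∀ u, inner ℝ (D u) (s - s')
      = ∑ k, (√n / a * (s - s') k) * (a / √n * D u k) := fun u => by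
    rw [PiLp.inner_apply]
    refine Finset.sum_congr rfl fun k _ => ?_
    simp only [RCLike.inner_apply, conj_trivial]
    field_simp
  have ilin : ∀ k, Integrable (fun u => (√n / a * (s - s') k) * (a / √n * D u k)) ν := fun k =>
    ((iD k).const_mul _).const_mul _
  have iinner : Integrable (fun u => inner ℝ (D u) (s - s')) ν := by
    simp_rw [inner_eq]; exact integrable_finsetSum _ fun k _ => ilin k
  have iρ : Integrable ρ ν := ((if1 s hs).sub' (if1 s' hs'T)).sub' iinner
  have iq : Integrable q ν := by
    refine ((hf.env_int.mul_const (a ^ 2)).div_const n).mono' qm.aestronglyMeasurable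
      (ae_of_all _ fun u => ?_)
    rw [Real.norm_of_nonneg (q0 u)]; exact min_le_right _ _
  -- The Lipschitz bounds yield the first member of the minimum in `remainderEnvelope`, the
  -- second-order bound the second; both gain the factor `η` from the mesh.
  have hρ : ∀ u, |ρ u| ≤ 4 * η * q u := fun u => by
    have hr : ∀ {t : EuclideanSpace ℝ ι}, √n * ‖t‖ ≤ a → ‖t‖ ≤ a / √n := fun {t} ht => by
      rw [le_div_iff₀ hsn, mul_comm]; exact ht
    have h1 := hf.lip_sub_linear u s hs s' hs'T (a / √n) (hr hsa) (hr hsa')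
    have h2 : |ρ u| ≤ 2 * √(H u) * ‖s - s'‖ := by
      refine (abs_sub _ _).trans ?_
      have := hf.lip u s hs s' hs'T
      have h3 := (abs_real_inner_le_norm (D u) (s - s')).trans
        (mul_le_mul_of_nonneg_right (hf.score_le u) (norm_nonneg _))
      linarith
    have hHu := hf.env_nonneg u
    rw [show 4 * η * q u = min (4 * η * (a * √(H u / n))) (4 * η * (H u * a ^ 2 / n)) from
      mul_min_of_nonneg _ _ (by positivity)]
    refine le_min (h2.trans ?_) (h1.trans ?_)
    · calc 2 * √(H u) * ‖s - s'‖ ≤ 2 * √(H u) * (2 * η * (a / √n)) := by gcongr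
        _ = _ := by rw [sqd]; ring
    · calc H u * (a / √n) * ‖s - s'‖ ≤ H u * (a / √n) * (2 * η * (a / √n)) := by gcongr
        _ = 2 * η * (H u * a ^ 2 / (√n * √n)) := by field_simp
        _ ≤ 4 * η * (H u * a ^ 2 / n) := by
          rw [sq_n]; have : 0 ≤ H u * a ^ 2 / n := by positivity
          nlinarith
  have decomp : (truncBelow H n fun u => f u s) = fun u => truncBelow H n (fun u => f u s') u
      + (truncBelow H n ρ u + ∑ k, (√n / a * (s - s') k)
        * truncBelow H n (fun u => a / √n * D u k) u) := by
    ext u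
    by_cases hu : H u ≤ n
    · simp only [truncBelow, Set.indicator, Set.mem_ofPred_eq, hu, if_true, ρ]
      rw [← inner_eq]; ring
    · simp [truncBelow, hu]
  have iB : ∀ {φ : 𝒰 → ℝ}, Integrable φ ν → Integrable (truncBelow H n φ) ν := fun hφ =>
    integrable_truncBelow hf.env_meas hφ n
  have iBk : ∀ k, Integrable (fun u => (√n / a * (s - s') k)
        * truncBelow H n (fun u => a / √n * D u k) u) ν := fun k =>
    (iB ((iD k).const_mul _)).const_mul _
  have hsum : centeredSum ν U (truncBelow H n fun u => f u s) n ω = Z₁ ω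
      + (centeredSum ν U (truncBelow H n ρ) n ω + ∑ k, (√n / a * (s - s') k) * Z₂ k ω) := by
    rw [decomp, centeredSum_add (iB (if1 s' hs'T))
      ((iB iρ).fun_add (integrable_finsetSum _ fun k _ => iBk k)),
      centeredSum_add (iB iρ) (integrable_finsetSum _ fun k _ => iBk k),
      centeredSum_finset_sum _ fun k _ => iBk k]
    simp_rw [centeredSum_const_mul]
    rfl
  have t₂ : |∑ k, (√n / a * (s - s') k) * Z₂ k ω| ≤ ∑ k, 2 * |Z₂ k ω| := by
    refine (Finset.abs_sum_le_sum_abs _ _).trans (Finset.sum_le_sum fun k _ => ?_)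
    rw [abs_mul]
    gcongr
    rw [abs_mul, abs_of_pos (by positivity)]
    calc √n / a * |(s - s') k| ≤ √n / a * (2 * η * (a / √n)) := by
          gcongr; exact (EuclideanSpace.abs_apply_le_norm _ _).trans hsy
      _ = 2 * η := by field_simp
      _ ≤ 2 := by linarith
  have t₃ : |centeredSum ν U (truncBelow H n ρ) n ω| ≤ 4 * |Z₃ ω| + 8 * η * h * a ^ 2 := by
    have h1 := abs_centeredSum_le_centeredSum (U := U) (iB (iq.const_mul (4 * η)))
      (abs_truncBelow_le hρ) n ω
    rw [truncBelow_const_mul, centeredSum_const_mul, integral_const_mul, abs_mul,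
      abs_of_pos (by positivity : 0 < 4 * η)] at h1
    have h2 : ∫ u, truncBelow H n q u ∂ν ≤ h * a ^ 2 / n := by
      rw [hh, ← integral_mul_const, ← integral_div]
      refine integral_mono (iB iq) ((hf.env_int.mul_const (a ^ 2)).div_const n) fun u => ?_
      have hHu := hf.env_nonneg u
      by_cases hu : H u ≤ n
      · simp only [truncBelow, Set.indicator, Set.mem_ofPred_eq, hu, if_true]
        exact min_le_right _ _
      · simp only [truncBelow, Set.indicator, Set.mem_ofPred_eq, hu, if_false]; positivity
    have h3 : n * ∫ u, truncBelow H n q u ∂ν ≤ h * a ^ 2 := by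
      calc _ ≤ n * (h * a ^ 2 / n) := by gcongr
        _ = _ := by field_simp
    have h4 : |centeredSum ν U (truncBelow H n q) n ω| = |Z₃ ω| := rfl
    rw [h4] at h1
    have h5 : 2 * (n * (4 * η * ∫ u, truncBelow H n q u ∂ν)) ≤ 8 * η * h * a ^ 2 := by
      nlinarith
    have h7 : 4 * η * |Z₃ ω| ≤ 4 * |Z₃ ω| := by nlinarith [abs_nonneg (Z₃ ω)]
    linarith
  rw [hsum]
  refine (abs_add_le _ _).trans ?_
  have := abs_add_le (centeredSum ν U (truncBelow H n ρ) n ω) (∑ k, (√n / a * (s - s') k) * Z₂ k ω)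
  change |Z₁ ω| + _ ≤ |Z₁ ω| + ∑ k, 2 * |Z₂ k ω| + 4 * |Z₃ ω| + _
  linarith

/-- Control of the truncated empirical process on a ball. -/
lemma exists_bound_on_ball (hU : IsIIDSample P ν U) (h0 : (0 : EuclideanSpace ℝ ι) ∈ T) {ε : ℝ}
    (hε : 0 < ε) :
    ∃ C, 0 ≤ C ∧ ∀ n : ℕ, 1 ≤ n → ∀ a : ℝ, 0 < a → ∃ G : Ω → ℝ, (∀ ω, 0 ≤ G ω) ∧
      Integrable G P ∧ ∫ ω, G ω ∂P ≤ C / a ^ 2 ∧ ∀ ω, ∀ s ∈ T, √n * ‖s‖ ≤ a →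
        |centeredSum ν U (truncBelow H n fun u => f u s) n ω| ≤ ε * a ^ 2 + G ω := by
  have := hU.isProbabilityMeasure
  set h := ∫ u, H u ∂ν with hh
  have h_nonneg : 0 ≤ h := hf.integral_env_nonneg
  -- The mesh is so fine that the mean of the remainder envelope, `8 η h a ^ 2`, uses at most half
  -- of `ε a ^ 2`. The deterministic parts of the sums use the other half, through `N θ = ε / 2`.
  set η := min 1 (ε / (16 * (h + 1))) with hηdef
  have hη : 0 < η := lt_min one_pos (by positivity)
  have hη1 : η ≤ 1 := min_le_left _ _
  have hηε : 8 * η * h ≤ ε / 2 := by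
    have : η ≤ ε / (16 * (h + 1)) := min_le_right _ _
    rw [le_div_iff₀ (by positivity)] at this
    nlinarith
  obtain ⟨F, hF⟩ := exists_uniform_net (E := EuclideanSpace ℝ ι) hη
  set N : ℝ := F.card + 2 * Fintype.card ι + 4 with hN
  have hN0 : 0 < N := by positivity
  set θ := ε / (2 * N) with hθ
  have hθ0 : 0 < θ := by positivity
  set C₄ := 16 * h + 6 * h ^ 2 with hC4
  refine ⟨N * C₄ / θ ^ 3, by positivity, fun n hn a ha => ?_⟩
  have hn' : (0 : ℝ) < n := by exact_mod_cast hn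
  have hsn : 0 < √(n : ℝ) := Real.sqrt_pos.2 hn'
  obtain ⟨rep, hrep, hnet⟩ := hF {s | s ∈ T ∧ √n * ‖s‖ ≤ a} (a / √n) (by positivity)
    ⟨0, h0, by simp [ha.le]⟩ fun s hs => by
      rw [le_div_iff₀ hsn, mul_comm]; exact hs.2
  have sqd : ∀ u, √(H u / n) = √(H u) / √n := fun u => Real.sqrt_div' _ hn'.le
  let Z₁ : EuclideanSpace ℝ ι → Ω → ℝ := fun y =>
    centeredSum ν U (truncBelow H n fun u => f u (rep y)) n
  let Z₂ : ι → Ω → ℝ := fun k => centeredSum ν U (truncBelow H n fun u => a / √n * D u k) n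
  let q : 𝒰 → ℝ := remainderEnvelope H n a
  let Z₃ : Ω → ℝ := centeredSum ν U (truncBelow H n q) n
  have q0 : ∀ u, 0 ≤ q u := remainderEnvelope_nonneg hf.env_nonneg n ha.le
  have qm : Measurable q := measurable_remainderEnvelope hf.env_meas n a
  have b₁ : ∀ y, Integrable (fun ω => Z₁ y ω ^ 4) P ∧ ∫ ω, Z₁ y ω ^ 4 ∂P ≤ C₄ * a ^ 4 := fun y =>
    hU.integral_centeredSum_truncBelow_pow_four hf.env_meas hf.env_int hf.env_nonneg
      (hf.meas _ (hrep y).1) hn ha.le fun u => by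
        refine (hf.abs_le h0 u (hrep y).1).trans ?_
        rw [sqd, mul_div_assoc', mul_comm, le_div_iff₀ hsn]
        have := (hrep y).2
        nlinarith [Real.sqrt_nonneg (H u)]
  have b₂ : ∀ k, Integrable (fun ω => Z₂ k ω ^ 4) P ∧ ∫ ω, Z₂ k ω ^ 4 ∂P ≤ C₄ * a ^ 4 := fun k =>
    hU.integral_centeredSum_truncBelow_pow_four hf.env_meas hf.env_int hf.env_nonneg
      ((hf.measurable_score_apply k).const_mul _) hn ha.le fun u => by
        rw [abs_mul, abs_of_pos (by positivity), sqd, div_mul_eq_mul_div, mul_div_assoc']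
        have := hf.abs_score_apply_le u k
        gcongr
  have b₃ : Integrable (fun ω => Z₃ ω ^ 4) P ∧ ∫ ω, Z₃ ω ^ 4 ∂P ≤ C₄ * a ^ 4 :=
    hU.integral_centeredSum_truncBelow_pow_four hf.env_meas hf.env_int hf.env_nonneg
      qm hn ha.le fun u => by rw [abs_of_nonneg (q0 u)]; exact min_le_left _ _
  set c := (θ * a ^ 2) ^ 3 with hc
  have hc0 : 0 < c := by positivity
  -- Fourth powers of finitely many sums, each of expectation `O(a ^ 4)`, over `(θ a ^ 2) ^ 3`; this
  -- is where the decay `C / a ^ 2` comes from.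
  let G : Ω → ℝ := fun ω =>
    (∑ y ∈ F, Z₁ y ω ^ 4 + 2 * ∑ k, Z₂ k ω ^ 4 + 4 * Z₃ ω ^ 4) / c
  have iG₁ : Integrable (fun ω => ∑ y ∈ F, Z₁ y ω ^ 4) P := integrable_finsetSum _ fun y _ => (b₁ y).1
  have iG₂ : Integrable (fun ω => ∑ k, Z₂ k ω ^ 4) P := integrable_finsetSum _ fun y _ => (b₂ y).1
  refine ⟨G, fun ω => by positivity,
    ((iG₁.fun_add (iG₂.const_mul 2)).fun_add (b₃.1.const_mul 4)).div_const _, ?_, ?_⟩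
  · have e : ∫ ω, G ω ∂P = (∑ y ∈ F, ∫ ω, Z₁ y ω ^ 4 ∂P + 2 * ∑ k, ∫ ω, Z₂ k ω ^ 4 ∂P
        + 4 * ∫ ω, Z₃ ω ^ 4 ∂P) / c := by
      simp only [G]
      rw [integral_div, integral_add (iG₁.fun_add (iG₂.const_mul 2)) (b₃.1.const_mul 4),
        integral_add iG₁ (iG₂.const_mul 2), integral_const_mul, integral_const_mul,
        integral_finsetSum _ fun y _ => (b₁ y).1, integral_finsetSum _ fun y _ => (b₂ y).1]
    rw [e]
    have s₁ : ∑ y ∈ F, ∫ ω, Z₁ y ω ^ 4 ∂P ≤ F.card * (C₄ * a ^ 4) := by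
      simpa using Finset.sum_le_card_nsmul F _ _ fun y _ => (b₁ y).2
    have s₂ : ∑ k, ∫ ω, Z₂ k ω ^ 4 ∂P ≤ Fintype.card ι * (C₄ * a ^ 4) := by
      simpa using Finset.sum_le_card_nsmul Finset.univ _ _ fun y _ => (b₂ y).2
    calc _ ≤ (N * (C₄ * a ^ 4)) / c := by
          gcongr; rw [hN]; nlinarith [b₃.2]
      _ = _ := by rw [hc]; field_simp
  · intro ω s hs hsa
    obtain ⟨y, hy, hsy⟩ := hnet s ⟨hs, hsa⟩
    set s' := rep y with hs'
    have hs'T : s' ∈ T := (hrep y).1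
    have key := hf.abs_centeredSum_truncBelow_le hU h0 hη hη1 hn ha hs hs'T hsa (hrep y).2 hsy ω
    change _ ≤ |Z₁ y ω| + ∑ k, 2 * |Z₂ k ω| + 4 * |Z₃ ω| + _ at key
    have h6 : 8 * η * h * a ^ 2 ≤ ε / 2 * a ^ 2 := by gcongr
    have hb : 0 < θ * a ^ 2 := by positivity
    have u₁ : |Z₁ y ω| ≤ F.card * (θ * a ^ 2) + (∑ y ∈ F, Z₁ y ω ^ 4) / c := by
      have h1 : |Z₁ y ω| ≤ ∑ y ∈ F, |Z₁ y ω| :=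
        Finset.single_le_sum (f := fun y => |Z₁ y ω|) (fun _ _ => abs_nonneg _) hy
      have h2 : ∑ y ∈ F, |Z₁ y ω| ≤ ∑ y ∈ F, (θ * a ^ 2 + Z₁ y ω ^ 4 / c) :=
        Finset.sum_le_sum fun y _ => abs_le_add_pow_four_div hb
      rw [Finset.sum_add_distrib, Finset.sum_const, nsmul_eq_mul, ← Finset.sum_div] at h2
      exact h1.trans h2
    have u₂ : ∑ k, 2 * |Z₂ k ω|
        ≤ 2 * Fintype.card ι * (θ * a ^ 2) + 2 * (∑ k, Z₂ k ω ^ 4) / c := by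
      have h2 : ∑ k, |Z₂ k ω| ≤ ∑ k, (θ * a ^ 2 + Z₂ k ω ^ 4 / c) :=
        Finset.sum_le_sum fun y _ => abs_le_add_pow_four_div hb
      rw [Finset.sum_add_distrib, Finset.sum_const, nsmul_eq_mul, ← Finset.sum_div,
        Finset.card_univ] at h2
      rw [← Finset.mul_sum, mul_div_assoc, mul_assoc, ← mul_add]
      gcongr
    have u₃ : |Z₃ ω| ≤ θ * a ^ 2 + Z₃ ω ^ 4 / c := abs_le_add_pow_four_div hb
    have uG : G ω = (∑ y ∈ F, Z₁ y ω ^ 4) / c + 2 * (∑ k, Z₂ k ω ^ 4) / c + 4 * (Z₃ ω ^ 4 / c) := by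
      simp only [G]; ring
    have uN : N * (θ * a ^ 2) = ε / 2 * a ^ 2 := by rw [hθ]; field_simp
    rw [hN] at uN
    rw [uG]
    nlinarith

/-- Uniform control of the empirical process by a small multiple of the squared scaled distance. -/
lemma exists_bound_outside_ball (hU : IsIIDSample P ν U) (h0 : (0 : EuclideanSpace ℝ ι) ∈ T)
    {ρ : ℝ} (hT : ∀ s ∈ T, ‖s‖ ≤ ρ) {ε : ℝ} (hε : 0 < ε) :
    ∃ C, 0 ≤ C ∧ ∀ n : ℕ, 1 ≤ n → ∀ L : ℕ, ∃ G : Ω → ℝ, (∀ ω, 0 ≤ G ω) ∧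
      Integrable G P ∧ ∫ ω, G ω ∂P ≤ C / 4 ^ L ∧ ∀ ω, ∀ s ∈ T, 2 ^ L ≤ √n * ‖s‖ →
        |centeredSum ν U (fun u => f u s) n ω|
          ≤ ε * (√n * ‖s‖) ^ 2 + G ω + √n * ‖s‖ * tailSum ν U H n ω := by
  obtain ⟨C, hC, hball⟩ := hf.exists_bound_on_ball hU h0 (show 0 < ε / 4 by positivity)
  refine ⟨C, hC, fun n hn L => ?_⟩
  have hn' : (0 : ℝ) < n := by exact_mod_cast hn
  have hsn : 0 < √(n : ℝ) := Real.sqrt_pos.2 hn'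
  -- Peeling: on the shell `2 ^ m ≤ √n ‖s‖ < 2 ^ (m + 1)` the bound for the ball of radius `2 ^ (m +
  -- 1)` is used. The square of that radius is at most `4 (√n ‖s‖) ^ 2`, hence `ε / 4` above.
  choose G hG0 hGi hGC hG using fun l : ℕ => hball n hn (2 ^ (l + 1)) (by positivity)
  -- As `T` is bounded, only finitely many shells occur for each `n`. Their number depends on `n`,
  -- but the geometric sum below is bounded independently of it.
  obtain ⟨Λ, hΛ⟩ := pow_unbounded_of_one_lt (√n * ρ) (one_lt_two (α := ℝ))
  refine ⟨fun ω => ∑ l ∈ Finset.range Λ, G (L + l) ω, fun ω => Finset.sum_nonneg fun l _ => hG0 _ _,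
    integrable_finsetSum _ fun l _ => hGi _, ?_, fun ω s hs hLs => ?_⟩
  · rw [integral_finsetSum _ fun l _ => hGi _]
    have hterm : ∀ l, ∫ ω, G (L + l) ω ∂P ≤ C / 4 ^ L / 2 * (1 / 2) ^ l := fun l => by
      refine (hGC _).trans ?_
      have e : ((2 : ℝ) ^ (L + l + 1)) ^ 2 = 4 ^ L * 4 ^ l * 4 := by
        rw [← pow_mul, mul_comm, pow_mul, pow_add, pow_add]; norm_num
      rw [e, div_div, one_div, inv_pow, ← div_eq_mul_inv, div_div]
      refine div_le_div_of_nonneg_left hC (by positivity) ?_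
      have : (2 : ℝ) ^ l ≤ 4 ^ l := by gcongr; norm_num
      have h4 : (0 : ℝ) < 4 ^ L := by positivity
      have h2 : (0 : ℝ) < 2 ^ l := by positivity
      rw [mul_assoc, mul_assoc]
      exact mul_le_mul_of_nonneg_left (by linarith) h4.le
    refine (Finset.sum_le_sum fun l _ => hterm l).trans ?_
    rw [← Finset.mul_sum]
    have hgeo : ∑ l ∈ Finset.range Λ, (1 / 2 : ℝ) ^ l ≤ 2 := sum_geometric_two_le Λ
    have : 0 ≤ C / 4 ^ L / 2 := by positivity
    nlinarith
  · have h1 : 1 ≤ √n * ‖s‖ := (one_le_pow₀ one_le_two).trans hLs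
    obtain ⟨m, hm1, hm2⟩ := exists_nat_pow_near h1 (one_lt_two (α := ℝ))
    have hLm : L ≤ m := by
      by_contra hcon
      have : m + 1 ≤ L := by omega
      have := pow_le_pow_right₀ (one_le_two (α := ℝ)) this
      linarith
    have hmΛ : m < Λ := by
      by_contra hcon
      have := pow_le_pow_right₀ (one_le_two (α := ℝ)) (not_lt.1 hcon)
      have h2 : √n * ‖s‖ ≤ √n * ρ := by gcongr; exact hT s hs
      linarith
    obtain ⟨l, rfl⟩ := Nat.exists_eq_add_of_le hLm
    have hbelow := hG (L + l) ω s hs hm2.le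
    have hsingle : G (L + l) ω ≤ ∑ l ∈ Finset.range Λ, G (L + l) ω :=
      Finset.single_le_sum (f := fun l => G (L + l) ω) (fun l _ => hG0 _ _)
        (Finset.mem_range.2 (by omega))
    have i1 : Integrable (fun u => f u s) ν := by
      have := hU.isProbabilityMeasure
      exact (hf.memLp h0 hs).integrable one_le_two
    -- Beyond the truncation level the crude Lipschitz bound is enough; the parameter enters only
    -- through the factor `√n ‖s‖`.
    have habove : |centeredSum ν U (truncAbove H n fun u => f u s) n ω|
        ≤ √n * ‖s‖ * tailSum ν U H n ω := by
      have := hU.isProbabilityMeasure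
      have i2 : Integrable (truncAbove H n fun u => √(H u)) ν :=
        integrable_truncAbove hf.env_meas (hf.memLp_sqrt_env.integrable one_le_two) n
      have i3 : Integrable (truncAbove H n fun u => ‖s‖ * √(H u)) ν := by
        rw [truncAbove_const_mul]; exact i2.const_mul _
      refine (abs_centeredSum_le i3 (abs_truncAbove_le fun u => hf.abs_le h0 u hs) n ω).trans
        (le_of_eq ?_)
      rw [truncAbove_const_mul, integral_const_mul, ← Finset.mul_sum, tailSum]
      have : √(n : ℝ) * √n = n := Real.mul_self_sqrt hn'.le
      field_simp
      linear_combination -(‖s‖ * ∫ u, truncAbove H n (fun u => √(H u)) u ∂ν) * this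
    rw [centeredSum_trunc hf.env_meas i1 n]
    refine (abs_add_le _ _).trans ?_
    have e : ε / 4 * (2 ^ (L + l + 1)) ^ 2 ≤ ε * (√n * ‖s‖) ^ 2 := by
      have : (2 : ℝ) ^ (L + l + 1) ≤ 2 * (√n * ‖s‖) := by rw [pow_succ]; linarith
      calc ε / 4 * (2 ^ (L + l + 1)) ^ 2 ≤ ε / 4 * (2 * (√n * ‖s‖)) ^ 2 := by gcongr
        _ = _ := by ring
    linarith

end SmoothFamily

/-! ### Local linearization of the empirical process and tails of the score. -/

/-- The normalized centred score `n^{-1/2} ∑_{i < n} (D (U i) - ∫ D dν)`. -/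
noncomputable def scoreSum {Ω 𝒰 ι : Type*} [MeasurableSpace 𝒰] [Fintype ι] (ν : Measure 𝒰)
    (U : ℕ → Ω → 𝒰) (D : 𝒰 → EuclideanSpace ℝ ι) (n : ℕ) (ω : Ω) : EuclideanSpace ℝ ι :=
  WithLp.toLp 2 fun k => (√n)⁻¹ * centeredSum ν U (fun u => D u k) n ω

/-- The integrand is at most `K ^ 2 H` by the first member of the minimum and `O(1 / n)` pointwise
by the second, so dominated convergence applies. Sums of `n` second-order remainders are thus
negligible in mean square, although `H ^ 2` need not be integrable. -/
lemma tendsto_integral_remainderEnvelope_sq {𝒰 : Type*} [MeasurableSpace 𝒰] {ν : Measure 𝒰}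
    {H : 𝒰 → ℝ} (hHm : Measurable H) (hHi : Integrable H ν) (hH0 : ∀ u, 0 ≤ H u) {K : ℝ}
    (hK : 0 < K) :
    Tendsto (fun n : ℕ => ∫ u, n * remainderEnvelope H n K u ^ 2 ∂ν) atTop (𝓝 0) := by
  have e : (0 : ℝ) = ∫ _, (0 : ℝ) ∂ν := by simp
  rw [e]
  have b1 : ∀ n : ℕ, ∀ u, n * remainderEnvelope H n K u ^ 2 ≤ K ^ 2 * H u := fun n u => by
    have hu := hH0 u
    rcases Nat.eq_zero_or_pos n with rfl | hn
    · simp; positivity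
    have hn' : (0 : ℝ) < n := by exact_mod_cast hn
    calc n * remainderEnvelope H n K u ^ 2 ≤ n * (K * √(H u / n)) ^ 2 := by
          gcongr
          · exact remainderEnvelope_nonneg hH0 n hK.le u
          · exact min_le_left _ _
      _ = K ^ 2 * H u := by
          rw [mul_pow, Real.sq_sqrt (by positivity)]; field_simp
  refine tendsto_integral_of_dominated_convergence (fun u => K ^ 2 * H u)
    (fun n => (((measurable_remainderEnvelope hHm n K).pow_const 2).const_mul _).aestronglyMeasurable)
    (hHi.const_mul _) (fun n => ae_of_all _ fun u => ?_) (ae_of_all _ fun u => ?_)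
  · rw [Real.norm_of_nonneg (by positivity)]; exact b1 n u
  · have hu := hH0 u
    have h1 : Tendsto (fun n : ℕ => (H u * K ^ 2) ^ 2 * (1 / (n : ℝ))) atTop (𝓝 0) := by
      simpa using tendsto_one_div_atTop_nhds_zero_nat.const_mul ((H u * K ^ 2) ^ 2)
    refine squeeze_zero' (Eventually.of_forall fun n => by positivity) ?_ h1
    filter_upwards [eventually_ge_atTop 1] with n hn
    have hn' : (0 : ℝ) < n := by exact_mod_cast hn
    calc n * remainderEnvelope H n K u ^ 2 ≤ n * (H u * K ^ 2 / n) ^ 2 := by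
          gcongr
          · exact remainderEnvelope_nonneg hH0 n hK.le u
          · exact min_le_right _ _
      _ = _ := by field_simp

namespace SmoothFamily

variable {Ω 𝒰 ι : Type*} [MeasurableSpace Ω] [MeasurableSpace 𝒰] [Fintype ι] {P : Measure Ω}
  [IsProbabilityMeasure P] {ν : Measure 𝒰} {U : ℕ → Ω → 𝒰}
  {T : Set (EuclideanSpace ℝ ι)} {f : 𝒰 → EuclideanSpace ℝ ι → ℝ}
  {D : 𝒰 → EuclideanSpace ℝ ι} {H : 𝒰 → ℝ} (hf : SmoothFamily ν T f D H)

include hf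

lemma integrable_inner_score [IsFiniteMeasure ν] (s : EuclideanSpace ℝ ι) :
    Integrable (fun u => inner ℝ (D u) s) ν := by
  simp only [PiLp.inner_apply, RCLike.inner_apply, conj_trivial]
  exact integrable_finsetSum _ fun k _ =>
    ((hf.memLp_score_apply k).integrable one_le_two).const_mul _

omit [MeasurableSpace Ω] in
lemma centeredSum_inner_score [IsFiniteMeasure ν] (s : EuclideanSpace ℝ ι) {n : ℕ} (hn : 1 ≤ n)
    (ω : Ω) :
    centeredSum ν U (fun u => inner ℝ (D u) s) n ω = inner ℝ (scoreSum ν U D n ω) (√n • s) := by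
  have hn' : (0 : ℝ) < √n := Real.sqrt_pos.2 (by exact_mod_cast hn)
  simp only [PiLp.inner_apply, RCLike.inner_apply, conj_trivial]
  rw [centeredSum_finset_sum _ fun k _ =>
    ((hf.memLp_score_apply k).integrable one_le_two).const_mul _]
  refine Finset.sum_congr rfl fun k _ => ?_
  rw [centeredSum_const_mul, scoreSum, PiLp.smul_apply, smul_eq_mul]
  field_simp

/-- The empirical process is linear in the local parameter, uniformly on compact sets. -/
lemma eventually_exists_local_bound (hU : IsIIDSample P ν U) (h0 : (0 : EuclideanSpace ℝ ι) ∈ T)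
    {K : ℝ} (hK : 0 < K) {ε : ℝ} (hε : 0 < ε) :
    ∀ᶠ n : ℕ in atTop, ∃ V : Ω → ℝ, (∀ ω, 0 ≤ V ω) ∧ Integrable V P ∧ ∫ ω, V ω ∂P ≤ ε ∧
      ∀ ω, ∀ s ∈ T, √n * ‖s‖ ≤ K →
        |centeredSum ν U (fun u => f u s) n ω - inner ℝ (scoreSum ν U D n ω) (√n • s)| ≤ V ω := by
  have := hU.isProbabilityMeasure
  set h := ∫ u, H u ∂ν with hh
  have h_nonneg : 0 ≤ h := hf.integral_env_nonneg
  set η := ε / (8 * (K ^ 2 * h + 1)) with hη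
  have hη0 : 0 < η := by positivity
  have hηε : 4 * η * K ^ 2 * h ≤ ε / 2 := by
    have : η * (8 * (K ^ 2 * h + 1)) = ε := by rw [hη]; field_simp
    nlinarith
  obtain ⟨F, hF⟩ := exists_uniform_net (E := EuclideanSpace ℝ ι) hη0
  set θ := ε / (4 * (F.card + 1)) with hθ
  have hθ0 : 0 < θ := by positivity
  have hδ : ∀ᶠ n : ℕ in atTop, F.card * (∫ u, n * remainderEnvelope H n K u ^ 2 ∂ν) * 4 / θ < ε / 4 := by
    have := (((tendsto_integral_remainderEnvelope_sq hf.env_meas hf.env_int hf.env_nonneg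
      hK).const_mul (F.card : ℝ)).mul_const 4).div_const θ
    simp only [mul_zero, zero_mul, zero_div] at this
    exact this.eventually_lt_const (by positivity)
  filter_upwards [hδ, eventually_ge_atTop 1] with n hδn hn
  have hn' : (0 : ℝ) < n := by exact_mod_cast hn
  have hsn : 0 < √(n : ℝ) := Real.sqrt_pos.2 hn'
  have sq_n : √(n : ℝ) * √n = n := Real.mul_self_sqrt hn'.le
  obtain ⟨rep, hrep, hnet⟩ := hF {s | s ∈ T ∧ √n * ‖s‖ ≤ K} (K / √n) (by positivity)
    ⟨0, h0, by simp [hK.le]⟩ fun s hs => by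
      rw [le_div_iff₀ hsn, mul_comm]; exact hs.2
  let ρ : EuclideanSpace ℝ ι → 𝒰 → ℝ := fun s u => f u s - inner ℝ (D u) s
  have hr : ∀ {t : EuclideanSpace ℝ ι}, √n * ‖t‖ ≤ K → ‖t‖ ≤ K / √n := fun {t} ht => by
    rw [le_div_iff₀ hsn, mul_comm]; exact ht
  have hDm : ∀ s, Measurable fun u => inner ℝ (D u) s := fun s => hf.score_meas.inner_const
  have hρm : ∀ s ∈ T, Measurable (ρ s) := fun s hs => (hf.meas s hs).sub (hDm s)
  have hρle : ∀ s ∈ T, √n * ‖s‖ ≤ K → ∀ u, |ρ s u| ≤ 2 * remainderEnvelope H n K u :=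
    fun s hs hsK u => by
      have hHu := hf.env_nonneg u
      have hsK' := hr hsK
      have h1 := hf.lip_sub_linear u s hs 0 h0 (K / √n) hsK' (by simp; positivity)
      have h2 := hf.lip u s hs 0 h0
      simp only [hf.zero, sub_zero] at h1 h2
      have h3 := (abs_real_inner_le_norm (D u) s).trans
          (mul_le_mul_of_nonneg_right (hf.score_le u) (norm_nonneg _))
      have h4 := abs_sub (f u s) (inner ℝ (D u) s)
      rw [remainderEnvelope, mul_min_of_nonneg _ _ zero_le_two]
      refine le_min ?_ ?_
      · calc |ρ s u| ≤ 2 * √(H u) * ‖s‖ := by simp only [ρ]; linarith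
          _ ≤ 2 * √(H u) * (K / √n) := by gcongr
          _ = _ := by rw [Real.sqrt_div' _ hn'.le]; ring
      · calc |ρ s u| ≤ H u * (K / √n) * (K / √n) := h1.trans (by gcongr)
          _ = H u * K ^ 2 / (√n * √n) := by field_simp
          _ ≤ 2 * (H u * K ^ 2 / n) := by
            rw [sq_n]; have : 0 ≤ H u * K ^ 2 / n := by positivity
            linarith
  have iρ : ∀ s ∈ T, Integrable (ρ s) ν := fun s hs =>
    ((hf.memLp h0 hs).integrable one_le_two).sub' (hf.integrable_inner_score s)
  have mrem : MemLp (remainderEnvelope H n K) 2 ν := by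
    refine ((hf.memLp_sqrt_env.const_mul (K / √n))).mono'
      (measurable_remainderEnvelope hf.env_meas n K).aestronglyMeasurable (ae_of_all _ fun u => ?_)
    rw [Real.norm_of_nonneg (remainderEnvelope_nonneg hf.env_nonneg n hK.le u)]
    refine (min_le_left _ _).trans (le_of_eq ?_)
    rw [Real.sqrt_div' _ hn'.le]; ring
  have mρ : ∀ s ∈ T, √n * ‖s‖ ≤ K → MemLp (ρ s) 2 ν := fun s hs hsK =>
    (mrem.const_mul 2).mono' (hρm s hs).aestronglyMeasurable (ae_of_all _ (hρle s hs hsK))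
  have hsq : ∀ s ∈ T, √n * ‖s‖ ≤ K → ∫ ω, centeredSum ν U (ρ s) n ω ^ 2 ∂P
      ≤ (∫ u, n * remainderEnvelope H n K u ^ 2 ∂ν) * 4 := fun s hs hsK => by
    refine (hU.integral_centeredSum_sq_le (hρm s hs) (mρ s hs hsK) n).trans ?_
    rw [← integral_const_mul, ← integral_mul_const]
    refine integral_mono ((mρ s hs hsK).integrable_sq.const_mul _)
      ((mrem.integrable_sq.const_mul _).mul_const _) fun u => ?_
    have := pow_le_pow_left₀ (abs_nonneg _) (hρle s hs hsK u) 2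
    rw [sq_abs] at this
    simp only
    nlinarith
  -- At the net points the remainders are small in mean square, used through `|x| ≤ θ + x ^ 2 / θ`.
  -- Between net points, at distance of order `η / √n`, the remainder of one observation moves by
  -- `O(η H / n)`, and the plain sum of `H` suffices.
  let V : Ω → ℝ := fun ω => ∑ y ∈ F, (θ + centeredSum ν U (ρ (rep y)) n ω ^ 2 / θ)
    + 2 * η * K ^ 2 / n * (∑ i ∈ Finset.range n, H (U i ω) + n * h)
  have i1 : ∀ y, Integrable (fun ω => θ + centeredSum ν U (ρ (rep y)) n ω ^ 2 / θ) P := fun y =>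
    (integrable_const _).fun_add ((hU.memLp_centeredSum (mρ _ (hrep y).1 (hrep y).2)
      n).integrable_sq.div_const _)
  have i2 : Integrable (fun ω => ∑ i ∈ Finset.range n, H (U i ω)) P :=
    integrable_finsetSum _ fun i _ => hU.integrable_comp hf.env_int i
  have i3 : Integrable (fun ω => ∑ y ∈ F, (θ + centeredSum ν U (ρ (rep y)) n ω ^ 2 / θ)) P :=
    integrable_finsetSum _ fun y _ => i1 y
  have i4 : Integrable (fun ω => 2 * η * K ^ 2 / n * (∑ i ∈ Finset.range n, H (U i ω) + n * h)) P :=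
    (i2.fun_add (integrable_const _)).const_mul _
  have V2_nonneg : ∀ ω, 0 ≤ 2 * η * K ^ 2 / n * (∑ i ∈ Finset.range n, H (U i ω) + n * h) :=
    fun ω => by
      have : 0 ≤ ∑ i ∈ Finset.range n, H (U i ω) := Finset.sum_nonneg fun i _ => hf.env_nonneg _
      positivity
  refine ⟨V, fun ω => add_nonneg (Finset.sum_nonneg fun y _ => by positivity) (V2_nonneg ω),
    i3.fun_add i4, ?_, fun ω s hs hsK => ?_⟩
  · have e : ∫ ω, V ω ∂P = ∑ y ∈ F, (θ + (∫ ω, centeredSum ν U (ρ (rep y)) n ω ^ 2 ∂P) / θ)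
        + 4 * η * K ^ 2 * h := by
      simp only [V]
      rw [integral_add i3 i4, integral_finsetSum _ fun y _ => i1 y, integral_const_mul,
        integral_add i2 (integrable_const _), integral_finsetSum _ fun i _ =>
        hU.integrable_comp hf.env_int i]
      simp_rw [hU.integral_comp hf.env_meas]
      congr 1
      · refine Finset.sum_congr rfl fun y _ => ?_
        rw [integral_add (integrable_const _) ((hU.memLp_centeredSum (mρ _ (hrep y).1 (hrep y).2)
          n).integrable_sq.div_const _), integral_const, probReal_univ, one_smul, integral_div]
      · simp only [integral_const, probReal_univ, smul_eq_mul, Finset.sum_const, Finset.card_range,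
          nsmul_eq_mul, one_mul, ← hh]
        field_simp; ring
    rw [e]
    set δ := ∫ u, n * remainderEnvelope H n K u ^ 2 ∂ν
    have s1 : ∑ y ∈ F, (θ + (∫ ω, centeredSum ν U (ρ (rep y)) n ω ^ 2 ∂P) / θ)
        ≤ F.card * (θ + δ * 4 / θ) := by
      rw [← nsmul_eq_mul]
      refine Finset.sum_le_card_nsmul F _ _ fun y _ => ?_
      gcongr
      exact hsq _ (hrep y).1 (hrep y).2
    have s2 : F.card * θ ≤ ε / 4 := by
      rw [hθ, mul_div_assoc', div_le_div_iff₀ (by positivity) (by positivity)]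
      nlinarith
    have s3 : F.card * (θ + δ * 4 / θ) = F.card * θ + F.card * δ * 4 / θ := by ring
    linarith
  · obtain ⟨y, hy, hsy⟩ := hnet s ⟨hs, hsK⟩
    set s' := rep y with hs'
    have hs'T : s' ∈ T := (hrep y).1
    have e1 : centeredSum ν U (fun u => f u s) n ω - inner ℝ (scoreSum ν U D n ω) (√n • s)
        = centeredSum ν U (ρ s) n ω := by
      rw [← hf.centeredSum_inner_score s hn, ← centeredSum_sub
        ((hf.memLp h0 hs).integrable one_le_two) (hf.integrable_inner_score s)]
    have e2 : centeredSum ν U (ρ s) n ω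
        = centeredSum ν U (ρ s') n ω + centeredSum ν U (fun u => ρ s u - ρ s' u) n ω := by
      rw [centeredSum_sub (iρ s hs) (iρ s' hs'T)]; ring
    have b1 : |centeredSum ν U (ρ s') n ω|
        ≤ ∑ y ∈ F, (θ + centeredSum ν U (ρ (rep y)) n ω ^ 2 / θ) := by
      refine le_trans ?_ (Finset.single_le_sum
        (f := fun y => θ + centeredSum ν U (ρ (rep y)) n ω ^ 2 / θ) (fun y _ => by positivity) hy)
      simp only [← hs']
      generalize centeredSum ν U (ρ s') n ω = x
      have : |x| * θ ≤ θ * θ + x ^ 2 := by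
        rw [← sq_abs x]; nlinarith [sq_nonneg (|x| - θ), abs_nonneg x]
      rw [← sub_nonneg]
      have e : θ + x ^ 2 / θ - |x| = (θ * θ + x ^ 2 - |x| * θ) / θ := by field_simp
      rw [e]
      exact div_nonneg (by linarith) hθ0.le
    have b2 : ∀ u, |ρ s u - ρ s' u| ≤ 2 * η * K ^ 2 / n * H u := fun u => by
      have hHu := hf.env_nonneg u
      have h1 := hf.lip_sub_linear u s hs s' hs'T (K / √n) (hr hsK) (hr (hrep y).2)
      rw [inner_sub_right] at h1
      calc |ρ s u - ρ s' u| ≤ H u * (K / √n) * (2 * η * (K / √n)) := by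
            refine le_trans (le_of_eq ?_) (h1.trans (by gcongr))
            simp only [ρ]; congr 1; ring
        _ = 2 * η * K ^ 2 / (√n * √n) * H u := by field_simp
        _ = _ := by rw [sq_n]
    have b3 := abs_centeredSum_le (U := U) (hf.env_int.const_mul _) b2 n ω
    rw [e1, e2]
    refine (abs_add_le _ _).trans (add_le_add b1 (b3.trans (le_of_eq ?_)))
    rw [integral_const_mul, ← Finset.mul_sum]; ring

omit [IsProbabilityMeasure P] in
lemma measurable_scoreSum (hU : IsIIDSample P ν U) (n : ℕ) : Measurable (scoreSum ν U D n) := by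
  refine (PiLp.continuous_toLp 2 (fun _ : ι => ℝ)).measurable.comp (measurable_pi_iff.2 fun k => ?_)
  exact (hU.measurable_centeredSum (hf.measurable_score_apply k) n).const_mul _

lemma memLp_scoreSum_apply (hU : IsIIDSample P ν U) (n : ℕ) (k : ι) :
    MemLp (fun ω => scoreSum ν U D n ω k) 2 P :=
  (hU.memLp_centeredSum (hf.memLp_score_apply k) n).const_mul _

/-- The tails of the squared normalized score. -/
lemma exists_scoreSum_bound (hU : IsIIDSample P ν U) :
    ∃ C, 0 ≤ C ∧ ∀ n : ℕ, 1 ≤ n → ∃ Y : Ω → ℝ, (∀ ω, 0 ≤ Y ω) ∧ Integrable Y P ∧ ∫ ω, Y ω ∂P ≤ C ∧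
      ∀ ω, ∀ K : ℝ, 0 < K → K ≤ ‖scoreSum ν U D n ω‖ → ‖scoreSum ν U D n ω‖ ^ 2
        ≤ Y ω / K ^ 2 + 4 * Fintype.card ι ^ 2 * tailSum ν U H n ω ^ 2 := by
  have := hU.isProbabilityMeasure
  set d : ℝ := (Fintype.card ι : ℝ) with hd
  set C₄ := 16 * ∫ u, H u ∂ν + 6 * (∫ u, H u ∂ν) ^ 2
  have h_nonneg : 0 ≤ ∫ u, H u ∂ν := hf.integral_env_nonneg
  refine ⟨16 * (d ^ 3 * (d * C₄)), by positivity, fun n hn => ?_⟩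
  have hn' : (0 : ℝ) < n := by exact_mod_cast hn
  have hsn : 0 < √(n : ℝ) := Real.sqrt_pos.2 hn'
  -- The truncated coordinates have fourth moments bounded in `n`, so the tails of their squares
  -- beyond `K` are `O(1 / K ^ 2)`; the rest of the score is absorbed by `tailSum`.
  let Z : ι → Ω → ℝ := fun k => centeredSum ν U (truncBelow H n fun u => (√n)⁻¹ * D u k) n
  have hZ : ∀ k, Integrable (fun ω => Z k ω ^ 4) P ∧ ∫ ω, Z k ω ^ 4 ∂P ≤ C₄ * 1 ^ 4 := fun k =>
    hU.integral_centeredSum_truncBelow_pow_four hf.env_meas hf.env_int hf.env_nonneg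
      ((hf.measurable_score_apply k).const_mul _) hn zero_le_one fun u => by
        rw [abs_mul, abs_of_pos (by positivity), Real.sqrt_div' _ hn'.le, one_mul,
          inv_mul_eq_div]
        have := hf.abs_score_apply_le u k
        gcongr
  have iZ : Integrable (fun ω => ∑ k, Z k ω ^ 4) P := integrable_finsetSum _ fun k _ => (hZ k).1
  refine ⟨fun ω => 16 * (d ^ 3 * ∑ k, Z k ω ^ 4), fun ω => by positivity,
    (iZ.const_mul _).const_mul _, ?_, fun ω K hK hKS => ?_⟩
  · rw [integral_const_mul, integral_const_mul, integral_finsetSum _ fun k _ => (hZ k).1]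
    have s₂ : ∑ k, ∫ ω, Z k ω ^ 4 ∂P ≤ d * C₄ := by
      simpa [hd] using Finset.sum_le_card_nsmul Finset.univ _ _ fun y _ => (hZ y).2
    gcongr
  · set S := scoreSum ν U D n ω with hS
    set R := tailSum ν U H n ω with hR
    set z := ∑ k, |Z k ω| with hz
    have hz0 : 0 ≤ z := Finset.sum_nonneg fun _ _ => abs_nonneg _
    have hR0 : 0 ≤ R := tailSum_nonneg n ω
    have hSk : ∀ k, |S k| ≤ |Z k ω| + R := fun k => by
      have iD : Integrable (fun u => (√n)⁻¹ * D u k) ν :=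
        ((hf.memLp_score_apply k).integrable one_le_two).const_mul _
      have e : S k = centeredSum ν U (fun u => (√n)⁻¹ * D u k) n ω := by
        rw [centeredSum_const_mul]; rfl
      rw [e, centeredSum_trunc hf.env_meas iD n]
      refine (abs_add_le _ _).trans (add_le_add le_rfl ?_)
      have i2 : Integrable (truncAbove H n fun u => √(H u)) ν :=
        integrable_truncAbove hf.env_meas (hf.memLp_sqrt_env.integrable one_le_two) n
      have i3 : Integrable (truncAbove H n fun u => (√n)⁻¹ * √(H u)) ν := by
        rw [truncAbove_const_mul]; exact i2.const_mul _
      refine (abs_centeredSum_le i3 (abs_truncAbove_le fun u => ?_) n ω).trans (le_of_eq ?_)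
      · rw [abs_mul, abs_of_pos (by positivity)]
        have := hf.abs_score_apply_le u k
        gcongr
      · rw [truncAbove_const_mul, integral_const_mul, ← Finset.mul_sum, hR, tailSum]
        have : √(n : ℝ) * √n = n := Real.mul_self_sqrt hn'.le
        field_simp
        linear_combination -(∫ u, truncAbove H n (fun u => √(H u)) u ∂ν) * this
    have hSle : ‖S‖ ≤ z + d * R := by
      refine (EuclideanSpace.norm_le_sum_abs S).trans ((Finset.sum_le_sum fun k _ => hSk k).trans ?_)
      rw [Finset.sum_add_distrib, Finset.sum_const, nsmul_eq_mul, Finset.card_univ]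
    have hz4 : z ^ 4 ≤ d ^ 3 * ∑ k, Z k ω ^ 4 := by
      have key := pow_sum_le_card_mul_sum_pow (s := Finset.univ) (f := fun k => |Z k ω|)
        (fun _ _ => abs_nonneg _) 3
      simpa only [Nat.reduceAdd, Even.pow_abs (show Even 4 by decide), Finset.card_univ] using key
    have hd0 : 0 ≤ d := by positivity
    -- One of the truncated part and the tail carries half of `‖S‖`. In the first case `K ≤ ‖S‖`
    -- gives `‖S‖ ^ 2 K ^ 2 ≤ ‖S‖ ^ 4 ≤ 16 z ^ 4`.
    rcases le_total (‖S‖ / 2) z with hcase | hcase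
    · have h1 : ‖S‖ ≤ 2 * z := by linarith
      have h2 : ‖S‖ ^ 2 * K ^ 2 ≤ 16 * z ^ 4 := by
        calc ‖S‖ ^ 2 * K ^ 2 ≤ (2 * z) ^ 2 * (2 * z) ^ 2 := by
              gcongr; exact hKS.trans h1
          _ = _ := by ring
      have h3 : ‖S‖ ^ 2 ≤ 16 * (d ^ 3 * ∑ k, Z k ω ^ 4) / K ^ 2 := by
        rw [le_div_iff₀ (by positivity)]; linarith
      have : 0 ≤ 4 * d ^ 2 * R ^ 2 := by positivity
      linarith
    · have h1 : ‖S‖ ≤ 2 * (d * R) := by linarith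
      have h2 : ‖S‖ ^ 2 ≤ (2 * (d * R)) ^ 2 := by gcongr
      have : 0 ≤ 16 * (d ^ 3 * ∑ k, Z k ω ^ 4) / K ^ 2 := by positivity
      nlinarith

lemma continuousOn (u : 𝒰) : ContinuousOn (f u) T := by
  refine LipschitzOnWith.continuousOn (K := ⟨√(H u), Real.sqrt_nonneg _⟩)
    (LipschitzOnWith.of_dist_le_mul fun s hs t ht => ?_)
  rw [Real.dist_eq, dist_eq_norm]
  exact hf.lip u s hs t ht

lemma abs_integral_sub_le [IsFiniteMeasure ν] (h0 : (0 : EuclideanSpace ℝ ι) ∈ T)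
    {s t : EuclideanSpace ℝ ι} (hs : s ∈ T) (ht : t ∈ T) :
    |(∫ u, f u s ∂ν) - ∫ u, f u t ∂ν| ≤ (∫ u, √(H u) ∂ν) * ‖s - t‖ := by
  rw [← integral_sub ((hf.memLp h0 hs).integrable one_le_two)
    ((hf.memLp h0 ht).integrable one_le_two), ← integral_mul_const]
  exact abs_integral_le_integral_abs.trans (integral_mono_of_nonneg (ae_of_all _ fun _ =>
    abs_nonneg _) ((hf.memLp_sqrt_env.integrable one_le_two).mul_const _)
    (ae_of_all _ fun u => hf.lip u s hs t ht))

lemma continuousOn_integral [IsFiniteMeasure ν] (h0 : (0 : EuclideanSpace ℝ ι) ∈ T) :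
    ContinuousOn (fun s => ∫ u, f u s ∂ν) T := by
  refine LipschitzOnWith.continuousOn (K := ⟨∫ u, √(H u) ∂ν,
    integral_nonneg fun _ => Real.sqrt_nonneg _⟩) (LipschitzOnWith.of_dist_le_mul fun s hs t ht => ?_)
  rw [Real.dist_eq, dist_eq_norm]
  exact hf.abs_integral_sub_le h0 hs ht

omit [MeasurableSpace Ω] [IsProbabilityMeasure P] in
-- A function continuous in the parameter and measurable in the observation is jointly measurable,
-- so a random parameter may be substituted.
lemma measurable_eval {Ω : Type*} [MeasurableSpace Ω] {X : Ω → 𝒰} (hX : Measurable X)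
    {s : Ω → EuclideanSpace ℝ ι} (hs : Measurable s) (hsT : ∀ ω, s ω ∈ T) :
    Measurable fun ω => f (X ω) (s ω) := by
  have h := measurable_uncurry_of_continuous_of_measurable (u := fun (t : T) u => f u t)
    (fun u => continuousOn_iff_continuous_domRestrict.1 (hf.continuousOn u)) fun t => hf.meas t t.2
  exact h.comp ((hs.subtype_mk (h := hsT)).prodMk hX)

lemma measurable_integral_eval [IsFiniteMeasure ν] (h0 : (0 : EuclideanSpace ℝ ι) ∈ T)
    {Ω : Type*} [MeasurableSpace Ω]
    {s : Ω → EuclideanSpace ℝ ι} (hs : Measurable s) (hsT : ∀ ω, s ω ∈ T) :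
    Measurable fun ω => ∫ u, f u (s ω) ∂ν :=
  (continuousOn_iff_continuous_domRestrict.1 (hf.continuousOn_integral h0)).measurable.comp
    (hs.subtype_mk (h := hsT))

end SmoothFamily

/-! ### Mean square convergence and uniform integrability of squares. -/

section SquareIntegrable

variable {Ω : Type*} [MeasurableSpace Ω] {P : Measure Ω}

/-- Cauchy–Schwarz, from the discriminant of the nonnegative quadratic `t ↦ ∫ (t x + y) ^ 2`. -/
lemma sq_integral_mul_le {x y : Ω → ℝ} (hx : MemLp x 2 P) (hy : MemLp y 2 P) :
    (∫ ω, x ω * y ω ∂P) ^ 2 ≤ (∫ ω, x ω ^ 2 ∂P) * ∫ ω, y ω ^ 2 ∂P := by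
  have ixy : Integrable (fun ω => x ω * y ω) P := hx.integrable_mul hy
  have h : ∀ t : ℝ, 0 ≤ (∫ ω, x ω ^ 2 ∂P) * (t * t) + (2 * ∫ ω, x ω * y ω ∂P) * t
      + ∫ ω, y ω ^ 2 ∂P := fun t => by
    have e : ∀ ω, (t * x ω + y ω) ^ 2 = t * t * x ω ^ 2 + 2 * t * (x ω * y ω) + y ω ^ 2 :=
      fun ω => by ring
    have h0 : 0 ≤ ∫ ω, (t * x ω + y ω) ^ 2 ∂P := integral_nonneg fun _ => sq_nonneg _
    simp_rw [e] at h0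
    rw [integral_add ((hx.integrable_sq.const_mul _).fun_add (ixy.const_mul _)) hy.integrable_sq,
      integral_add (hx.integrable_sq.const_mul _) (ixy.const_mul _), integral_const_mul,
      integral_const_mul] at h0
    linarith
  have := discrim_le_zero h
  rw [discrim] at this
  nlinarith

lemma tendsto_integral_mul_zero {x y : ℕ → Ω → ℝ} (hx : ∀ n, MemLp (x n) 2 P)
    (hy : ∀ n, MemLp (y n) 2 P) (hx0 : Tendsto (fun n => ∫ ω, x n ω ^ 2 ∂P) atTop (𝓝 0)) {C : ℝ}
    (hC : ∀ᶠ n in atTop, ∫ ω, y n ω ^ 2 ∂P ≤ C) :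
    Tendsto (fun n => ∫ ω, x n ω * y n ω ∂P) atTop (𝓝 0) := by
  have h1 : Tendsto (fun n => √((∫ ω, x n ω ^ 2 ∂P) * C)) atTop (𝓝 0) := by
    simpa using (hx0.mul_const C).sqrt
  rw [tendsto_zero_iff_abs_tendsto_zero]
  refine squeeze_zero' (Eventually.of_forall fun _ => abs_nonneg _) ?_ h1
  filter_upwards [hC] with n hn
  refine Real.abs_le_sqrt ((sq_integral_mul_le (hx n) (hy n)).trans ?_)
  have : 0 ≤ ∫ ω, x n ω ^ 2 ∂P := integral_nonneg fun _ => sq_nonneg _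
  gcongr

/-- Rests on `a b - a' b' = (a - a') (b - b') + (a - a') b' + (b - b') a'`. It lets the scaled
estimator be replaced by its linearization inside mixed second moments. -/
lemma tendsto_integral_mul_sub {a b a' b' : ℕ → Ω → ℝ} (ha : ∀ n, MemLp (a n) 2 P)
    (hb : ∀ n, MemLp (b n) 2 P) (ha' : ∀ n, MemLp (a' n) 2 P) (hb' : ∀ n, MemLp (b' n) 2 P)
    (haa : Tendsto (fun n => ∫ ω, (a n ω - a' n ω) ^ 2 ∂P) atTop (𝓝 0))
    (hbb : Tendsto (fun n => ∫ ω, (b n ω - b' n ω) ^ 2 ∂P) atTop (𝓝 0)) {C : ℝ}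
    (haC : ∀ᶠ n in atTop, ∫ ω, a' n ω ^ 2 ∂P ≤ C) (hbC : ∀ᶠ n in atTop, ∫ ω, b' n ω ^ 2 ∂P ≤ C) :
    Tendsto (fun n => ∫ ω, a n ω * b n ω ∂P - ∫ ω, a' n ω * b' n ω ∂P) atTop (𝓝 0) := by
  have ma : ∀ n, MemLp (fun ω => a n ω - a' n ω) 2 P := fun n => (ha n).sub (ha' n)
  have mb : ∀ n, MemLp (fun ω => b n ω - b' n ω) 2 P := fun n => (hb n).sub (hb' n)
  have h1 := tendsto_integral_mul_zero ma mb haa (C := 1)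
    ((hbb.eventually_lt_const one_pos).mono fun _ h => h.le)
  have h2 := tendsto_integral_mul_zero ma hb' haa hbC
  have h3 := tendsto_integral_mul_zero mb ha' hbb haC
  have h4 := (h1.add h2).add h3
  simp only [add_zero] at h4
  refine h4.congr fun n => ?_
  have i1 : Integrable (fun ω => (a n ω - a' n ω) * (b n ω - b' n ω)) P :=
    (ma n).integrable_mul (mb n)
  have i2 : Integrable (fun ω => (a n ω - a' n ω) * b' n ω) P := (ma n).integrable_mul (hb' n)
  have i3 : Integrable (fun ω => (b n ω - b' n ω) * a' n ω) P := (mb n).integrable_mul (ha' n)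
  have i4 : Integrable (fun ω => a n ω * b n ω) P := (ha n).integrable_mul (hb n)
  have i5 : Integrable (fun ω => a' n ω * b' n ω) P := (ha' n).integrable_mul (hb' n)
  rw [← integral_add i1 i2, ← integral_add (i1.fun_add i2) i3, ← integral_sub i4 i5]
  exact integral_congr_ae (ae_of_all _ fun ω => by ring)

/-- The squared norms have uniformly small tail integrals, asymptotically. -/
def SqTailsSmall {E : Type*} [NormedAddCommGroup E] (P : Measure Ω) (X : ℕ → Ω → E) : Prop :=
  ∀ ε > 0, ∃ K₀ > 0, ∀ K ≥ K₀, ∀ᶠ n in atTop,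
    ∫ ω, {ω | K ≤ ‖X n ω‖}.indicator (fun ω => ‖X n ω‖ ^ 2) ω ∂P ≤ ε

variable {E : Type*} [NormedAddCommGroup E]

lemma integrable_sq_tail [MeasurableSpace E] [OpensMeasurableSpace E] {X : Ω → E}
    (hX : Measurable X) (hX2 : Integrable (fun ω => ‖X ω‖ ^ 2) P) (K : ℝ) :
    Integrable ({ω | K ≤ ‖X ω‖}.indicator (fun ω => ‖X ω‖ ^ 2)) P :=
  hX2.indicator (measurableSet_le measurable_const hX.norm)

lemma SqTailsSmall.clm [NormedSpace ℝ E] [MeasurableSpace E] [OpensMeasurableSpace E]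
    {X : ℕ → Ω → E} (h : SqTailsSmall P X) (hX : ∀ n, Measurable (X n))
    (hX2 : ∀ n, Integrable (fun ω => ‖X n ω‖ ^ 2) P) (A : E →L[ℝ] E) :
    SqTailsSmall P fun n ω => A (X n ω) := by
  intro ε hε
  set m := ‖A‖ + 1 with hm
  have hm0 : 0 < m := by positivity
  have hA : ∀ x, ‖A x‖ ≤ m * ‖x‖ := fun x => (A.le_opNorm x).trans (by gcongr; simp [hm])
  obtain ⟨K₀, hK₀, h⟩ := h (ε / m ^ 2) (by positivity)
  refine ⟨m * K₀, by positivity, fun K hK => ?_⟩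
  have hK' : K₀ ≤ K / m := by rw [le_div_iff₀ hm0]; linarith
  filter_upwards [h (K / m) hK'] with n hn
  have hi := integrable_sq_tail (hX n) (hX2 n) (K / m)
  calc _ ≤ ∫ ω, m ^ 2 * {ω | K / m ≤ ‖X n ω‖}.indicator (fun ω => ‖X n ω‖ ^ 2) ω ∂P := by
        refine integral_mono_of_nonneg (ae_of_all _ fun ω => Set.indicator_nonneg
          (fun _ _ => sq_nonneg _) _) (hi.const_mul _) (ae_of_all _ fun ω => ?_)
        by_cases hω : K ≤ ‖A (X n ω)‖
        · have h1 : K / m ≤ ‖X n ω‖ := by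
            rw [div_le_iff₀ hm0, mul_comm]; exact hω.trans (hA _)
          simp only [Set.indicator, Set.mem_ofPred_eq, hω, h1, if_true]
          rw [← mul_pow]; gcongr; exact hA _
        · simp only [Set.indicator, Set.mem_ofPred_eq, hω, if_false]
          split_ifs <;> positivity
    _ ≤ m ^ 2 * (ε / m ^ 2) := by rw [integral_const_mul]; gcongr
    _ = ε := by field_simp

lemma SqTailsSmall.eventually_integral_le [IsProbabilityMeasure P] [MeasurableSpace E]
    [OpensMeasurableSpace E] {X : ℕ → Ω → E}
    (h : SqTailsSmall P X) (hX : ∀ n, Measurable (X n))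
    (hX2 : ∀ n, Integrable (fun ω => ‖X n ω‖ ^ 2) P) :
    ∃ C, 0 ≤ C ∧ ∀ᶠ n in atTop, ∫ ω, ‖X n ω‖ ^ 2 ∂P ≤ C := by
  obtain ⟨K, hK, h⟩ := h 1 one_pos
  refine ⟨K ^ 2 + 1, by positivity, ?_⟩
  filter_upwards [h K le_rfl] with n hn
  have hi := integrable_sq_tail (hX n) (hX2 n) K
  calc ∫ ω, ‖X n ω‖ ^ 2 ∂P
      ≤ ∫ ω, (K ^ 2 + {ω | K ≤ ‖X n ω‖}.indicator (fun ω => ‖X n ω‖ ^ 2) ω) ∂P := by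
        refine integral_mono (hX2 n) ((integrable_const _).fun_add hi) fun ω => ?_
        by_cases hω : K ≤ ‖X n ω‖
        · simp [Set.indicator, hω]; positivity
        · simp only [Set.indicator, Set.mem_ofPred_eq, hω, if_false, add_zero]
          have := (not_le.1 hω).le
          gcongr
    _ ≤ K ^ 2 + 1 := by
        rw [integral_add (integrable_const _) hi]; simpa using hn

/-- A Vitali argument: closeness is needed only where both vectors are bounded by `K`, since the
remaining squares are uniformly small. It turns a comparison on bounded sets into convergence in
mean square. -/
lemma tendsto_integral_norm_sub_sq [MeasurableSpace E] [BorelSpace E] [SecondCountableTopology E]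
    {X Y : ℕ → Ω → E} (hX : ∀ n, Measurable (X n)) (hY : ∀ n, Measurable (Y n))
    (hX2 : ∀ n, Integrable (fun ω => ‖X n ω‖ ^ 2) P)
    (hY2 : ∀ n, Integrable (fun ω => ‖Y n ω‖ ^ 2) P)
    (tX : SqTailsSmall P X) (tY : SqTailsSmall P Y)
    (hloc : ∀ K > 0, ∀ ε > 0, ∀ᶠ n in atTop, ∃ V : Ω → ℝ, (∀ ω, 0 ≤ V ω) ∧ Integrable V P ∧
      ∫ ω, V ω ∂P ≤ ε ∧
      ∀ᵐ ω ∂P, ‖X n ω‖ ≤ K → ‖Y n ω‖ ≤ K → ‖X n ω - Y n ω‖ ^ 2 ≤ V ω) :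
    Tendsto (fun n => ∫ ω, ‖X n ω - Y n ω‖ ^ 2 ∂P) atTop (𝓝 0) := by
  rw [Metric.tendsto_atTop']
  suffices h : ∀ ε > 0, ∀ᶠ n in atTop, ∫ ω, ‖X n ω - Y n ω‖ ^ 2 ∂P ≤ ε by
    intro ε hε
    obtain ⟨N, hN⟩ := eventually_atTop.1 (h (ε / 2) (by positivity))
    refine ⟨N, fun n hn => ?_⟩
    rw [Real.dist_eq, sub_zero, abs_of_nonneg (integral_nonneg fun _ => sq_nonneg _)]
    linarith [hN n hn.le]
  intro ε hε
  obtain ⟨K₁, hK₁, h₁⟩ := tX (ε / 12) (by positivity)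
  obtain ⟨K₂, hK₂, h₂⟩ := tY (ε / 12) (by positivity)
  set K := max K₁ K₂ with hK
  have hK0 : 0 < K := lt_max_of_lt_left hK₁
  filter_upwards [h₁ K (le_max_left _ _), h₂ K (le_max_right _ _),
    hloc K hK0 (ε / 3) (by positivity)] with n hn₁ hn₂ ⟨V, hV0, hVi, hVε, hV⟩
  have iX := integrable_sq_tail (hX n) (hX2 n) K
  have iY := integrable_sq_tail (hY n) (hY2 n) K
  calc ∫ ω, ‖X n ω - Y n ω‖ ^ 2 ∂P
      ≤ ∫ ω, (V ω + (4 * {ω | K ≤ ‖X n ω‖}.indicator (fun ω => ‖X n ω‖ ^ 2) ω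
          + 4 * {ω | K ≤ ‖Y n ω‖}.indicator (fun ω => ‖Y n ω‖ ^ 2) ω)) ∂P := by
        refine integral_mono_of_nonneg (ae_of_all _ fun _ => sq_nonneg _)
          (hVi.fun_add ((iX.const_mul 4).fun_add (iY.const_mul 4))) ?_
        filter_upwards [hV] with ω hω
        have hV0 := hV0 ω
        have htri := norm_sub_le (X n ω) (Y n ω)
        have hsq : ‖X n ω - Y n ω‖ ^ 2 ≤ 2 * ‖X n ω‖ ^ 2 + 2 * ‖Y n ω‖ ^ 2 := by
          have := pow_le_pow_left₀ (norm_nonneg _) htri 2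
          nlinarith [sq_nonneg (‖X n ω‖ - ‖Y n ω‖)]
        have nX := norm_nonneg (X n ω)
        have nY := norm_nonneg (Y n ω)
        -- If only one of the two norms reaches `K`, it also dominates the other, and `2 ‖X‖ ^ 2 + 2
        -- ‖Y‖ ^ 2` is at most four times its square.
        by_cases cX : K ≤ ‖X n ω‖ <;> by_cases cY : K ≤ ‖Y n ω‖ <;>
          simp only [Set.indicator, Set.mem_ofPred_eq, cX, cY, if_true, if_false, mul_zero,
            add_zero, zero_add]
        · nlinarith
        · nlinarith [not_le.1 cY]
        · nlinarith [not_le.1 cX]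
        · exact hω (not_le.1 cX).le (not_le.1 cY).le
    _ ≤ ε := by
        rw [integral_add hVi ((iX.const_mul 4).fun_add (iY.const_mul 4)),
          integral_add (iX.const_mul 4) (iY.const_mul 4), integral_const_mul, integral_const_mul]
        linarith

end SquareIntegrable

/-! ### Quadratic forms and completion of the square. -/

/-- The quadratic form `∑ M i j s_i s_j`. -/
def quadForm {ι : Type*} [Fintype ι] (M : Matrix ι ι ℝ) (s : EuclideanSpace ℝ ι) : ℝ :=
  ∑ i, ∑ j, M i j * (s i * s j)

section QuadForm

variable {ι : Type*} [Fintype ι] (M : Matrix ι ι ℝ)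

lemma quadForm_smul (c : ℝ) (s : EuclideanSpace ℝ ι) :
    quadForm M (c • s) = c ^ 2 * quadForm M s := by
  simp only [quadForm, PiLp.smul_apply, smul_eq_mul, Finset.mul_sum]
  exact Finset.sum_congr rfl fun i _ => Finset.sum_congr rfl fun j _ => by ring

lemma abs_quadForm_le (s : EuclideanSpace ℝ ι) :
    |quadForm M s| ≤ (∑ i, ∑ j, |M i j|) * ‖s‖ ^ 2 := by
  rw [quadForm, Finset.sum_mul]
  refine (Finset.abs_sum_le_sum_abs _ _).trans (Finset.sum_le_sum fun i _ => ?_)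
  rw [Finset.sum_mul]
  refine (Finset.abs_sum_le_sum_abs _ _).trans (Finset.sum_le_sum fun j _ => ?_)
  rw [abs_mul, abs_mul, sq]
  gcongr <;> exact EuclideanSpace.abs_apply_le_norm _ _

lemma continuous_quadForm : Continuous (quadForm M) := by
  unfold quadForm
  fun_prop

lemma quadForm_eq_dotProduct (s : EuclideanSpace ℝ ι) :
    quadForm M s = s.ofLp ⬝ᵥ (M.mulVec s.ofLp) := by
  simp only [quadForm, dotProduct, Matrix.mulVec, Finset.mul_sum]
  exact Finset.sum_congr rfl fun i _ => Finset.sum_congr rfl fun j _ => by ring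

variable {M} [DecidableEq ι]

/-- The action of a matrix on the Euclidean space. -/
noncomputable def matrixCLM (A : Matrix ι ι ℝ) : EuclideanSpace ℝ ι →L[ℝ] EuclideanSpace ℝ ι :=
  (Matrix.toEuclideanLin A).toContinuousLinearMap

lemma matrixCLM_apply (A : Matrix ι ι ℝ) (x : EuclideanSpace ℝ ι) (i : ι) :
    matrixCLM A x i = ∑ j, A i j * x j := by
  simp [matrixCLM, Matrix.toLpLin_apply, Matrix.mulVec, dotProduct]

/-- Completing the square. -/
lemma inner_sub_quadForm (hM : M.IsSymm) (hdet : M.det ≠ 0) (S t : EuclideanSpace ℝ ι) :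
    inner ℝ S t - 1 / 2 * quadForm M t
      = inner ℝ S (matrixCLM M⁻¹ S) - 1 / 2 * quadForm M (matrixCLM M⁻¹ S)
        - 1 / 2 * quadForm M (t - matrixCLM M⁻¹ S) := by
  set y := matrixCLM M⁻¹ S with hy
  have hS : S.ofLp = M.mulVec y.ofLp := by
    have h1 : y.ofLp = M⁻¹.mulVec S.ofLp := by
      ext i; rw [hy, matrixCLM_apply]; rfl
    rw [h1, Matrix.mulVec_mulVec, Matrix.mul_nonsing_inv _ (isUnit_iff_ne_zero.2 hdet),
      Matrix.one_mulVec]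
  have hin : ∀ x : EuclideanSpace ℝ ι, inner ℝ S x = x.ofLp ⬝ᵥ M.mulVec y.ofLp := fun x => by
    rw [← hS]; simp [PiLp.inner_apply, dotProduct]
  have hsymm : y.ofLp ⬝ᵥ M.mulVec t.ofLp = t.ofLp ⬝ᵥ M.mulVec y.ofLp := by
    rw [Matrix.dotProduct_mulVec, ← Matrix.mulVec_transpose, hM.eq, dotProduct_comm]
  rw [hin, hin, quadForm_eq_dotProduct, quadForm_eq_dotProduct, quadForm_eq_dotProduct,
    WithLp.ofLp_sub, Matrix.mulVec_sub, dotProduct_sub, sub_dotProduct, sub_dotProduct, hsymm]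
  ring

end QuadForm

/-! ### Asymptotics of maximizers: tails, linearization and limits of expectations. -/

/-- Maximizers `est n ∈ T` of the empirical criterion `∑ f (U i) s` whose mean `∫ f u s dν` has a
nondegenerate quadratic maximum at `0`, with Hessian `-M`. -/
structure QuadraticArgmax {Ω 𝒰 ι : Type*} [MeasurableSpace Ω] [MeasurableSpace 𝒰] [Fintype ι]
    [DecidableEq ι] (P : Measure Ω) (ν : Measure 𝒰) (U : ℕ → Ω → 𝒰)
    (T : Set (EuclideanSpace ℝ ι)) (f : 𝒰 → EuclideanSpace ℝ ι → ℝ)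
    (D : 𝒰 → EuclideanSpace ℝ ι) (H : 𝒰 → ℝ) (M : Matrix ι ι ℝ)
    (est : ℕ → Ω → EuclideanSpace ℝ ι) : Prop where
  sample : IsIIDSample P ν U
  family : SmoothFamily ν T f D H
  mem_nhds : T ∈ 𝓝 0
  bounded : ∃ ρ : ℝ, ∀ s ∈ T, ‖s‖ ≤ ρ
  score_mean : ∀ k, ∫ u, D u k ∂ν = 0
  symm : M.IsSymm
  det_ne_zero : M.det ≠ 0
  expansion : (fun s => (∫ u, f u s ∂ν) + 1 / 2 * quadForm M s) =o[𝓝 0] fun s => ‖s‖ ^ 2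
  decay : ∃ c > 0, ∀ s ∈ T, ∫ u, f u s ∂ν ≤ -(c * ‖s‖ ^ 2)
  est_meas : ∀ n, Measurable (est n)
  est_mem : ∀ n ω, est n ω ∈ T
  argmax : ∀ᵐ ω ∂P, ∀ n, ∀ s ∈ T,
    ∑ i ∈ Finset.range n, f (U i ω) s ≤ ∑ i ∈ Finset.range n, f (U i ω) (est n ω)

lemma norm_sqrt_smul {E : Type*} [NormedAddCommGroup E] [NormedSpace ℝ E] (n : ℕ) (s : E) :
    ‖√(n : ℝ) • s‖ = √n * ‖s‖ := by
  rw [norm_smul, Real.norm_of_nonneg (Real.sqrt_nonneg _)]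

namespace QuadraticArgmax

variable {Ω 𝒰 ι : Type*} [MeasurableSpace Ω] [MeasurableSpace 𝒰] [Fintype ι] [DecidableEq ι]
  {P : Measure Ω} [IsProbabilityMeasure P] {ν : Measure 𝒰} {U : ℕ → Ω → 𝒰}
  {T : Set (EuclideanSpace ℝ ι)} {f : 𝒰 → EuclideanSpace ℝ ι → ℝ}
  {D : 𝒰 → EuclideanSpace ℝ ι} {H : 𝒰 → ℝ} {M : Matrix ι ι ℝ}
  {est : ℕ → Ω → EuclideanSpace ℝ ι} (h : QuadraticArgmax P ν U T f D H M est)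

include h

omit [IsProbabilityMeasure P] in
lemma zero_mem : (0 : EuclideanSpace ℝ ι) ∈ T := mem_of_mem_nhds h.mem_nhds

omit [IsProbabilityMeasure P] in
/-- Expansion of the mean criterion with a quantified error. -/
lemma exists_radius {δ : ℝ} (hδ : 0 < δ) : ∃ r > 0, ∀ s, ‖s‖ < r → s ∈ T ∧
    |(∫ u, f u s ∂ν) + 1 / 2 * quadForm M s| ≤ δ * ‖s‖ ^ 2 := by
  have h1 := (h.expansion.bound hδ).and h.mem_nhds
  obtain ⟨r, hr, hball⟩ := Metric.eventually_nhds_iff.1 h1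
  refine ⟨r, hr, fun s hs => ?_⟩
  have := hball (by simpa using hs)
  refine ⟨this.2, ?_⟩
  simpa [Real.norm_eq_abs] using this.1

omit [IsProbabilityMeasure P] in
-- Near `0` the mean criterion is `-1/2 quadForm M s` up to `(c / 2) ‖s‖ ^ 2` and at most `-c ‖s‖ ^
-- 2`; homogeneity carries the resulting inequality to all `s`.
lemma exists_quadForm_lower : ∃ c > 0, ∀ s, c * ‖s‖ ^ 2 ≤ quadForm M s := by
  obtain ⟨c, hc, hdec⟩ := h.decay
  obtain ⟨r, hr, hrad⟩ := h.exists_radius (half_pos hc)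
  refine ⟨c, hc, fun s => ?_⟩
  set t := r / (2 * (‖s‖ + 1)) with ht
  have ht0 : 0 < t := by positivity
  have hts : ‖t • s‖ < r := by
    rw [norm_smul, Real.norm_of_nonneg ht0.le, ht, div_mul_eq_mul_div, div_lt_iff₀ (by positivity)]
    nlinarith [norm_nonneg s]
  obtain ⟨h1, h2⟩ := hrad _ hts
  have h3 := hdec _ h1
  rw [quadForm_smul] at h2
  rw [norm_smul, Real.norm_of_nonneg ht0.le, mul_pow] at h2 h3
  have h4 := (abs_le.1 h2).1
  have h5 : 0 ≤ t ^ 2 * (quadForm M s - c * ‖s‖ ^ 2) := by nlinarith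
  have := nonneg_of_mul_nonneg_right h5 (by positivity)
  linarith

omit [IsProbabilityMeasure P] in
lemma measurable_scaled (n : ℕ) : Measurable fun ω => √(n : ℝ) • est n ω :=
  (continuous_const_smul (√(n : ℝ))).measurable.comp (h.est_meas n)

lemma integrable_scaled_sq (n : ℕ) : Integrable (fun ω => ‖√(n : ℝ) • est n ω‖ ^ 2) P := by
  obtain ⟨ρ, hρ⟩ := h.bounded
  refine (integrable_const ((√n * ρ) ^ 2)).mono'
    ((h.measurable_scaled n).norm.pow_const 2).aestronglyMeasurable (ae_of_all _ fun ω => ?_)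
  rw [Real.norm_of_nonneg (sq_nonneg _), norm_sqrt_smul]
  have := hρ _ (h.est_mem n ω)
  gcongr

lemma memLp_scaled_apply (n : ℕ) (k : ι) : MemLp (fun ω => (√(n : ℝ) • est n ω) k) 2 P := by
  have hm : Measurable fun ω => (√(n : ℝ) • est n ω) k :=
    (EuclideanSpace.proj (𝕜 := ℝ) k).continuous.measurable.comp (h.measurable_scaled n)
  rw [memLp_two_iff_integrable_sq hm.aestronglyMeasurable]
  refine (h.integrable_scaled_sq n).mono' (hm.pow_const 2).aestronglyMeasurable
    (ae_of_all _ fun ω => ?_)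
  rw [Real.norm_of_nonneg (sq_nonneg _), ← sq_abs]
  gcongr
  exact EuclideanSpace.abs_apply_le_norm _ _

/-- The scaled estimation error has uniformly square-integrable tails. -/
lemma sqTailsSmall_scaled : SqTailsSmall P fun n ω => √(n : ℝ) • est n ω := by
  intro ε hε
  obtain ⟨c, hc, hdec⟩ := h.decay
  obtain ⟨ρ, hρ⟩ := h.bounded
  obtain ⟨C, hC, hmaster⟩ := h.family.exists_bound_outside_ball h.sample h.zero_mem hρ
    (show 0 < c / 4 by positivity)
  obtain ⟨L, hL⟩ : ∃ L : ℕ, 2 / c * (C / 4 ^ L) ≤ ε / 2 := by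
    have : Tendsto (fun L : ℕ => 2 / c * (C * (1 / 4 : ℝ) ^ L)) atTop (𝓝 0) := by
      simpa using ((tendsto_pow_atTop_nhds_zero_of_lt_one (by norm_num : (0 : ℝ) ≤ 1 / 4)
        (by norm_num)).const_mul C).const_mul (2 / c)
    obtain ⟨L, hL⟩ := (this.eventually_lt_const (half_pos hε)).exists
    exact ⟨L, by simpa [div_eq_mul_inv] using hL.le⟩
  refine ⟨2 ^ L, by positivity, fun K hK => ?_⟩
  have hR := (tendsto_integral_tailSum_sq h.sample h.family.env_meas h.family.env_int
    h.family.env_nonneg).const_mul (2 / c * (1 / c))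
  rw [mul_zero] at hR
  filter_upwards [hR.eventually_lt_const (half_pos hε), eventually_ge_atTop 1] with n hRn hn
  obtain ⟨G, hG0, hGi, hGC, hG⟩ := hmaster n hn L
  have iR := integrable_tailSum_sq h.sample h.family.env_meas h.family.env_int h.family.env_nonneg n
  calc ∫ ω, {ω | K ≤ ‖√(n : ℝ) • est n ω‖}.indicator (fun ω => ‖√(n : ℝ) • est n ω‖ ^ 2) ω ∂P
      ≤ ∫ ω, 2 / c * (G ω + 1 / c * tailSum ν U H n ω ^ 2) ∂P := by
        refine integral_mono_of_nonneg (ae_of_all _ fun ω => Set.indicator_nonneg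
          (fun _ _ => sq_nonneg _) _) ((hGi.fun_add (iR.const_mul _)).const_mul _) ?_
        filter_upwards [h.argmax] with ω hω
        have hG0 := hG0 ω
        by_cases hK' : K ≤ ‖√(n : ℝ) • est n ω‖
        · rw [norm_sqrt_smul] at hK'
          simp only [Set.indicator, Set.mem_ofPred_eq, norm_sqrt_smul, hK', if_true]
          have hs := h.est_mem n ω
          have key := hG ω _ hs (hK.trans hK')
          have hmax : 0 ≤ ∑ i ∈ Finset.range n, f (U i ω) (est n ω) := by
            simpa [h.family.zero] using hω n 0 h.zero_mem
          have hd := hdec _ hs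
          have hsq : (√(n : ℝ) * ‖est n ω‖) ^ 2 = n * ‖est n ω‖ ^ 2 := by
            rw [mul_pow, Real.sq_sqrt (Nat.cast_nonneg n)]
          -- With `q = √n ‖est‖`, maximality against `s = 0` and the decay of the mean force the
          -- centred sum at the estimate to be at least `c q ^ 2`, while the uniform bound allows
          -- only `(c / 4) q ^ 2 + G + q R`. Splitting `q R` leaves `(c / 2) q ^ 2 ≤ G + R ^ 2 / c`.
          have hlow : c * (√(n : ℝ) * ‖est n ω‖) ^ 2 ≤ centeredSum ν U (fun u => f u (est n ω)) n ω := by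
            rw [centeredSum_eq_sub, hsq]
            have := mul_le_mul_of_nonneg_left hd (Nat.cast_nonneg (α := ℝ) n)
            linarith
          have hup := (le_abs_self _).trans key
          generalize √(n : ℝ) * ‖est n ω‖ = q at *
          generalize tailSum ν U H n ω = R at *
          have h1 : q * R ≤ c / 4 * q ^ 2 + 1 / c * R ^ 2 := by
            have e : c / 4 * q ^ 2 + 1 / c * R ^ 2 - q * R = (c * q - 2 * R) ^ 2 / (4 * c) := by
              field_simp; ring
            have : 0 ≤ (c * q - 2 * R) ^ 2 / (4 * c) := by positivity
            linarith
          have h2 : c / 2 * q ^ 2 ≤ G ω + 1 / c * R ^ 2 := by linarith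
          calc q ^ 2 = 2 / c * (c / 2 * q ^ 2) := by field_simp
            _ ≤ _ := by gcongr
        · simp only [Set.indicator, Set.mem_ofPred_eq, hK', if_false]
          positivity
    _ = 2 / c * (∫ ω, G ω ∂P) + 2 / c * (1 / c) * ∫ ω, tailSum ν U H n ω ^ 2 ∂P := by
        rw [integral_const_mul, integral_add hGi (iR.const_mul _), integral_const_mul]; ring
    _ ≤ 2 / c * (C / 4 ^ L) + 2 / c * (1 / c) * ∫ ω, tailSum ν U H n ω ^ 2 ∂P := by gcongr
    _ ≤ ε := by linarith

end QuadraticArgmax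

/-! ### Second moments of normalized scores. -/

namespace SmoothFamily

variable {Ω 𝒰 ι : Type*} [MeasurableSpace Ω] [MeasurableSpace 𝒰] [Fintype ι] {P : Measure Ω}
  [IsProbabilityMeasure P] {ν : Measure 𝒰} {U : ℕ → Ω → 𝒰}
  {T : Set (EuclideanSpace ℝ ι)} {f : 𝒰 → EuclideanSpace ℝ ι → ℝ}
  {D : 𝒰 → EuclideanSpace ℝ ι} {H : 𝒰 → ℝ} (hf : SmoothFamily ν T f D H)

include hf

lemma integrable_norm_scoreSum_sq (hU : IsIIDSample P ν U) (n : ℕ) :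
    Integrable (fun ω => ‖scoreSum ν U D n ω‖ ^ 2) P := by
  simp only [EuclideanSpace.norm_sq_eq, Real.norm_eq_abs, sq_abs]
  exact integrable_finsetSum _ fun k _ => (hf.memLp_scoreSum_apply hU n k).integrable_sq

lemma sqTailsSmall_scoreSum (hU : IsIIDSample P ν U) : SqTailsSmall P (scoreSum ν U D) := by
  intro ε hε
  obtain ⟨C, hC, hS⟩ := hf.exists_scoreSum_bound hU
  refine ⟨√(2 * (C + 1) / ε), by positivity, fun K hK => ?_⟩
  have hK0 : 0 < K := lt_of_lt_of_le (by positivity) hK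
  have hK2 : C / K ^ 2 ≤ ε / 2 := by
    have : 2 * (C + 1) / ε ≤ K ^ 2 := (Real.sqrt_le_left hK0.le).1 hK
    rw [div_le_iff₀ hε] at this
    rw [div_le_iff₀ (by positivity)]
    linarith
  have hR := (tendsto_integral_tailSum_sq hU hf.env_meas hf.env_int
    hf.env_nonneg).const_mul (4 * (Fintype.card ι : ℝ) ^ 2)
  rw [mul_zero] at hR
  filter_upwards [hR.eventually_lt_const (half_pos hε), eventually_ge_atTop 1] with n hRn hn
  obtain ⟨Y, hY0, hYi, hYC, hY⟩ := hS n hn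
  have iR := integrable_tailSum_sq hU hf.env_meas hf.env_int hf.env_nonneg n
  calc _ ≤ ∫ ω, (Y ω / K ^ 2 + 4 * (Fintype.card ι : ℝ) ^ 2 * tailSum ν U H n ω ^ 2) ∂P := by
        refine integral_mono_of_nonneg (ae_of_all _ fun ω => Set.indicator_nonneg
          (fun _ _ => sq_nonneg _) _) ((hYi.div_const _).fun_add (iR.const_mul _))
          (ae_of_all _ fun ω => ?_)
        have := hY0 ω
        by_cases hω : K ≤ ‖scoreSum ν U D n ω‖
        · simp only [Set.indicator, Set.mem_ofPred_eq, hω, if_true]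
          exact hY ω K hK0 hω
        · simp only [Set.indicator, Set.mem_ofPred_eq, hω, if_false]
          positivity
    _ = (∫ ω, Y ω ∂P) / K ^ 2 + 4 * (Fintype.card ι : ℝ) ^ 2 * ∫ ω, tailSum ν U H n ω ^ 2 ∂P := by
        rw [integral_add (hYi.div_const _) (iR.const_mul _), integral_div, integral_const_mul]
    _ ≤ C / K ^ 2 + 4 * (Fintype.card ι : ℝ) ^ 2 * ∫ ω, tailSum ν U H n ω ^ 2 ∂P := by gcongr
    _ ≤ ε := by linarith

omit [IsProbabilityMeasure P] in
/-- Covariances of the normalized scores of two families. -/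
lemma integral_scoreSum_mul [IsProbabilityMeasure P] (hU : IsIIDSample P ν U)
    {T' : Set (EuclideanSpace ℝ ι)}
    {f' : 𝒰 → EuclideanSpace ℝ ι → ℝ} {D' : 𝒰 → EuclideanSpace ℝ ι} {H' : 𝒰 → ℝ}
    (hf' : SmoothFamily ν T' f' D' H') {n : ℕ} (hn : 1 ≤ n) (j k : ι) :
    ∫ ω, scoreSum ν U D n ω j * scoreSum ν U D' n ω k ∂P
      = ∫ u, D u j * D' u k ∂ν - (∫ u, D u j ∂ν) * ∫ u, D' u k ∂ν := by
  have hn' : (0 : ℝ) < n := by exact_mod_cast hn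
  have e : ∀ ω, scoreSum ν U D n ω j * scoreSum ν U D' n ω k = (n : ℝ)⁻¹
      * (centeredSum ν U (fun u => D u j) n ω * centeredSum ν U (fun u => D' u k) n ω) := fun ω => by
    have : (√(n : ℝ))⁻¹ * (√n)⁻¹ = (n : ℝ)⁻¹ := by
      rw [← mul_inv, Real.mul_self_sqrt hn'.le]
    simp only [scoreSum, ← this]; ring
  simp_rw [e]
  rw [integral_const_mul, hU.integral_centeredSum_mul (hf.measurable_score_apply j)
    (hf'.measurable_score_apply k) (hf.memLp_score_apply j) (hf'.memLp_score_apply k)]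
  field_simp

end SmoothFamily

namespace QuadraticArgmax

variable {Ω 𝒰 ι : Type*} [MeasurableSpace Ω] [MeasurableSpace 𝒰] [Fintype ι] [DecidableEq ι]
  {P : Measure Ω} [IsProbabilityMeasure P] {ν : Measure 𝒰} {U : ℕ → Ω → 𝒰}
  {T : Set (EuclideanSpace ℝ ι)} {f : 𝒰 → EuclideanSpace ℝ ι → ℝ}
  {D : 𝒰 → EuclideanSpace ℝ ι} {H : 𝒰 → ℝ} {M : Matrix ι ι ℝ}
  {est : ℕ → Ω → EuclideanSpace ℝ ι} (h : QuadraticArgmax P ν U T f D H M est)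

include h

omit [IsProbabilityMeasure P] in
lemma measurable_linearized (n : ℕ) : Measurable fun ω => matrixCLM M⁻¹ (scoreSum ν U D n ω) :=
  (matrixCLM M⁻¹).continuous.measurable.comp (h.family.measurable_scoreSum h.sample n)

lemma integrable_linearized_sq (n : ℕ) :
    Integrable (fun ω => ‖matrixCLM M⁻¹ (scoreSum ν U D n ω)‖ ^ 2) P := by
  refine ((h.family.integrable_norm_scoreSum_sq h.sample n).const_mul
    (‖matrixCLM M⁻¹‖ ^ 2)).mono'
    ((h.measurable_linearized n).norm.pow_const 2).aestronglyMeasurable (ae_of_all _ fun ω => ?_)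
  rw [Real.norm_of_nonneg (sq_nonneg _), ← mul_pow]
  gcongr
  exact (matrixCLM M⁻¹).le_opNorm _

/-- On compact sets the scaled estimation error is close to the linearized one. -/
lemma eventually_exists_local_error {K : ℝ} (hK : 0 < K) {ε : ℝ} (hε : 0 < ε) :
    ∀ᶠ n : ℕ in atTop, ∃ V : Ω → ℝ, (∀ ω, 0 ≤ V ω) ∧ Integrable V P ∧ ∫ ω, V ω ∂P ≤ ε ∧
      ∀ᵐ ω ∂P, ‖√(n : ℝ) • est n ω‖ ≤ K → ‖matrixCLM M⁻¹ (scoreSum ν U D n ω)‖ ≤ K →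
        ‖√(n : ℝ) • est n ω - matrixCLM M⁻¹ (scoreSum ν U D n ω)‖ ^ 2 ≤ V ω := by
  obtain ⟨c, hc, hq⟩ := h.exists_quadForm_lower
  set δ := c * ε / (8 * K ^ 2) with hδ
  have hδ0 : 0 < δ := by positivity
  obtain ⟨r, hr, hrad⟩ := h.exists_radius hδ0
  have hlarge : ∀ᶠ n : ℕ in atTop, K / r < √(n : ℝ) :=
    ((Real.tendsto_sqrt_atTop.comp tendsto_natCast_atTop_atTop).eventually_gt_atTop (K / r))
  filter_upwards [h.family.eventually_exists_local_bound h.sample h.zero_mem hK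
    (show 0 < c * ε / 8 by positivity), hlarge] with n ⟨V, hV0, hVi, hVε, hV⟩ hn
  have hsn : 0 < √(n : ℝ) := lt_trans (by positivity) hn
  have hn0 : (0 : ℝ) < n := Real.sqrt_pos.1 hsn
  refine ⟨fun ω => 4 / c * (V ω + δ * K ^ 2), fun ω => by have := hV0 ω; positivity,
    (hVi.fun_add (integrable_const _)).const_mul _, ?_, ?_⟩
  · rw [integral_const_mul, integral_add hVi (integrable_const _)]
    simp only [integral_const, probReal_univ, one_smul]
    have : δ * K ^ 2 = c * ε / 8 := by rw [hδ]; field_simp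
    rw [this]
    calc 4 / c * ((∫ ω, V ω ∂P) + c * ε / 8) ≤ 4 / c * (c * ε / 8 + c * ε / 8) := by gcongr
      _ = ε := by field_simp; norm_num
  · filter_upwards [h.argmax] with ω hω hX hY
    set x := √(n : ℝ) • est n ω with hx
    set S := scoreSum ν U D n ω with hS
    set y := matrixCLM M⁻¹ S with hy
    set sy := (√(n : ℝ))⁻¹ • y with hsy
    have y_eq : √(n : ℝ) • sy = y := by rw [hsy, smul_smul, mul_inv_cancel₀ hsn.ne', one_smul]
    -- For bounded `t = √n • s` the empirical criterion is `inner S t - 1/2 quadForm M t` up to `V +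
    -- δ K ^ 2`. Large `n` also puts `s` inside `T`, which makes `sy` an admissible competitor of
    -- the estimate.
    have val : ∀ s : EuclideanSpace ℝ ι, ‖√(n : ℝ) • s‖ ≤ K → s ∈ T ∧
        |∑ i ∈ Finset.range n, f (U i ω) s
          - (inner ℝ S (√(n : ℝ) • s) - 1 / 2 * quadForm M (√(n : ℝ) • s))| ≤ V ω + δ * K ^ 2 := by
      intro s hs
      have hsK := hs
      rw [norm_sqrt_smul] at hsK
      have hsr : ‖s‖ < r := by
        rw [div_lt_iff₀ hr] at hn
        by_contra hcon
        have := mul_le_mul_of_nonneg_left (not_lt.1 hcon) hsn.le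
        linarith
      obtain ⟨hsT, hexp⟩ := hrad s hsr
      refine ⟨hsT, ?_⟩
      have h1 := hV ω s hsT hsK
      have h2 : |n * (∫ u, f u s ∂ν) + 1 / 2 * quadForm M (√(n : ℝ) • s)| ≤ δ * K ^ 2 := by
        rw [quadForm_smul, Real.sq_sqrt hn0.le]
        have e : n * (∫ u, f u s ∂ν) + 1 / 2 * (n * quadForm M s)
            = n * ((∫ u, f u s ∂ν) + 1 / 2 * quadForm M s) := by ring
        rw [e, abs_mul, abs_of_pos hn0]
        calc n * |(∫ u, f u s ∂ν) + 1 / 2 * quadForm M s| ≤ n * (δ * ‖s‖ ^ 2) := by gcongr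
          _ = δ * (√n * ‖s‖) ^ 2 := by rw [mul_pow, Real.sq_sqrt hn0.le]; ring
          _ ≤ _ := by gcongr
      rw [centeredSum_eq_sub] at h1
      refine le_trans (le_of_eq ?_) ((abs_add_le _ _).trans (add_le_add h1 h2))
      congr 1; ring
    obtain ⟨-, v1⟩ := val _ hX
    obtain ⟨hyT, v2⟩ := val sy (by rw [y_eq]; exact hY)
    -- The quadratic at `x` falls short of its maximum, attained at `y`, by at least `(c / 2) ‖x -
    -- y‖ ^ 2`. Since the estimate maximizes the empirical criterion, the shortfall is at most two
    -- approximation errors; hence the factor `4 / c`.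
    have hmax := hω n sy hyT
    rw [y_eq] at v2
    rw [← hx] at v1
    have sq := inner_sub_quadForm h.symm h.det_ne_zero S x
    rw [← hy] at sq
    have low := hq (x - y)
    have a1 := (abs_le.1 v1).2
    have a2 := (abs_le.1 v2).1
    have : c * ‖x - y‖ ^ 2 ≤ 4 * (V ω + δ * K ^ 2) := by linarith
    rw [div_mul_eq_mul_div, le_div_iff₀ hc]
    linarith

/-- The scaled estimation error is asymptotically linear in mean square. -/
lemma tendsto_integral_scaled_sub_sq :
    Tendsto (fun n : ℕ => ∫ ω, ‖√(n : ℝ) • est n ω - matrixCLM M⁻¹ (scoreSum ν U D n ω)‖ ^ 2 ∂P)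
      atTop (𝓝 0) :=
  tendsto_integral_norm_sub_sq h.measurable_scaled h.measurable_linearized h.integrable_scaled_sq
    h.integrable_linearized_sq h.sqTailsSmall_scaled
    ((h.family.sqTailsSmall_scoreSum h.sample).clm (h.family.measurable_scoreSum h.sample)
      (h.family.integrable_norm_scoreSum_sq h.sample) _)
    fun _ hK _ hε => h.eventually_exists_local_error hK hε

lemma memLp_linearized_apply (n : ℕ) (k : ι) :
    MemLp (fun ω => matrixCLM M⁻¹ (scoreSum ν U D n ω) k) 2 P := by
  simp_rw [matrixCLM_apply]
  exact memLp_finsetSum _ fun l _ => (h.family.memLp_scoreSum_apply h.sample n l).const_mul _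

lemma tendsto_integral_scaled_sub_apply_sq (k : ι) :
    Tendsto (fun n : ℕ => ∫ ω, ((√(n : ℝ) • est n ω) k
      - matrixCLM M⁻¹ (scoreSum ν U D n ω) k) ^ 2 ∂P) atTop (𝓝 0) := by
  refine squeeze_zero (fun n => integral_nonneg fun _ => sq_nonneg _) (fun n => ?_)
    h.tendsto_integral_scaled_sub_sq
  have hi : Integrable (fun ω => ‖√(n : ℝ) • est n ω
      - matrixCLM M⁻¹ (scoreSum ν U D n ω)‖ ^ 2) P := by
    refine (((h.integrable_scaled_sq n).const_mul 2).fun_add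
      ((h.integrable_linearized_sq n).const_mul 2)).mono'
      (((h.measurable_scaled n).sub (h.measurable_linearized n)).norm.pow_const 2).aestronglyMeasurable
      (ae_of_all _ fun ω => ?_)
    rw [Real.norm_of_nonneg (sq_nonneg _)]
    have htri := norm_sub_le (√(n : ℝ) • est n ω) (matrixCLM M⁻¹ (scoreSum ν U D n ω))
    have := pow_le_pow_left₀ (norm_nonneg _) htri 2
    nlinarith [sq_nonneg (‖√(n : ℝ) • est n ω‖ - ‖matrixCLM M⁻¹ (scoreSum ν U D n ω)‖)]
  refine integral_mono_of_nonneg (ae_of_all _ fun _ => sq_nonneg _) hi (ae_of_all _ fun ω => ?_)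
  have := EuclideanSpace.abs_apply_le_norm
    (√(n : ℝ) • est n ω - matrixCLM M⁻¹ (scoreSum ν U D n ω)) k
  rw [PiLp.sub_apply] at this
  simp only
  rw [← sq_abs]
  gcongr

/-- Centring `D` alone already removes the product of means from the covariance, so `D'` may have
nonzero mean. This matters because `βbar` need not maximize the mean of `log p_y`. -/
lemma integral_score_mul_linearized {g : 𝒰 → EuclideanSpace ℝ ι → ℝ}
    {D' : 𝒰 → EuclideanSpace ℝ ι} {H' : 𝒰 → ℝ} (hg : SmoothFamily ν T g D' H') {n : ℕ}
    (hn : 1 ≤ n) (j k : ι) :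
    ∫ ω, scoreSum ν U D' n ω j * matrixCLM M⁻¹ (scoreSum ν U D n ω) k ∂P
      = ∑ l, M⁻¹ k l * ∫ u, D' u j * D u l ∂ν := by
  simp_rw [matrixCLM_apply, Finset.mul_sum]
  have i1 : ∀ l, Integrable (fun ω => scoreSum ν U D' n ω j * scoreSum ν U D n ω l) P := fun l =>
    (hg.memLp_scoreSum_apply h.sample n j).integrable_mul
      (h.family.memLp_scoreSum_apply h.sample n l)
  have e : ∀ l ω, scoreSum ν U D' n ω j * (M⁻¹ k l * scoreSum ν U D n ω l)
      = M⁻¹ k l * (scoreSum ν U D' n ω j * scoreSum ν U D n ω l) := fun l ω => by ring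
  simp_rw [e]
  rw [integral_finsetSum _ fun l _ => (i1 l).const_mul _]
  refine Finset.sum_congr rfl fun l _ => ?_
  rw [integral_const_mul, hg.integral_scoreSum_mul h.sample h.family hn, h.score_mean, mul_zero,
    sub_zero]

lemma integral_linearized_mul {n : ℕ} (hn : 1 ≤ n) (i j : ι) :
    ∫ ω, matrixCLM M⁻¹ (scoreSum ν U D n ω) i * matrixCLM M⁻¹ (scoreSum ν U D n ω) j ∂P
      = ∑ k, M⁻¹ i k * ∑ l, M⁻¹ j l * ∫ u, D u k * D u l ∂ν := by
  have e : ∀ ω, matrixCLM M⁻¹ (scoreSum ν U D n ω) i * matrixCLM M⁻¹ (scoreSum ν U D n ω) j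
      = ∑ k, M⁻¹ i k * (scoreSum ν U D n ω k * matrixCLM M⁻¹ (scoreSum ν U D n ω) j) := fun ω => by
    conv_lhs => rw [matrixCLM_apply, Finset.sum_mul]
    exact Finset.sum_congr rfl fun k _ => by ring
  have i1 : ∀ k, Integrable (fun ω => scoreSum ν U D n ω k
      * matrixCLM M⁻¹ (scoreSum ν U D n ω) j) P := fun k =>
    (h.family.memLp_scoreSum_apply h.sample n k).integrable_mul (h.memLp_linearized_apply n j)
  simp_rw [e]
  rw [integral_finsetSum _ fun k _ => (i1 k).const_mul _]
  refine Finset.sum_congr rfl fun k _ => ?_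
  rw [integral_const_mul, h.integral_score_mul_linearized h.family hn]

/-- The limiting second moments of the scaled estimation error. -/
lemma tendsto_integral_scaled_mul (i j : ι) :
    Tendsto (fun n : ℕ => ∫ ω, (√(n : ℝ) • est n ω) i * (√(n : ℝ) • est n ω) j ∂P) atTop
      (𝓝 (∑ k, M⁻¹ i k * ∑ l, M⁻¹ j l * ∫ u, D u k * D u l ∂ν)) := by
  have hb : ∀ k, ∀ᶠ n in atTop, ∫ ω, matrixCLM M⁻¹ (scoreSum ν U D n ω) k ^ 2 ∂P
      ≤ ∑ k', |∑ k₁, M⁻¹ k' k₁ * ∑ l, M⁻¹ k' l * ∫ u, D u k₁ * D u l ∂ν| := fun k => by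
    filter_upwards [eventually_ge_atTop 1] with n hn
    simp_rw [sq]
    rw [h.integral_linearized_mul hn]
    exact (le_abs_self _).trans (Finset.single_le_sum
      (f := fun k' => |∑ k₁, M⁻¹ k' k₁ * ∑ l, M⁻¹ k' l * ∫ u, D u k₁ * D u l ∂ν|)
      (fun _ _ => abs_nonneg _) (Finset.mem_univ k))
  have := tendsto_integral_mul_sub (fun n => h.memLp_scaled_apply n i)
    (fun n => h.memLp_scaled_apply n j) (fun n => h.memLp_linearized_apply n i)
    (fun n => h.memLp_linearized_apply n j) (h.tendsto_integral_scaled_sub_apply_sq i)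
    (h.tendsto_integral_scaled_sub_apply_sq j) (hb i) (hb j)
  have h2 := this.add_const (∑ k, M⁻¹ i k * ∑ l, M⁻¹ j l * ∫ u, D u k * D u l ∂ν)
  rw [zero_add] at h2
  refine h2.congr' ?_
  filter_upwards [eventually_ge_atTop 1] with n hn
  rw [h.integral_linearized_mul hn]; ring

/-- Expectation of a function with a quadratic expansion at the estimate. -/
theorem tendsto_integral_quadratic {Φ : EuclideanSpace ℝ ι → ℝ} {N : Matrix ι ι ℝ}
    (hΦm : ∀ n, Measurable fun ω => Φ (est n ω))
    (hΦ : (fun s => Φ s - 1 / 2 * quadForm N s) =o[𝓝 0] fun s => ‖s‖ ^ 2)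
    {C : ℝ} (hC : ∀ s ∈ T, |Φ s| ≤ C * ‖s‖ ^ 2) :
    Tendsto (fun n : ℕ => ∫ ω, n * Φ (est n ω) ∂P) atTop
      (𝓝 (1 / 2 * ∑ i, ∑ j, N i j * ∑ k, M⁻¹ i k * ∑ l, M⁻¹ j l * ∫ u, D u k * D u l ∂ν)) := by
  have hi : ∀ (n : ℕ) i j,
      Integrable (fun ω => (√(n : ℝ) • est n ω) i * (√(n : ℝ) • est n ω) j) P :=
    fun n i j => (h.memLp_scaled_apply n i).integrable_mul (h.memLp_scaled_apply n j)
  have iq : ∀ n : ℕ, Integrable (fun ω => quadForm N (√(n : ℝ) • est n ω)) P := fun n => by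
    unfold quadForm
    exact integrable_finsetSum _ fun i _ => integrable_finsetSum _ fun j _ =>
      (hi n i j).const_mul _
  have hmain : Tendsto (fun n : ℕ => ∫ ω, 1 / 2 * quadForm N (√(n : ℝ) • est n ω) ∂P) atTop
      (𝓝 (1 / 2 * ∑ i, ∑ j, N i j * ∑ k, M⁻¹ i k * ∑ l, M⁻¹ j l * ∫ u, D u k * D u l ∂ν)) := by
    have : ∀ n : ℕ, ∫ ω, 1 / 2 * quadForm N (√(n : ℝ) • est n ω) ∂P = 1 / 2 * ∑ i, ∑ j, N i j
        * ∫ ω, (√(n : ℝ) • est n ω) i * (√(n : ℝ) • est n ω) j ∂P := fun n => by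
      unfold quadForm
      have i1 : ∀ i, Integrable (fun ω => ∑ j, N i j
          * ((√(n : ℝ) • est n ω) i * (√(n : ℝ) • est n ω) j)) P := fun i =>
        integrable_finsetSum _ fun j _ => (hi n i j).const_mul _
      rw [integral_const_mul, integral_finsetSum _ fun i _ => i1 i]
      congr 1
      refine Finset.sum_congr rfl fun i _ => ?_
      rw [integral_finsetSum _ fun j _ => (hi n i j).const_mul _]
      simp_rw [integral_const_mul]
    simp_rw [this]
    exact (tendsto_finsetSum _ fun i _ => tendsto_finsetSum _ fun j _ =>
      (h.tendsto_integral_scaled_mul i j).const_mul _).const_mul _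
  have hsq : ∀ (n : ℕ) ω, ‖√(n : ℝ) • est n ω‖ ^ 2 = n * ‖est n ω‖ ^ 2 := fun n ω => by
    rw [norm_sqrt_smul, mul_pow, Real.sq_sqrt (Nat.cast_nonneg n)]
  -- A global quadratic bound for the error, used where `√n ‖est‖ ≥ K`, a region whose contribution
  -- is a small tail. Elsewhere `est` is small for large `n` and the expansion at `0` applies.
  set B := |C| + ∑ i, ∑ j, |N i j| with hB
  have hB0 : 0 ≤ B := by positivity
  have hbound : ∀ (n : ℕ) ω, |n * Φ (est n ω) - 1 / 2 * quadForm N (√(n : ℝ) • est n ω)|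
      ≤ B * ‖√(n : ℝ) • est n ω‖ ^ 2 := fun n ω => by
    have h1 := hC _ (h.est_mem n ω)
    have h2 := abs_quadForm_le N (√(n : ℝ) • est n ω)
    refine (abs_sub _ _).trans ?_
    rw [abs_mul, abs_mul, Nat.abs_cast, abs_of_pos (by norm_num : (0 : ℝ) < 1 / 2), hB, add_mul]
    refine add_le_add ?_ ?_
    · rw [hsq]
      have h3 : C * ‖est n ω‖ ^ 2 ≤ |C| * ‖est n ω‖ ^ 2 := by gcongr; exact le_abs_self _
      calc (n : ℝ) * |Φ (est n ω)| ≤ n * (|C| * ‖est n ω‖ ^ 2) := by gcongr; linarith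
        _ = _ := by ring
    · have := abs_nonneg (quadForm N (√(n : ℝ) • est n ω))
      linarith
  have iΦ : ∀ n : ℕ, Integrable (fun ω => n * Φ (est n ω)) P := fun n => by
    refine (((h.integrable_scaled_sq n).const_mul B).fun_add
      ((iq n).const_mul (1 / 2)).abs).mono' ((hΦm n).const_mul _).aestronglyMeasurable
      (ae_of_all _ fun ω => ?_)
    have := hbound n ω
    have h2 := abs_add_le (n * Φ (est n ω) - 1 / 2 * quadForm N (√(n : ℝ) • est n ω))
      (1 / 2 * quadForm N (√(n : ℝ) • est n ω))
    rw [sub_add_cancel] at h2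
    rw [Real.norm_eq_abs]
    linarith
  obtain ⟨E₂, hE₂, hE⟩ := h.sqTailsSmall_scaled.eventually_integral_le h.measurable_scaled
    h.integrable_scaled_sq
  have hdiff : Tendsto (fun n : ℕ => ∫ ω, n * Φ (est n ω) ∂P
      - ∫ ω, 1 / 2 * quadForm N (√(n : ℝ) • est n ω) ∂P) atTop (𝓝 0) := by
    rw [Metric.tendsto_nhds]
    intro ε hε
    set δ := ε / (4 * (E₂ + 1)) with hδ
    have hδ0 : 0 < δ := by positivity
    obtain ⟨r, hr, hrad⟩ := Metric.eventually_nhds_iff.1 (hΦ.bound hδ0)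
    obtain ⟨K, hK, htail⟩ := h.sqTailsSmall_scaled (ε / (4 * (B + 1))) (by positivity)
    have hlarge : ∀ᶠ n : ℕ in atTop, K / r < √(n : ℝ) :=
      ((Real.tendsto_sqrt_atTop.comp tendsto_natCast_atTop_atTop).eventually_gt_atTop (K / r))
    filter_upwards [hE, htail K le_rfl, hlarge] with n hn₁ hn₂ hn₃
    have it := integrable_sq_tail (h.measurable_scaled n) (h.integrable_scaled_sq n) K
    rw [Real.dist_eq, sub_zero, ← integral_sub (iΦ n) ((iq n).const_mul _)]
    refine lt_of_le_of_lt abs_integral_le_integral_abs ?_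
    calc ∫ ω, |n * Φ (est n ω) - 1 / 2 * quadForm N (√(n : ℝ) • est n ω)| ∂P
        ≤ ∫ ω, (δ * ‖√(n : ℝ) • est n ω‖ ^ 2 + B * {ω | K ≤ ‖√(n : ℝ) • est n ω‖}.indicator
            (fun ω => ‖√(n : ℝ) • est n ω‖ ^ 2) ω) ∂P := by
          refine integral_mono_of_nonneg (ae_of_all _ fun _ => abs_nonneg _)
            (((h.integrable_scaled_sq n).const_mul _).fun_add (it.const_mul _))
            (ae_of_all _ fun ω => ?_)
          by_cases hω : K ≤ ‖√(n : ℝ) • est n ω‖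
          · simp only [Set.indicator, Set.mem_ofPred_eq, hω, if_true]
            have := hbound n ω
            have h2 : 0 ≤ δ * ‖√(n : ℝ) • est n ω‖ ^ 2 := by positivity
            linarith
          · simp only [Set.indicator, Set.mem_ofPred_eq, hω, if_false, mul_zero, add_zero]
            rw [norm_sqrt_smul] at hω
            have hsr : ‖est n ω‖ < r := by
              rw [div_lt_iff₀ hr] at hn₃
              by_contra hcon
              have := mul_le_mul_of_nonneg_left (not_lt.1 hcon) (Real.sqrt_nonneg (n : ℝ))
              linarith
            have h1 := hrad (y := est n ω) (by simpa using hsr)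
            rw [Real.norm_eq_abs, Real.norm_of_nonneg (sq_nonneg _)] at h1
            rw [quadForm_smul, hsq, Real.sq_sqrt (Nat.cast_nonneg n)]
            calc |n * Φ (est n ω) - 1 / 2 * (n * quadForm N (est n ω))|
                = n * |Φ (est n ω) - 1 / 2 * quadForm N (est n ω)| := by
                  rw [← Nat.abs_cast n, ← abs_mul, Nat.abs_cast]; congr 1; ring
              _ ≤ n * (δ * ‖est n ω‖ ^ 2) := by gcongr
              _ = _ := by ring
      _ = δ * (∫ ω, ‖√(n : ℝ) • est n ω‖ ^ 2 ∂P) + B * ∫ ω, {ω | K ≤ ‖√(n : ℝ) • est n ω‖}.indicator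
            (fun ω => ‖√(n : ℝ) • est n ω‖ ^ 2) ω ∂P := by
          rw [integral_add ((h.integrable_scaled_sq n).const_mul _) (it.const_mul _),
            integral_const_mul, integral_const_mul]
      _ ≤ δ * E₂ + B * (ε / (4 * (B + 1))) := by gcongr
      _ ≤ ε / 4 + ε / 4 := by
          gcongr
          · rw [hδ, div_mul_eq_mul_div, div_le_div_iff₀ (by positivity) (by positivity)]
            nlinarith
          · rw [mul_div_assoc', div_le_div_iff₀ (by positivity) (by positivity)]
            nlinarith
      _ < ε := by linarith
  have := hdiff.add hmain
  rw [zero_add] at this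
  exact this.congr fun n => by ring

/-- Expectation of the empirical process of a second family at the estimate. -/
theorem tendsto_integral_centeredSum {g : 𝒰 → EuclideanSpace ℝ ι → ℝ}
    {D' : 𝒰 → EuclideanSpace ℝ ι} {H' : 𝒰 → ℝ} (hg : SmoothFamily ν T g D' H') :
    Tendsto (fun n : ℕ => ∫ ω, centeredSum ν U (fun u => g u (est n ω)) n ω ∂P) atTop
      (𝓝 (∑ k, ∑ l, M⁻¹ k l * ∫ u, D' u k * D u l ∂ν)) := by
  have := h.sample.isProbabilityMeasure
  have mS := fun n k => hg.memLp_scoreSum_apply h.sample n k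
  -- The linear part of the empirical process at the estimate. In its expectation the scaled
  -- estimate may be replaced by `M⁻¹` times its score, which leaves covariances of two scores.
  have hmain : Tendsto (fun n : ℕ => ∫ ω, inner ℝ (scoreSum ν U D' n ω) (√(n : ℝ) • est n ω) ∂P)
      atTop (𝓝 (∑ k, ∑ l, M⁻¹ k l * ∫ u, D' u k * D u l ∂ν)) := by
    have e : ∀ n : ℕ, ∫ ω, inner ℝ (scoreSum ν U D' n ω) (√(n : ℝ) • est n ω) ∂P
        = ∑ k, ∫ ω, scoreSum ν U D' n ω k * (√(n : ℝ) • est n ω) k ∂P := fun n => by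
      have i1 : ∀ k, Integrable (fun ω => scoreSum ν U D' n ω k * (√(n : ℝ) • est n ω) k) P :=
        fun k => (mS n k).integrable_mul (h.memLp_scaled_apply n k)
      rw [← integral_finsetSum _ fun k _ => i1 k]
      refine integral_congr_ae (ae_of_all _ fun ω => ?_)
      simp [PiLp.inner_apply, mul_comm]
    simp_rw [e]
    refine tendsto_finsetSum _ fun k _ => ?_
    have hz : ∀ n : ℕ, ∫ ω, (scoreSum ν U D' n ω k - scoreSum ν U D' n ω k) ^ 2 ∂P = 0 := by simp
    obtain ⟨C₁, -, hC₁⟩ := (hg.sqTailsSmall_scoreSum h.sample).eventually_integral_le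
      (hg.measurable_scoreSum h.sample) (hg.integrable_norm_scoreSum_sq h.sample)
    obtain ⟨C₂, -, hC₂⟩ := (((h.family.sqTailsSmall_scoreSum h.sample).clm
      (h.family.measurable_scoreSum h.sample) (h.family.integrable_norm_scoreSum_sq h.sample)
      (matrixCLM M⁻¹))).eventually_integral_le h.measurable_linearized h.integrable_linearized_sq
    have := tendsto_integral_mul_sub (C := max C₁ C₂) (fun n => mS n k)
      (fun n => h.memLp_scaled_apply n k) (fun n => mS n k)
      (fun n => h.memLp_linearized_apply n k) (by simp_rw [hz]; exact tendsto_const_nhds)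
      (h.tendsto_integral_scaled_sub_apply_sq k)
      (by
        filter_upwards [hC₁] with n hn
        refine le_trans ?_ (hn.trans (le_max_left _ _))
        refine integral_mono (mS n k).integrable_sq (hg.integrable_norm_scoreSum_sq h.sample n)
          fun ω => ?_
        simp only
        rw [← sq_abs]
        gcongr
        exact EuclideanSpace.abs_apply_le_norm _ _)
      (by
        filter_upwards [hC₂] with n hn
        refine le_trans ?_ (hn.trans (le_max_right _ _))
        refine integral_mono (h.memLp_linearized_apply n k).integrable_sq
          (h.integrable_linearized_sq n) fun ω => ?_
        simp only
        rw [← sq_abs]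
        gcongr
        exact EuclideanSpace.abs_apply_le_norm _ _)
    have h2 := this.add_const (∑ l, M⁻¹ k l * ∫ u, D' u k * D u l ∂ν)
    rw [zero_add] at h2
    refine h2.congr' ?_
    filter_upwards [eventually_ge_atTop 1] with n hn
    rw [h.integral_score_mul_linearized hg hn]; ring
  have iin : ∀ n : ℕ,
      Integrable (fun ω => inner ℝ (scoreSum ν U D' n ω) (√(n : ℝ) • est n ω)) P := fun n => by
    simp only [PiLp.inner_apply, RCLike.inner_apply, conj_trivial]
    exact integrable_finsetSum _ fun k _ => (h.memLp_scaled_apply n k).integrable_mul (mS n k)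
  obtain ⟨ρ, hρ⟩ := h.bounded
  have hρ0 : 0 ≤ ρ := (norm_nonneg _).trans (hρ 0 h.zero_mem)
  have iH := hg.memLp_sqrt_env.integrable one_le_two
  have ics : ∀ n : ℕ, Integrable (fun ω => centeredSum ν U (fun u => g u (est n ω)) n ω) P :=
    fun n => by
      have hm : Measurable fun ω => centeredSum ν U (fun u => g u (est n ω)) n ω :=
        Finset.measurable_sum _ fun i _ => (hg.measurable_eval (h.sample.measurable i)
          (h.est_meas n) (h.est_mem n)).sub
            (hg.measurable_integral_eval h.zero_mem (h.est_meas n) (h.est_mem n))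
      refine Integrable.mono' (g := fun ω => ∑ i ∈ Finset.range n, ρ * √(H' (U i ω))
          + n * ∫ u, ρ * √(H' u) ∂ν)
        ((integrable_finsetSum _ fun i _ => (h.sample.integrable_comp iH i).const_mul _).fun_add
          (integrable_const _)) hm.aestronglyMeasurable (ae_of_all _ fun ω => ?_)
      exact abs_centeredSum_le (iH.const_mul ρ) (fun u =>
        (hg.abs_le h.zero_mem u (h.est_mem n ω)).trans
          (mul_le_mul_of_nonneg_right (hρ _ (h.est_mem n ω)) (Real.sqrt_nonneg _))) n ω
  have hdiff : Tendsto (fun n : ℕ => ∫ ω, centeredSum ν U (fun u => g u (est n ω)) n ω ∂P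
      - ∫ ω, inner ℝ (scoreSum ν U D' n ω) (√(n : ℝ) • est n ω) ∂P) atTop (𝓝 0) := by
    rw [Metric.tendsto_nhds]
    intro ε hε
    obtain ⟨E₂, hE₂, hE⟩ := (hg.sqTailsSmall_scoreSum h.sample).eventually_integral_le
      (hg.measurable_scoreSum h.sample) (hg.integrable_norm_scoreSum_sq h.sample)
    set θ := ε / (8 * (E₂ + 1)) with hθ
    have hθ0 : 0 < θ := by positivity
    have hθE : θ * E₂ ≤ ε / 8 := by
      rw [hθ, div_mul_eq_mul_div, div_le_div_iff₀ (by positivity) (by positivity)]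
      nlinarith
    -- The constant `1` before the square is harmless: it meets only a tail of `n ‖est‖ ^ 2`. The
    -- coefficient `2 + 1 / θ` below collects it, the square from `q R ≤ q ^ 2 + R ^ 2`, and the one
    -- from `S q ≤ θ S ^ 2 + q ^ 2 / θ`.
    obtain ⟨C, hC, hmaster⟩ := hg.exists_bound_outside_ball h.sample h.zero_mem hρ one_pos
    obtain ⟨K₀, hK₀, htail⟩ := h.sqTailsSmall_scaled (ε / (8 * (2 + 1 / θ))) (by positivity)
    obtain ⟨L, hL₁, hL₂⟩ : ∃ L : ℕ, C / 4 ^ L ≤ ε / 8 ∧ K₀ ≤ 2 ^ L := by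
      have h1 : Tendsto (fun L : ℕ => C * (1 / 4 : ℝ) ^ L) atTop (𝓝 0) := by
        simpa using (tendsto_pow_atTop_nhds_zero_of_lt_one (by norm_num : (0 : ℝ) ≤ 1 / 4)
          (by norm_num)).const_mul C
      have h2 := (tendsto_pow_atTop_atTop_of_one_lt (one_lt_two (α := ℝ))).eventually_ge_atTop K₀
      obtain ⟨L, hL, hL'⟩ := ((h1.eventually_lt_const (show 0 < ε / 8 by positivity)).and h2).exists
      exact ⟨L, by simpa [div_eq_mul_inv] using hL.le, hL'⟩
    have hR := tendsto_integral_tailSum_sq h.sample hg.env_meas hg.env_int hg.env_nonneg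
    filter_upwards [hE, htail _ hL₂, hR.eventually_lt_const (show 0 < ε / 8 by positivity),
      hg.eventually_exists_local_bound h.sample h.zero_mem (K := 2 ^ L) (by positivity)
        (show 0 < ε / 8 by positivity), eventually_ge_atTop 1]
      with n hn₁ hn₂ hn₃ ⟨V, hV0, hVi, hVε, hV⟩ hn
    obtain ⟨G, hG0, hGi, hGC, hG⟩ := hmaster n hn L
    have it := integrable_sq_tail (h.measurable_scaled n) (h.integrable_scaled_sq n) (2 ^ L)
    have iR := integrable_tailSum_sq h.sample hg.env_meas hg.env_int hg.env_nonneg n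
    have iS := hg.integrable_norm_scoreSum_sq h.sample n
    rw [Real.dist_eq, sub_zero, ← integral_sub (ics n) (iin n)]
    refine lt_of_le_of_lt abs_integral_le_integral_abs ?_
    have iA := (hVi.fun_add hGi).fun_add iR
    have iB := (iS.const_mul θ).fun_add (it.const_mul (2 + 1 / θ))
    calc ∫ ω, |centeredSum ν U (fun u => g u (est n ω)) n ω
          - inner ℝ (scoreSum ν U D' n ω) (√(n : ℝ) • est n ω)| ∂P
        ≤ ∫ ω, (V ω + G ω + tailSum ν U H' n ω ^ 2 + (θ * ‖scoreSum ν U D' n ω‖ ^ 2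
          + (2 + 1 / θ) * {ω | 2 ^ L ≤ ‖√(n : ℝ) • est n ω‖}.indicator
            (fun ω => ‖√(n : ℝ) • est n ω‖ ^ 2) ω)) ∂P := by
          refine integral_mono_of_nonneg (ae_of_all _ fun _ => abs_nonneg _)
            (iA.fun_add iB) (ae_of_all _ fun ω => ?_)
          have := hV0 ω
          have := hG0 ω
          have hsT := h.est_mem n ω
          by_cases hω : 2 ^ L ≤ ‖√(n : ℝ) • est n ω‖
          · simp only [Set.indicator, Set.mem_ofPred_eq, hω, if_true]
            have h1 := hG ω _ hsT (by rwa [norm_sqrt_smul] at hω)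
            rw [← norm_sqrt_smul] at h1
            have h2 := abs_real_inner_le_norm (scoreSum ν U D' n ω) (√(n : ℝ) • est n ω)
            have h3 := abs_sub (centeredSum ν U (fun u => g u (est n ω)) n ω)
              (inner ℝ (scoreSum ν U D' n ω) (√(n : ℝ) • est n ω))
            generalize ‖√(n : ℝ) • est n ω‖ = q at *
            generalize ‖scoreSum ν U D' n ω‖ = S at *
            generalize tailSum ν U H' n ω = R at *
            have h4 : q * R ≤ q ^ 2 + R ^ 2 := by nlinarith [sq_nonneg (q - R), sq_nonneg q, sq_nonneg R]
            have h5 : S * q ≤ θ * S ^ 2 + 1 / θ * q ^ 2 := by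
              have e : θ * S ^ 2 + 1 / θ * q ^ 2 - S * q
                  = ((θ * S - q / 2) ^ 2 + 3 / 4 * q ^ 2) / θ := by field_simp; ring
              have : 0 ≤ ((θ * S - q / 2) ^ 2 + 3 / 4 * q ^ 2) / θ := by positivity
              linarith
            linarith
          · simp only [Set.indicator, Set.mem_ofPred_eq, hω, if_false, mul_zero, add_zero]
            have h1 := hV ω _ hsT (by rw [← norm_sqrt_smul]; exact (not_le.1 hω).le)
            have : 0 ≤ θ * ‖scoreSum ν U D' n ω‖ ^ 2 := by positivity
            nlinarith [sq_nonneg (tailSum ν U H' n ω)]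
      _ = (∫ ω, V ω ∂P) + (∫ ω, G ω ∂P) + (∫ ω, tailSum ν U H' n ω ^ 2 ∂P)
          + (θ * (∫ ω, ‖scoreSum ν U D' n ω‖ ^ 2 ∂P)
          + (2 + 1 / θ) * ∫ ω, {ω | 2 ^ L ≤ ‖√(n : ℝ) • est n ω‖}.indicator
            (fun ω => ‖√(n : ℝ) • est n ω‖ ^ 2) ω ∂P) := by
          rw [integral_add iA iB, integral_add (hVi.fun_add hGi) iR, integral_add hVi hGi,
            integral_add (iS.const_mul θ) (it.const_mul (2 + 1 / θ)), integral_const_mul,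
            integral_const_mul]
      _ ≤ ε / 8 + C / 4 ^ L + ε / 8 + (θ * E₂ + (2 + 1 / θ) * (ε / (8 * (2 + 1 / θ)))) := by
          gcongr
      _ ≤ ε / 8 + ε / 8 + ε / 8 + (ε / 8 + ε / 8) := by
          gcongr
          rw [mul_div_assoc', div_le_div_iff₀ (by positivity) (by positivity)]
          nlinarith [show 0 < 1 / θ by positivity]
      _ < ε := by linarith
  have := hdiff.add hmain
  rw [zero_add] at this
  exact this.congr fun n => by ring

end QuadraticArgmax

/-! ### Taylor estimates from bounds on partial derivatives. -/

section Calculus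

variable {ι : Type*} [Fintype ι] [DecidableEq ι]

/-- The gradient of `G`, as a vector of partial derivatives. -/
noncomputable def gradVec (G : EuclideanSpace ℝ ι → ℝ) (β : EuclideanSpace ℝ ι) :
    EuclideanSpace ℝ ι :=
  WithLp.toLp 2 fun i => partialDeriv G i β

lemma EuclideanSpace.clm_apply_eq_sum (L : EuclideanSpace ℝ ι →L[ℝ] ℝ) (v : EuclideanSpace ℝ ι) :
    L v = ∑ j, v j * L (EuclideanSpace.single j 1) := by
  have hv : v = ∑ j, v j • EuclideanSpace.single j (1 : ℝ) := by
    ext i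
    simp [Pi.single_apply]
  conv_lhs => rw [hv]
  simp

lemma EuclideanSpace.opNorm_le_sum (L : EuclideanSpace ℝ ι →L[ℝ] ℝ) :
    ‖L‖ ≤ ∑ j, |L (EuclideanSpace.single j 1)| := by
  refine L.opNorm_le_bound (Finset.sum_nonneg fun _ _ => abs_nonneg _) fun v => ?_
  rw [EuclideanSpace.clm_apply_eq_sum L v, Finset.sum_mul, Real.norm_eq_abs]
  refine (Finset.abs_sum_le_sum_abs _ _).trans (Finset.sum_le_sum fun j _ => ?_)
  rw [abs_mul, mul_comm]
  gcongr
  exact EuclideanSpace.abs_apply_le_norm v j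

lemma inner_gradVec (G : EuclideanSpace ℝ ι → ℝ) (β v : EuclideanSpace ℝ ι) :
    inner ℝ (gradVec G β) v = fderiv ℝ G β v := by
  rw [EuclideanSpace.clm_apply_eq_sum, PiLp.inner_apply]
  exact Finset.sum_congr rfl fun i _ => by simp [gradVec, partialDeriv]

variable {G : EuclideanSpace ℝ ι → ℝ} {O : Set (EuclideanSpace ℝ ι)} {h : ℝ}

lemma partialDeriv₂_eq {β : EuclideanSpace ℝ ι} (hd : DifferentiableAt ℝ (fderiv ℝ G) β) (i j : ι) :
    partialDeriv₂ G i j β = fderiv ℝ (fderiv ℝ G) β (EuclideanSpace.single i 1)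
      (EuclideanSpace.single j 1) := by
  have h1 := hd.hasFDerivAt.clm_apply (hasFDerivAt_const (EuclideanSpace.single j (1 : ℝ)) β)
  have h2 : fderiv ℝ (partialDeriv G j) β = _ := h1.fderiv
  rw [partialDeriv₂, partialDeriv, h2]
  simp

variable (hO : IsOpen O) (hG : ContDiffOn ℝ 2 G O)
include hO hG

omit [DecidableEq ι] in
lemma differentiableAt_of_contDiffOn_two {β : EuclideanSpace ℝ ι} (hβ : β ∈ O) :
    DifferentiableAt ℝ G β :=
  (hG.contDiffAt (hO.mem_nhds hβ)).differentiableAt (by norm_num)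

omit [DecidableEq ι] in
lemma differentiableAt_fderiv_of_contDiffOn_two {β : EuclideanSpace ℝ ι} (hβ : β ∈ O) :
    DifferentiableAt ℝ (fderiv ℝ G) β :=
  ((hG.fderiv_of_isOpen hO (m := 1) (by norm_num)).contDiffAt (hO.mem_nhds hβ)).differentiableAt
    (by norm_num)

lemma differentiableAt_partialDeriv {β : EuclideanSpace ℝ ι} (hβ : β ∈ O) (j : ι) :
    DifferentiableAt ℝ (partialDeriv G j) β :=
  (differentiableAt_fderiv_of_contDiffOn_two hO hG hβ).clm_apply (differentiableAt_const _)

lemma partialDeriv₂_comm {β : EuclideanSpace ℝ ι} (hβ : β ∈ O) (i j : ι) :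
    partialDeriv₂ G i j β = partialDeriv₂ G j i β := by
  have hd := differentiableAt_fderiv_of_contDiffOn_two hO hG hβ
  rw [partialDeriv₂_eq hd, partialDeriv₂_eq hd]
  exact (hG.contDiffAt (hO.mem_nhds hβ)).isSymmSndFDerivAt (by simp) _ _

variable (h1 : ∀ β ∈ O, ∀ i j, |partialDeriv G i β * partialDeriv G j β| ≤ h)
  (h2 : ∀ β ∈ O, ∀ i j, |partialDeriv₂ G i j β| ≤ h)

include h1 in
omit hO hG in
lemma abs_partialDeriv_le {β : EuclideanSpace ℝ ι} (hβ : β ∈ O) (i : ι) :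
    |partialDeriv G i β| ≤ √h := by
  have := h1 β hβ i i
  rw [abs_mul_self] at this
  exact Real.abs_le_sqrt (by rwa [sq])

include h1 in
omit hO hG in
lemma sum_abs_partialDeriv_le {β : EuclideanSpace ℝ ι} (hβ : β ∈ O) :
    ∑ i, |partialDeriv G i β| ≤ √((Fintype.card ι : ℝ) ^ 2 * h) := by
  rw [Real.sqrt_mul (by positivity), Real.sqrt_sq (by positivity)]
  simpa using Finset.sum_le_card_nsmul Finset.univ _ _ fun i _ => abs_partialDeriv_le h1 hβ i

include h1 in
omit hO hG in
lemma norm_fderiv_le_sqrt {β : EuclideanSpace ℝ ι} (hβ : β ∈ O) :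
    ‖fderiv ℝ G β‖ ≤ √((Fintype.card ι : ℝ) ^ 2 * h) :=
  (EuclideanSpace.opNorm_le_sum _).trans (sum_abs_partialDeriv_le h1 hβ)

include h1 in
omit hO hG in
lemma norm_gradVec_le_sqrt {β : EuclideanSpace ℝ ι} (hβ : β ∈ O) :
    ‖gradVec G β‖ ≤ √((Fintype.card ι : ℝ) ^ 2 * h) :=
  (EuclideanSpace.norm_le_sum_abs _).trans (sum_abs_partialDeriv_le h1 hβ)

include h2 in
lemma norm_fderiv_sub_le (hOc : Convex ℝ O) {β β' : EuclideanSpace ℝ ι} (hβ : β ∈ O)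
    (hβ' : β' ∈ O) :
    ‖fderiv ℝ G β - fderiv ℝ G β'‖ ≤ (Fintype.card ι : ℝ) ^ 2 * h * ‖β - β'‖ := by
  have hj : ∀ j, |partialDeriv G j β - partialDeriv G j β'|
      ≤ Fintype.card ι * h * ‖β - β'‖ := fun j => by
    refine hOc.norm_image_sub_le_of_norm_fderiv_le (𝕜 := ℝ) (f := partialDeriv G j)
      (fun x hx => differentiableAt_partialDeriv hO hG hx j) (fun x hx => ?_) hβ' hβ
    refine (EuclideanSpace.opNorm_le_sum _).trans ?_
    change ∑ i, |partialDeriv₂ G i j x| ≤ _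
    simpa using Finset.sum_le_card_nsmul Finset.univ _ _ fun i _ => h2 x hx i j
  refine (EuclideanSpace.opNorm_le_sum _).trans ?_
  calc ∑ j, |(fderiv ℝ G β - fderiv ℝ G β') (EuclideanSpace.single j 1)|
      ≤ ∑ _j : ι, Fintype.card ι * h * ‖β - β'‖ := Finset.sum_le_sum fun j _ => hj j
    _ = _ := by rw [Finset.sum_const, Finset.card_univ, nsmul_eq_mul]; ring

/-- Second-order Taylor expansion. -/
lemma isLittleO_taylor_two {β : EuclideanSpace ℝ ι} (hβ : β ∈ O) :
    (fun s => G (β + s) - G β - inner ℝ (gradVec G β) s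
      - 1 / 2 * quadForm (Matrix.of fun i j => partialDeriv₂ G i j β) s) =o[𝓝 0]
      fun s => ‖s‖ ^ 2 := by
  set A := Matrix.of fun i j => partialDeriv₂ G i j β with hA
  set L := fderiv ℝ (fderiv ℝ G) β with hL
  have hd := differentiableAt_fderiv_of_contDiffOn_two hO hG hβ
  have hsymm : ∀ v w, L v w = L w v := fun v w =>
    (hG.contDiffAt (hO.mem_nhds hβ)).isSymmSndFDerivAt (by simp) v w
  have hquad : ∀ s, quadForm A s = L s s := fun s => by
    rw [EuclideanSpace.clm_apply_eq_sum (L s) s]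
    have : ∀ j, L s (EuclideanSpace.single j 1) = ∑ i, s i * A i j := fun j => by
      rw [hsymm, EuclideanSpace.clm_apply_eq_sum]
      refine Finset.sum_congr rfl fun i _ => ?_
      rw [hA, Matrix.of_apply, partialDeriv₂_eq hd, hsymm]
    simp_rw [this, Finset.mul_sum]
    rw [quadForm, Finset.sum_comm]
    exact Finset.sum_congr rfl fun i _ => Finset.sum_congr rfl fun j _ => by ring
  -- The remainder has derivative `fderiv G (β + s) - fderiv G β - L s`, which is `o(‖s‖)`; the mean
  -- value inequality on the ball of radius `‖s‖` then gives `o(‖s‖ ^ 2)`.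
  have hψ : ∀ s, β + s ∈ O → HasFDerivAt (fun s => G (β + s) - G β - inner ℝ (gradVec G β) s
      - 1 / 2 * quadForm A s) (fderiv ℝ G (β + s) - fderiv ℝ G β - L s) s := fun s hs => by
    have e1 : HasFDerivAt (fun s => G (β + s)) (fderiv ℝ G (β + s)) s :=
      (differentiableAt_of_contDiffOn_two hO hG hs).hasFDerivAt.comp s
        ((hasFDerivAt_id s).const_add β)
    have e3 : HasFDerivAt (fun s => L s s) (L s + L.flip s) s := by
      have := L.hasFDerivAt (x := s) |>.clm_apply (hasFDerivAt_id s)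
      refine this.congr_fderiv ?_
      ext v
      simp
    simp_rw [inner_gradVec, hquad]
    refine (((e1.sub_const (G β)).sub (fderiv ℝ G β).hasFDerivAt).sub
      (e3.const_mul (1 / 2))).congr_fderiv ?_
    ext v
    simp [hsymm v s]
    ring
  rw [Asymptotics.isLittleO_iff]
  intro ε hε
  have hlin := hd.hasFDerivAt.isLittleO
  have hev : ∀ᶠ s in 𝓝 (0 : EuclideanSpace ℝ ι),
      ‖fderiv ℝ G (β + s) - fderiv ℝ G β - L s‖ ≤ ε * ‖s‖ ∧ β + s ∈ O := by
    have t : Tendsto (fun s => β + s) (𝓝 (0 : EuclideanSpace ℝ ι)) (𝓝 β) := by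
      simpa using (continuous_const_add β).tendsto 0
    filter_upwards [t.eventually (hlin.bound hε), t.eventually (hO.mem_nhds hβ)] with s hs hs'
    exact ⟨by simpa using hs, hs'⟩
  obtain ⟨r, hr, hball⟩ := Metric.eventually_nhds_iff_ball.1 hev
  filter_upwards [Metric.ball_mem_nhds _ hr] with s hs
  have hsr : ‖s‖ < r := by simpa using hs
  have key := (convex_closedBall (0 : EuclideanSpace ℝ ι) ‖s‖).norm_image_sub_le_of_norm_hasFDerivWithin_le
    (𝕜 := ℝ) (C := ε * ‖s‖) (fun x hx => (hψ x (hball x (by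
      rw [mem_closedBall_zero_iff] at hx; simpa using hx.trans_lt hsr)).2).hasFDerivWithinAt)
    (fun x hx => by
      rw [mem_closedBall_zero_iff] at hx
      exact (hball x (by simpa using hx.trans_lt hsr)).1.trans (by gcongr))
    (x := 0) (y := s) (by simp) (by simp)
  simp only [add_zero, sub_self, inner_zero_right, sub_zero] at key
  have hq0 : quadForm A (0 : EuclideanSpace ℝ ι) = 0 := by simp [quadForm]
  rw [hq0, mul_zero, sub_zero, sub_zero] at key
  rw [Real.norm_of_nonneg (sq_nonneg ‖s‖), sq, ← mul_assoc]
  exact key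

omit [DecidableEq ι] hO hG in
-- Derivative bounds are available in the interior only. When `βbar` is interior, so is every point
-- of the segment from `β` to `βbar` except possibly `β`, and estimates proved there extend by
-- continuity to boundary points.
lemma tendsto_along_segment {B : Set (EuclideanSpace ℝ ι)} (hB : Convex ℝ B)
    {βbar : EuclideanSpace ℝ ι} (hβ : βbar ∈ B) {G : EuclideanSpace ℝ ι → ℝ}
    (hGB : ContinuousOn G B) {β : EuclideanSpace ℝ ι} (hβB : β ∈ B) :
    Tendsto (fun t : ℝ => G (β + t • (βbar - β))) (𝓝[>] 0) (𝓝 (G β)) := by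
  have hp : Tendsto (fun t : ℝ => β + t • (βbar - β)) (𝓝[>] 0) (𝓝[B] β) := by
    refine tendsto_nhdsWithin_iff.2 ⟨?_, ?_⟩
    · have : Continuous fun t : ℝ => β + t • (βbar - β) := by fun_prop
      simpa using (this.tendsto 0).mono_left nhdsWithin_le_nhds
    · filter_upwards [Ioc_mem_nhdsGT (show (0 : ℝ) < 1 by norm_num)] with t ht
      exact hB.add_smul_sub_mem hβB hβ ⟨ht.1.le, ht.2⟩
  exact (hGB β hβB).tendsto.comp hp

end Calculus

section Segments

variable {ι : Type*} [Fintype ι] [DecidableEq ι] {B : Set (EuclideanSpace ℝ ι)}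
  {βbar : EuclideanSpace ℝ ι} {G : EuclideanSpace ℝ ι → ℝ} {h : ℝ}

lemma abs_sub_le_of_bounds (hB : Convex ℝ B) (hβ : βbar ∈ interior B) (hGc : ContinuousOn G B)
    (hG : ContDiffOn ℝ 2 G (interior B))
    (h1 : ∀ β ∈ interior B, ∀ i j, |partialDeriv G i β * partialDeriv G j β| ≤ h)
    {s t : EuclideanSpace ℝ ι} (hs : βbar + s ∈ B) (ht : βbar + t ∈ B) :
    |G (βbar + s) - G (βbar + t)| ≤ √((Fintype.card ι : ℝ) ^ 2 * h) * ‖s - t‖ := by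
  have hβB := interior_subset hβ
  have T1 := tendsto_along_segment hB hβB hGc hs
  have T2 := tendsto_along_segment hB hβB hGc ht
  refine le_of_tendsto (T1.sub T2).abs ?_
  filter_upwards [Ioc_mem_nhdsGT (show (0 : ℝ) < 1 by norm_num)] with τ hτ
  have key := hB.interior.norm_image_sub_le_of_norm_fderiv_le (𝕜 := ℝ)
    (fun x hx => differentiableAt_of_contDiffOn_two isOpen_interior hG hx)
    (fun x hx => norm_fderiv_le_sqrt h1 hx)
    (hB.add_smul_sub_mem_interior ht hβ hτ) (hB.add_smul_sub_mem_interior hs hβ hτ)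
  refine key.trans ?_
  gcongr
  -- Both points move towards `βbar` by the same proportion, so their difference is merely scaled by
  -- `1 - τ`.
  rw [show βbar + s + τ • (βbar - (βbar + s)) - (βbar + t + τ • (βbar - (βbar + t)))
    = (1 - τ) • (s - t) by module, norm_smul, Real.norm_of_nonneg (by linarith [hτ.2])]
  nlinarith [norm_nonneg (s - t), hτ.1]

lemma abs_sub_sub_inner_le_of_bounds (hB : Convex ℝ B) (hβ : βbar ∈ interior B)
    (hGc : ContinuousOn G B) (hG : ContDiffOn ℝ 2 G (interior B)) (h0 : 0 ≤ h)
    (h2 : ∀ β ∈ interior B, ∀ i j, |partialDeriv₂ G i j β| ≤ h)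
    {s t : EuclideanSpace ℝ ι} (hs : βbar + s ∈ B) (ht : βbar + t ∈ B) {r : ℝ} (hsr : ‖s‖ ≤ r)
    (htr : ‖t‖ ≤ r) :
    |G (βbar + s) - G (βbar + t) - inner ℝ (gradVec G βbar) (s - t)|
      ≤ (Fintype.card ι : ℝ) ^ 2 * h * r * ‖s - t‖ := by
  have hβB := interior_subset hβ
  have T1 := tendsto_along_segment hB hβB hGc hs
  have T2 := tendsto_along_segment hB hβB hGc ht
  have T3 : Tendsto (fun τ : ℝ => (1 - τ) * inner ℝ (gradVec G βbar) (s - t)) (𝓝[>] 0)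
      (𝓝 (inner ℝ (gradVec G βbar) (s - t))) := by
    have : Continuous fun τ : ℝ => (1 - τ) * inner ℝ (gradVec G βbar) (s - t) := by fun_prop
    simpa using (this.tendsto 0).mono_left nhdsWithin_le_nhds
  refine le_of_tendsto ((T1.sub T2).sub T3).abs ?_
  filter_upwards [Ioc_mem_nhdsGT (show (0 : ℝ) < 1 by norm_num)] with τ hτ
  have hr0 : 0 ≤ r := (norm_nonneg _).trans hsr
  have mem : ∀ {x : EuclideanSpace ℝ ι}, ‖x‖ ≤ r →
      βbar + x + τ • (βbar - (βbar + x)) ∈ Metric.closedBall βbar r := fun {x} hx => by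
    rw [mem_closedBall_iff_norm, show βbar + x + τ • (βbar - (βbar + x)) - βbar = (1 - τ) • x by
      module, norm_smul, Real.norm_of_nonneg (by linarith [hτ.2])]
    nlinarith [norm_nonneg x, hτ.1]
  -- Inside the ball of radius `r` about `βbar` the derivative differs from the one at `βbar` by
  -- `O(h r)`, which is the Lipschitz constant of the function minus its linear part.
  have key := (hB.interior.inter (convex_closedBall βbar r)).norm_image_sub_le_of_norm_fderiv_le'
    (𝕜 := ℝ) (φ := fderiv ℝ G βbar) (C := (Fintype.card ι : ℝ) ^ 2 * h * r)
    (fun x hx => differentiableAt_of_contDiffOn_two isOpen_interior hG hx.1)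
    (fun x hx => (norm_fderiv_sub_le isOpen_interior hG h2 hB.interior hx.1 hβ).trans (by
      have := mem_closedBall_iff_norm.1 hx.2
      gcongr))
    ⟨hB.add_smul_sub_mem_interior ht hβ hτ, mem htr⟩
    ⟨hB.add_smul_sub_mem_interior hs hβ hτ, mem hsr⟩
  rw [show βbar + s + τ • (βbar - (βbar + s)) - (βbar + t + τ • (βbar - (βbar + t)))
    = (1 - τ) • (s - t) by module, map_smul, ← inner_gradVec, smul_eq_mul, Real.norm_eq_abs,
    norm_smul, Real.norm_of_nonneg (show (0 : ℝ) ≤ 1 - τ by linarith [hτ.2])] at key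
  refine key.trans ?_
  gcongr
  nlinarith [norm_nonneg (s - t), hτ.1]

end Segments

/-! ### From the domination conditions to smooth families. -/

namespace IsDominatedFamily

variable {𝒰 V ι : Type*} [MeasurableSpace 𝒰] [MeasurableSpace V] [Fintype ι] [DecidableEq ι]
  {ν : Measure 𝒰} {B : Set (EuclideanSpace ℝ ι)} {βbar : EuclideanSpace ℝ ι}

/-- Pulls the families of `B`, `X` and `Y` back to the space of `C`, so that one sample and one law
serve all three. -/
lemma comp {φ : 𝒰 → V} (hφ : Measurable φ) {p : V → EuclideanSpace ℝ ι → ℝ}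
    (hp : IsDominatedFamily (ν.map φ) B p) : IsDominatedFamily ν B fun u => p (φ u) where
  pos u := hp.pos (φ u)
  measurable β hβ := (hp.measurable β hβ).comp hφ
  continuousOn u := hp.continuousOn (φ u)
  log_dominated := by
    obtain ⟨m, hm, hb⟩ := hp.log_dominated
    exact ⟨m ∘ φ, hm.comp_measurable hφ, fun u => hb (φ u)⟩
  contDiffOn u := hp.contDiffOn (φ u)
  measurable_deriv β hβ i := (hp.measurable_deriv β hβ i).comp hφ
  deriv_dominated := by
    obtain ⟨m, hm, hb⟩ := hp.deriv_dominated
    exact ⟨m ∘ φ, hm.comp_measurable hφ, fun u => hb (φ u)⟩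

variable {p : 𝒰 → EuclideanSpace ℝ ι → ℝ} (hp : IsDominatedFamily ν B p)
include hp

lemma continuousOn_log (u : 𝒰) : ContinuousOn (fun β => Real.log (p u β)) B :=
  (hp.continuousOn u).log fun β hβ => (hp.pos u β hβ).ne'

lemma measurable_log {β : EuclideanSpace ℝ ι} (hβ : β ∈ B) :
    Measurable fun u => Real.log (p u β) :=
  (hp.measurable β hβ).log

lemma integrable_log {β : EuclideanSpace ℝ ι} (hβ : β ∈ B) :
    Integrable (fun u => Real.log (p u β)) ν := by
  obtain ⟨m, hm, hb⟩ := hp.log_dominated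
  exact hm.mono' (hp.measurable_log hβ).aestronglyMeasurable (ae_of_all _ fun u => hb u β hβ)

lemma continuousOn_integral_log : ContinuousOn (fun β => ∫ u, Real.log (p u β) ∂ν) B := by
  obtain ⟨m, hm, hb⟩ := hp.log_dominated
  intro β hβ
  refine tendsto_integral_filter_of_dominated_convergence m ?_ ?_ hm
    (ae_of_all _ fun u => hp.continuousOn_log u β hβ)
  · filter_upwards [self_mem_nhdsWithin] with β' hβ'
    exact (hp.measurable_log hβ').aestronglyMeasurable
  · filter_upwards [self_mem_nhdsWithin] with β' hβ'
    exact ae_of_all _ fun u => hb u β' hβ'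

lemma measurable_log_eval {Ω : Type*} [MeasurableSpace Ω] {X : Ω → 𝒰} (hX : Measurable X)
    {s : Ω → EuclideanSpace ℝ ι} (hs : Measurable s) (hsB : ∀ ω, s ω ∈ B) :
    Measurable fun ω => Real.log (p (X ω) (s ω)) := by
  have h := measurable_uncurry_of_continuous_of_measurable
    (u := fun (t : B) u => Real.log (p u t))
    (fun u => continuousOn_iff_continuous_domRestrict.1 (hp.continuousOn_log u))
    fun t => hp.measurable_log t.2
  exact h.comp ((hs.subtype_mk (h := hsB)).prodMk hX)

/-- Measurability is assumed for first derivatives only. Second derivatives are limits of their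
difference quotients, started at an index `N` from which the shifted points are interior. -/
lemma measurable_partialDeriv₂ {β : EuclideanSpace ℝ ι} (hβ : β ∈ interior B) (i j : ι) :
    Measurable fun u => partialDeriv₂ (fun β' => Real.log (p u β')) i j β := by
  have t0 : Tendsto (fun n : ℕ => β + ((n : ℝ) + 1)⁻¹ • EuclideanSpace.single i (1 : ℝ)) atTop
      (𝓝 β) := by
    have h1 : Tendsto (fun n : ℕ => ((n : ℝ) + 1)⁻¹) atTop (𝓝 0) := by
      simpa using tendsto_one_div_add_atTop_nhds_zero_nat (𝕜 := ℝ)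
    simpa using (h1.smul_const (EuclideanSpace.single i (1 : ℝ))).const_add β
  obtain ⟨N, hN⟩ := eventually_atTop.1 (t0.eventually (isOpen_interior.mem_nhds hβ))
  refine measurable_of_tendsto_metrizable (f := fun (n : ℕ) u => (((n + N : ℕ) : ℝ) + 1)
    • (partialDeriv (fun β' => Real.log (p u β')) j
        (β + (((n + N : ℕ) : ℝ) + 1)⁻¹ • EuclideanSpace.single i (1 : ℝ))
      - partialDeriv (fun β' => Real.log (p u β')) j β)) (fun n => ?_) ?_
  · exact ((hp.measurable_deriv _ (hN (n + N) (Nat.le_add_left _ _)) j).sub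
      (hp.measurable_deriv β hβ j)).const_smul (((n + N : ℕ) : ℝ) + 1)
  · rw [tendsto_pi_nhds]
    intro u
    have hd := (differentiableAt_partialDeriv isOpen_interior (hp.contDiffOn u) hβ j).hasFDerivAt
    refine hd.lim (EuclideanSpace.single i (1 : ℝ)) ?_
    have h1 : Tendsto (fun n : ℕ => (((n + N : ℕ) : ℝ) + 1)) atTop atTop :=
      tendsto_atTop_add_const_right _ _ (tendsto_natCast_atTop_atTop.comp
        (tendsto_add_atTop_nat N))
    exact tendsto_norm_atTop_atTop.comp h1

lemma integrable_partialDeriv₂ {β : EuclideanSpace ℝ ι} (hβ : β ∈ interior B) (i j : ι) :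
    Integrable (fun u => partialDeriv₂ (fun β' => Real.log (p u β')) i j β) ν := by
  obtain ⟨m, hm, hb⟩ := hp.deriv_dominated
  exact hm.mono' (hp.measurable_partialDeriv₂ hβ i j).aestronglyMeasurable
    (ae_of_all _ fun u => (hb u β hβ i j).1)

lemma integrable_partialDeriv [IsFiniteMeasure ν] {β : EuclideanSpace ℝ ι} (hβ : β ∈ interior B)
    (i : ι) : Integrable (fun u => partialDeriv (fun β' => Real.log (p u β')) i β) ν := by
  obtain ⟨m, hm, hb⟩ := hp.deriv_dominated
  refine ((integrable_const (1 : ℝ)).fun_add hm).mono'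
    (hp.measurable_deriv β hβ i).aestronglyMeasurable (ae_of_all _ fun u => ?_)
  have := (hb u β hβ i i).2
  rw [abs_mul, ← sq] at this
  rw [Real.norm_eq_abs]
  nlinarith [sq_nonneg (|partialDeriv (fun β' => Real.log (p u β')) i β| - 1)]

/-- The log-likelihood increments of a dominated family form a smooth family, after a modification
on a null set. -/
lemma exists_smoothFamily (hB : Convex ℝ B) (hβ : βbar ∈ interior B) :
    ∃ (f : 𝒰 → EuclideanSpace ℝ ι → ℝ) (D : 𝒰 → EuclideanSpace ℝ ι) (H : 𝒰 → ℝ),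
      SmoothFamily ν {s | βbar + s ∈ B} f D H ∧ ∀ᵐ u ∂ν,
        (∀ s, f u s = Real.log (p u (βbar + s)) - Real.log (p u βbar)) ∧
        D u = gradVec (fun β' => Real.log (p u β')) βbar := by
  classical
  obtain ⟨h, hi, hb⟩ := hp.deriv_dominated
  have hβB := interior_subset hβ
  -- The dominating function `h` is only almost everywhere measurable. A measurable version `h'`
  -- agrees with it off a measurable null set `N`; setting increments and scores to `0` on `N` makes
  -- all inequalities hold at every point.
  set h' := hi.1.mk h with hh'
  have hae : h =ᵐ[ν] h' := hi.1.ae_eq_mk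
  set N := toMeasurable ν {u | h u ≠ h' u} with hN
  have hN0 : ν N = 0 := by rw [hN, measure_toMeasurable]; exact hae
  have hNm : MeasurableSet N := measurableSet_toMeasurable _ _
  have hout : ∀ u, u ∉ N → h u = h' u := fun u hu => by
    by_contra hcon; exact hu (subset_toMeasurable _ _ hcon)
  set d2 : ℝ := (Fintype.card ι : ℝ) ^ 2 with hd2
  have hgm : Measurable fun u => gradVec (fun β' => Real.log (p u β')) βbar :=
    (PiLp.continuous_toLp 2 (fun _ : ι => ℝ)).measurable.comp
      (measurable_pi_iff.2 fun k => hp.measurable_deriv βbar hβ k)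
  refine ⟨fun u s => if u ∈ N then 0 else Real.log (p u (βbar + s)) - Real.log (p u βbar),
    fun u => if u ∈ N then 0 else gradVec (fun β' => Real.log (p u β')) βbar,
    fun u => d2 * |h' u|, ?_, ?_⟩
  · have hm' : Measurable h' := hi.1.stronglyMeasurable_mk.measurable
    refine ⟨(hm'.abs).const_mul _, ((hi.congr hae).abs).const_mul _, fun u => by positivity,
      Measurable.ite hNm measurable_const hgm, fun u => ?_, fun s hs => ?_, fun u => ?_,
      fun u s hs t ht => ?_, fun u s hs t ht r hsr htr => ?_⟩
    · by_cases hu : u ∈ N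
      · simp only [hu, if_true, norm_zero]; positivity
      · simp only [hu, if_false]
        refine norm_gradVec_le_sqrt (fun β hβ i j => ?_) hβ
        exact (hb u β hβ i j).2.trans (by rw [hout u hu]; exact le_abs_self _)
    · exact Measurable.ite hNm measurable_const ((hp.measurable_log hs).sub (hp.measurable_log hβB))
    · simp
    · by_cases hu : u ∈ N
      · simp only [hu, if_true, sub_self, abs_zero]; positivity
      · simp only [hu, if_false]
        rw [sub_sub_sub_cancel_right]
        exact abs_sub_le_of_bounds (G := fun β => Real.log (p u β)) hB hβ (hp.continuousOn_log u)
          (hp.contDiffOn u) (fun β hβ i j => (hb u β hβ i j).2.trans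
            (by rw [hout u hu]; exact le_abs_self _)) hs ht
    · by_cases hu : u ∈ N
      · have : 0 ≤ r := (norm_nonneg _).trans hsr
        simp only [hu, if_true, sub_self, inner_zero_left, abs_zero]; positivity
      · simp only [hu, if_false]
        rw [sub_sub_sub_cancel_right]
        exact abs_sub_sub_inner_le_of_bounds (G := fun β => Real.log (p u β)) hB hβ
          (hp.continuousOn_log u) (hp.contDiffOn u) (abs_nonneg _)
          (fun β hβ i j => (hb u β hβ i j).1.trans
            (by rw [hout u hu]; exact le_abs_self _)) hs ht hsr htr
  · filter_upwards [measure_eq_zero_iff_ae_notMem.1 hN0] with u hu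
    simp [hu]

/-- Second-order expansion of the mean log-likelihood. -/
lemma isLittleO_integral_log [IsFiniteMeasure ν] (hB : Convex ℝ B) (hβ : βbar ∈ interior B) :
    (fun s => ((∫ u, Real.log (p u (βbar + s)) ∂ν) - ∫ u, Real.log (p u βbar) ∂ν)
      - ∑ k, s k * ∫ u, partialDeriv (fun β' => Real.log (p u β')) k βbar ∂ν
      - 1 / 2 * quadForm (Matrix.of fun i j =>
          ∫ u, partialDeriv₂ (fun β' => Real.log (p u β')) i j βbar ∂ν) s) =o[𝓝 0]
      fun s => ‖s‖ ^ 2 := by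
  have hβB := interior_subset hβ
  obtain ⟨h, hi, hb⟩ := hp.deriv_dominated
  set A : 𝒰 → Matrix ι ι ℝ := fun u => Matrix.of fun i j =>
    partialDeriv₂ (fun β' => Real.log (p u β')) i j βbar with hA
  set ψ : EuclideanSpace ℝ ι → 𝒰 → ℝ := fun s u => Real.log (p u (βbar + s)) - Real.log (p u βbar)
    - inner ℝ (gradVec (fun β' => Real.log (p u β')) βbar) s - 1 / 2 * quadForm (A u) s with hψ
  have hT : ∀ᶠ s in 𝓝 (0 : EuclideanSpace ℝ ι), βbar + s ∈ B := by
    have t : Tendsto (fun s => βbar + s) (𝓝 (0 : EuclideanSpace ℝ ι)) (𝓝 βbar) := by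
      simpa using (continuous_const_add βbar).tendsto 0
    exact (t.eventually (isOpen_interior.mem_nhds hβ)).mono fun _ hs => interior_subset hs
  have iin : ∀ s : EuclideanSpace ℝ ι, (fun u => inner ℝ
      (gradVec (fun β' => Real.log (p u β')) βbar) s)
      = fun u => ∑ k, s k * partialDeriv (fun β' => Real.log (p u β')) k βbar := fun s => by
    ext u
    rw [PiLp.inner_apply]
    exact Finset.sum_congr rfl fun k _ => by simp [gradVec]
  have i1 : ∀ s : EuclideanSpace ℝ ι, Integrable (fun u => ∑ k, s k
      * partialDeriv (fun β' => Real.log (p u β')) k βbar) ν := fun s =>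
    integrable_finsetSum _ fun k _ => (hp.integrable_partialDeriv hβ k).const_mul _
  have i2 : ∀ (s : EuclideanSpace ℝ ι) (i j : ι), Integrable (fun u => A u i j * (s i * s j)) ν :=
    fun s i j => (hp.integrable_partialDeriv₂ hβ i j).mul_const _
  have i2' : ∀ (s : EuclideanSpace ℝ ι) (i : ι),
      Integrable (fun u => ∑ j, A u i j * (s i * s j)) ν :=
    fun s i => integrable_finsetSum _ fun j _ => i2 s i j
  have i3 : ∀ s : EuclideanSpace ℝ ι, Integrable (fun u => quadForm (A u) s) ν := fun s =>
    integrable_finsetSum _ fun i _ => i2' s i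
  have hint : ∀ s, βbar + s ∈ B → Integrable (ψ s) ν ∧
      ∫ u, ψ s u ∂ν = ((∫ u, Real.log (p u (βbar + s)) ∂ν) - ∫ u, Real.log (p u βbar) ∂ν)
      - ∑ k, s k * ∫ u, partialDeriv (fun β' => Real.log (p u β')) k βbar ∂ν
      - 1 / 2 * quadForm (Matrix.of fun i j =>
          ∫ u, partialDeriv₂ (fun β' => Real.log (p u β')) i j βbar ∂ν) s := fun s hs => by
    have l1 := hp.integrable_log hs
    have l2 := hp.integrable_log hβB
    have i1' : Integrable (fun u => inner ℝ (gradVec (fun β' => Real.log (p u β')) βbar) s) ν := by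
      rw [iin]; exact i1 s
    refine ⟨((l1.sub' l2).sub' i1').sub' ((i3 s).const_mul _), ?_⟩
    simp only [hψ]
    rw [integral_sub ((l1.sub' l2).sub' i1') ((i3 s).const_mul _), integral_sub (l1.sub' l2) i1',
      integral_sub l1 l2, integral_const_mul, iin,
      integral_finsetSum _ fun k _ => (hp.integrable_partialDeriv hβ k).const_mul _]
    simp_rw [integral_const_mul]
    congr 2
    unfold quadForm
    rw [integral_finsetSum _ fun i _ => i2' s i]
    refine Finset.sum_congr rfl fun i _ => ?_
    rw [integral_finsetSum _ fun j _ => i2 s i j]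
    refine Finset.sum_congr rfl fun j _ => ?_
    rw [integral_mul_const]; rfl
  -- After division by `‖s‖ ^ 2` the Taylor remainders tend to `0` pointwise and are dominated by a
  -- multiple of `h` uniformly in `s`, so the expansion may be integrated.
  have hlim : Tendsto (fun s => ∫ u, ψ s u / ‖s‖ ^ 2 ∂ν) (𝓝 0) (𝓝 0) := by
    have e : (0 : ℝ) = ∫ _, (0 : ℝ) ∂ν := by simp
    rw [e]
    refine tendsto_integral_filter_of_dominated_convergence
      (fun u => 2 * (Fintype.card ι : ℝ) ^ 2 * h u) ?_ ?_ (hi.const_mul _)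
      (ae_of_all _ fun u => ?_)
    · filter_upwards [hT] with s hs
      exact ((hint s hs).1.div_const _).aestronglyMeasurable
    · filter_upwards [hT] with s hs
      refine ae_of_all _ fun u => ?_
      -- An index is needed to see that `h u` is nonnegative; without coordinates the parameter
      -- space is a point.
      rcases isEmpty_or_nonempty ι with hι | ⟨⟨k⟩⟩
      · have : s = 0 := Subsingleton.elim _ _
        simp [this]
      have h0 : 0 ≤ h u := (abs_nonneg _).trans (hb u βbar hβ k k).1
      have b1 := abs_sub_sub_inner_le_of_bounds (G := fun β => Real.log (p u β)) (h := h u) hB hβ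
        (hp.continuousOn_log u) (hp.contDiffOn u) h0 (fun β hβ i j => (hb u β hβ i j).1) hs
        (t := 0) (by simpa using hβB) (r := ‖s‖) le_rfl (by simp)
      simp only [add_zero, sub_zero] at b1
      have b2 := abs_quadForm_le (A u) s
      have b3 : ∑ i, ∑ j, |A u i j| ≤ (Fintype.card ι : ℝ) ^ 2 * h u := by
        calc ∑ i, ∑ j, |A u i j| ≤ ∑ _i : ι, ∑ _j : ι, h u :=
              Finset.sum_le_sum fun i _ => Finset.sum_le_sum fun j _ => (hb u βbar hβ i j).1
          _ = _ := by simp; ring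
      rw [Real.norm_eq_abs, abs_div, abs_of_nonneg (sq_nonneg ‖s‖)]
      refine div_le_of_le_mul₀ (sq_nonneg _) (by positivity) ?_
      refine (abs_sub _ _).trans ?_
      rw [abs_mul, abs_of_pos (by norm_num : (0 : ℝ) < 1 / 2)]
      have b4 : |quadForm (A u) s| ≤ (Fintype.card ι : ℝ) ^ 2 * h u * ‖s‖ ^ 2 :=
        b2.trans (by gcongr)
      have b5 : 0 ≤ (Fintype.card ι : ℝ) ^ 2 * h u * ‖s‖ ^ 2 := by positivity
      nlinarith
    · have := isLittleO_taylor_two isOpen_interior (hp.contDiffOn u) hβ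
      exact this.tendsto_div_nhds_zero
  refine (Asymptotics.isLittleO_iff_tendsto' ?_).2 (hlim.congr' ?_)
  · refine Eventually.of_forall fun s hs => ?_
    have : s = 0 := by simpa using hs
    subst this
    simp [quadForm]
  · filter_upwards [hT] with s hs
    rw [integral_div, (hint s hs).2]

end IsDominatedFamily

/-! ### Second-order conditions at a maximum. -/

section QuadraticMaximum

variable {ι : Type*} [Fintype ι] {F : EuclideanSpace ℝ ι → ℝ} {a : ι → ℝ} {N : Matrix ι ι ℝ}

/-- At a local maximum the linear term of a second-order expansion vanishes. -/
lemma linear_coeff_eq_zero_of_isLocalMax [DecidableEq ι]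
    (hF : (fun s => F s - ∑ k, s k * a k - 1 / 2 * quadForm N s) =o[𝓝 0] fun s => ‖s‖ ^ 2)
    (hmax : ∀ᶠ s in 𝓝 0, F s ≤ 0) (k : ι) : a k = 0 := by
  have h0 : F 0 = 0 := by
    have h := (hF.bound one_pos).self_of_nhds
    simpa [quadForm] using h
  set L : EuclideanSpace ℝ ι →L[ℝ] ℝ := ∑ k, a k • EuclideanSpace.proj k with hL
  have hLs : ∀ s, L s = ∑ k, s k * a k := fun s => by
    simp [hL, mul_comm]
  have hsq : (fun s : EuclideanSpace ℝ ι => ‖s‖ ^ 2) =o[𝓝 0] fun s => s := by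
    simpa using Asymptotics.isLittleO_norm_pow_id (E' := EuclideanSpace ℝ ι) one_lt_two
  have hq : (fun s => 1 / 2 * quadForm N s) =O[𝓝 0] fun s => ‖s‖ ^ 2 := by
    refine Asymptotics.IsBigO.of_bound (1 / 2 * ∑ i, ∑ j, |N i j|) (Eventually.of_forall fun s => ?_)
    rw [norm_mul, Real.norm_eq_abs, Real.norm_eq_abs, norm_pow, norm_norm,
      abs_of_pos (by norm_num : (0 : ℝ) < 1 / 2), mul_assoc]
    gcongr
    exact abs_quadForm_le N s
  have hd : HasFDerivAt F L 0 := by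
    rw [hasFDerivAt_iff_isLittleO_nhds_zero]
    refine ((hF.trans hsq).add (hq.trans_isLittleO hsq)).congr_left fun s => ?_
    rw [zero_add, h0, hLs]; ring
  have hz : L = 0 := by
    refine IsLocalMax.hasFDerivAt_eq_zero ?_ hd
    filter_upwards [hmax] with s hs
    rwa [h0]
  have := hLs (EuclideanSpace.single k 1)
  rw [hz] at this
  simpa [Pi.single_apply] using this.symm

/-- On the ray through `s` the form scales with `t ^ 2`, and so does the bound on the error, with an
arbitrarily small factor. -/
lemma quadForm_nonpos_of_isLocalMax
    (hF : (fun s => F s - 1 / 2 * quadForm N s) =o[𝓝 0] fun s => ‖s‖ ^ 2)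
    (hmax : ∀ᶠ s in 𝓝 0, F s ≤ 0) (s : EuclideanSpace ℝ ι) : quadForm N s ≤ 0 := by
  refine le_of_forall_pos_le_add fun ε hε => ?_
  set δ := ε / (2 * (‖s‖ ^ 2 + 1)) with hδ
  have hδ0 : 0 < δ := by positivity
  obtain ⟨r, hr, hball⟩ := Metric.eventually_nhds_iff.1 ((hF.bound hδ0).and hmax)
  set t := r / (2 * (‖s‖ + 1)) with ht
  have ht0 : 0 < t := by positivity
  have hts : ‖t • s‖ < r := by
    rw [norm_smul, Real.norm_of_nonneg ht0.le, ht, div_mul_eq_mul_div, div_lt_iff₀ (by positivity)]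
    nlinarith [norm_nonneg s]
  obtain ⟨h1, h2⟩ := hball (show dist (t • s) 0 < r by simpa using hts)
  rw [quadForm_smul, norm_smul, Real.norm_of_nonneg ht0.le, Real.norm_eq_abs, norm_pow,
    Real.norm_of_nonneg (by positivity)] at h1
  have h3 := (abs_le.1 h1).1
  have h4 : t ^ 2 * quadForm N s ≤ t ^ 2 * ε := by
    have : δ * (‖s‖ ^ 2 + 1) = ε / 2 := by rw [hδ]; field_simp
    have h5 : δ * (t * ‖s‖) ^ 2 ≤ t ^ 2 * (ε / 2) := by
      rw [← this]; nlinarith [mul_pos hδ0 (pow_pos ht0 2)]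
    linarith
  rw [zero_add]
  exact le_of_mul_le_mul_left h4 (by positivity)

/-- A nonsingular symmetric matrix with nonnegative quadratic form has a coercive quadratic form. -/
lemma exists_le_quadForm [DecidableEq ι] {M : Matrix ι ι ℝ} (hM : M.IsSymm) (hdet : M.det ≠ 0)
    (hpos : ∀ s, 0 ≤ quadForm M s) : ∃ c > 0, ∀ s, c * ‖s‖ ^ 2 ≤ quadForm M s := by
  -- Nonnegative and nonsingular means positive definite; the minimum over the unit sphere then
  -- serves as `c`.
  have hps : M.PosSemidef := .of_dotProduct_mulVec_nonneg
    (by rw [Matrix.IsHermitian, Matrix.conjTranspose_eq_transpose_of_trivial]; exact hM) fun x => by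
      simpa [quadForm_eq_dotProduct] using hpos (WithLp.toLp 2 x)
  have hpd := hps.posDef_iff_det_ne_zero.2 hdet
  have hlt : ∀ s : EuclideanSpace ℝ ι, s ≠ 0 → 0 < quadForm M s := fun s hs => by
    have := hpd.dotProduct_mulVec_pos (x := s.ofLp) (by simpa using hs)
    simpa [quadForm_eq_dotProduct] using this
  rcases isEmpty_or_nonempty ι with hι | hι
  · refine ⟨1, one_pos, fun s => ?_⟩
    have : s = 0 := Subsingleton.elim _ _
    simp [this, quadForm]
  have : Nontrivial (EuclideanSpace ℝ ι) := inferInstance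
  obtain ⟨s₀, hs₀, hmin⟩ := (isCompact_sphere (0 : EuclideanSpace ℝ ι) 1).exists_isMinOn
    (NormedSpace.sphere_nonempty.2 zero_le_one) (continuous_quadForm M).continuousOn
  refine ⟨quadForm M s₀, hlt s₀ (fun h => by simp [h] at hs₀), fun s => ?_⟩
  rcases eq_or_ne s 0 with rfl | hs
  · simp [quadForm]
  have hn : 0 < ‖s‖ := norm_pos_iff.2 hs
  have h1 : quadForm M s₀ ≤ quadForm M (‖s‖⁻¹ • s) := hmin (by
    simp [norm_smul, hn.ne'])
  rw [quadForm_smul] at h1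
  calc quadForm M s₀ * ‖s‖ ^ 2 ≤ ((‖s‖⁻¹) ^ 2 * quadForm M s) * ‖s‖ ^ 2 := by gcongr
    _ = _ := by field_simp

/-- A continuous function on a compact set with a unique maximum at `0`, where its value is `0` and
its Hessian is nonsingular, is bounded above by a negative multiple of `‖s‖ ^ 2`. -/
lemma exists_quadratic_decay [DecidableEq ι] {M : Matrix ι ι ℝ} {T : Set (EuclideanSpace ℝ ι)}
    (hT : IsCompact T) (hT0 : T ∈ 𝓝 0) (hFc : ContinuousOn F T)
    (hneg : ∀ s ∈ T, s ≠ 0 → F s < 0) (hM : M.IsSymm) (hdet : M.det ≠ 0)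
    (hF : (fun s => F s + 1 / 2 * quadForm M s) =o[𝓝 0] fun s => ‖s‖ ^ 2) :
    ∃ c > 0, ∀ s ∈ T, F s ≤ -(c * ‖s‖ ^ 2) := by
  have h0 : F 0 = 0 := by
    have h := (hF.bound one_pos).self_of_nhds
    simpa [quadForm] using h
  have hneg' : ∀ s, quadForm (-M) s = -quadForm M s := fun s => by simp [quadForm]
  have hpos : ∀ s, 0 ≤ quadForm M s := fun s => by
    have h := quadForm_nonpos_of_isLocalMax (F := F) (N := -M)
      (hF.congr_left fun s => by rw [hneg']; ring) (by
        filter_upwards [hT0] with s hs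
        rcases eq_or_ne s 0 with rfl | hs0
        · exact h0.le
        · exact (hneg s hs hs0).le) s
    rw [hneg'] at h; linarith
  obtain ⟨c, hc, hq⟩ := exists_le_quadForm hM hdet hpos
  -- Near `0` the Hessian gives the constant `c / 4`. The rest of `T` is compact, `F` attains a
  -- negative maximum there, and `‖s‖ ≤ ρ` turns this into a multiple of `‖s‖ ^ 2`.
  obtain ⟨r, hr, hball⟩ := Metric.eventually_nhds_iff.1 (hF.bound (show 0 < c / 4 by positivity))
  have hnear : ∀ s, ‖s‖ < r → F s ≤ -(c / 4 * ‖s‖ ^ 2) := fun s hs => by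
    have h1 := hball (show dist s 0 < r by simpa using hs)
    rw [Real.norm_eq_abs, norm_pow, norm_norm] at h1
    nlinarith [(abs_le.1 h1).2, hq s, sq_nonneg ‖s‖]
  obtain ⟨ρ, hρ0, hρ⟩ : ∃ ρ > 0, ∀ s ∈ T, ‖s‖ ≤ ρ := by
    obtain ⟨ρ, hρ⟩ := hT.isBounded.exists_norm_le
    exact ⟨max ρ 1, by positivity, fun s hs => (hρ s hs).trans (le_max_left _ _)⟩
  have hK : IsCompact (T ∩ {s | r ≤ ‖s‖}) := hT.inter_right (isClosed_le continuous_const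
    continuous_norm)
  rcases (T ∩ {s | r ≤ ‖s‖}).eq_empty_or_nonempty with he | hne
  · refine ⟨c / 4, by positivity, fun s hs => hnear s ?_⟩
    by_contra hcon
    exact Set.notMem_empty s (he ▸ ⟨hs, not_lt.1 hcon⟩)
  obtain ⟨s₁, hs₁, hmax⟩ := hK.exists_isMaxOn hne (hFc.mono Set.inter_subset_left)
  have hs₁0 : s₁ ≠ 0 := fun h => by
    have : r ≤ ‖s₁‖ := hs₁.2
    rw [h, norm_zero] at this; linarith
  have hF1 := hneg s₁ hs₁.1 hs₁0
  refine ⟨min (c / 4) (-F s₁ / ρ ^ 2), lt_min (by positivity) (div_pos (by linarith)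
    (by positivity)), fun s hs => ?_⟩
  by_cases hsr : ‖s‖ < r
  · refine (hnear s hsr).trans ?_
    gcongr
    exact min_le_left _ _
  · have h1 : F s ≤ F s₁ := hmax ⟨hs, not_lt.1 hsr⟩
    have h2 : min (c / 4) (-F s₁ / ρ ^ 2) * ‖s‖ ^ 2 ≤ -F s₁ / ρ ^ 2 * ρ ^ 2 := by
      gcongr
      · exact div_nonneg (by linarith) (by positivity)
      · exact min_le_right _ _
      · exact hρ s hs
    rw [div_mul_cancel₀ _ (by positivity)] at h2
    linarith

end QuadraticMaximum

/-! ### Partial derivatives of functions that agree on an open set. -/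

section Congruence

variable {ι : Type*} [Fintype ι] [DecidableEq ι] {G G' : EuclideanSpace ℝ ι → ℝ}
  {O : Set (EuclideanSpace ℝ ι)}

/-- The identities between logarithms of densities hold on the parameter set only, so their
derivatives are compared on its interior. -/
lemma partialDeriv_congr (hO : IsOpen O) (h : Set.EqOn G G' O) (i : ι) :
    Set.EqOn (partialDeriv G i) (partialDeriv G' i) O := fun β hβ => by
  rw [partialDeriv, partialDeriv, (h.eventuallyEq_of_mem (hO.mem_nhds hβ)).fderiv_eq]

lemma partialDeriv₂_congr (hO : IsOpen O) (h : Set.EqOn G G' O) (i j : ι) :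
    Set.EqOn (partialDeriv₂ G i j) (partialDeriv₂ G' i j) O :=
  partialDeriv_congr hO (partialDeriv_congr hO h j) i

lemma partialDeriv_sub_const (c : ℝ) (i : ι) :
    partialDeriv (fun β => G β - c) i = partialDeriv G i := by
  ext β
  simp [partialDeriv, fderiv_sub_const]

lemma partialDeriv₂_sub_const (c : ℝ) (i j : ι) :
    partialDeriv₂ (fun β => G β - c) i j = partialDeriv₂ G i j := by
  ext β
  rw [partialDeriv₂, partialDeriv_sub_const]; rfl

lemma partialDeriv₂_const (c : ℝ) (i j : ι) (β : EuclideanSpace ℝ ι) :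
    partialDeriv₂ (fun _ : EuclideanSpace ℝ ι => c) i j β = 0 := by
  have : partialDeriv (fun _ : EuclideanSpace ℝ ι => c) j = fun _ => 0 := by
    ext β; simp [partialDeriv]
  rw [partialDeriv₂, this]; simp [partialDeriv]

lemma partialDeriv₂_sub (hO : IsOpen O) (hG : ContDiffOn ℝ 2 G O) (hG' : ContDiffOn ℝ 2 G' O)
    {β : EuclideanSpace ℝ ι} (hβ : β ∈ O) (i j : ι) :
    partialDeriv₂ (fun β => G β - G' β) i j β = partialDeriv₂ G i j β - partialDeriv₂ G' i j β := by
  have h1 : Set.EqOn (partialDeriv (fun β => G β - G' β) j)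
      (fun β => partialDeriv G j β - partialDeriv G' j β) O := fun x hx => by
    simp only [partialDeriv]
    rw [fderiv_fun_sub (differentiableAt_of_contDiffOn_two hO hG hx)
      (differentiableAt_of_contDiffOn_two hO hG' hx)]
    rfl
  rw [partialDeriv₂, partialDeriv_congr hO h1 i hβ, partialDeriv,
    fderiv_fun_sub (differentiableAt_partialDeriv hO hG hβ j)
      (differentiableAt_partialDeriv hO hG' hβ j)]
  rfl

end Congruence

/-! ### Probability densities and their marginals. -/

section Densities

variable {U V : Type*} [MeasurableSpace U] [MeasurableSpace V] {μ : Measure U} {κ : Measure V}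

namespace IsProbDensity

lemma integrable {q : U → ℝ} (hq : IsProbDensity μ q) : Integrable q μ := by
  by_contra h
  have := hq.integral_eq_one
  rw [integral_undef h] at this
  exact zero_ne_one this

lemma lintegral_eq_one {q : U → ℝ} (hq : IsProbDensity μ q) :
    ∫⁻ u, ENNReal.ofReal (q u) ∂μ = 1 := by
  rw [← ofReal_integral_eq_lintegral_ofReal hq.integrable (ae_of_all _ hq.nonneg),
    hq.integral_eq_one, ENNReal.ofReal_one]

lemma isProbabilityMeasure {q : U → ℝ} (hq : IsProbDensity μ q) :
    IsProbabilityMeasure (μ.withDensity fun u => ENNReal.ofReal (q u)) :=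
  ⟨by rw [withDensity_apply _ MeasurableSet.univ, Measure.restrict_univ, hq.lintegral_eq_one]⟩

lemma ae_pos {q : U → ℝ} (hq : IsProbDensity μ q) :
    ∀ᵐ u ∂(μ.withDensity fun u => ENNReal.ofReal (q u)), 0 < q u := by
  rw [ae_withDensity_iff hq.measurable.ennreal_ofReal]
  exact ae_of_all _ fun u hu => by simpa using hu

lemma comp_measurePreserving {e : V ≃ᵐ U} (he : MeasurePreserving e κ μ) {q : U → ℝ}
    (hq : IsProbDensity μ q) : IsProbDensity κ (q ∘ e) where
  measurable := hq.measurable.comp e.measurable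
  nonneg v := hq.nonneg _
  integral_eq_one := by
    rw [← hq.integral_eq_one]; exact he.integral_comp e.measurableEmbedding q

variable [SigmaFinite μ] [SigmaFinite κ] {q : U × V → ℝ}

lemma marginal (hq : IsProbDensity (μ.prod κ) q) :
    IsProbDensity μ fun u => ∫ v, q (u, v) ∂κ where
  measurable := (StronglyMeasurable.integral_prod_right (f := fun u v => q (u, v)) (ν := κ)
    hq.measurable.stronglyMeasurable).measurable
  nonneg u := integral_nonneg fun v => hq.nonneg _
  integral_eq_one := by rw [← hq.integral_eq_one, integral_prod _ hq.integrable]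

lemma lintegral_eq_marginal (hq : IsProbDensity (μ.prod κ) q) :
    ∀ᵐ u ∂μ, ∫⁻ v, ENNReal.ofReal (q (u, v)) ∂κ = ENNReal.ofReal (∫ v, q (u, v) ∂κ) := by
  filter_upwards [hq.integrable.prod_right_ae] with u hu
  rw [ofReal_integral_eq_lintegral_ofReal hu (ae_of_all _ fun v => hq.nonneg _)]

lemma map_fst (hq : IsProbDensity (μ.prod κ) q) :
    ((μ.prod κ).withDensity fun w => ENNReal.ofReal (q w)).map Prod.fst
      = μ.withDensity fun u => ENNReal.ofReal (∫ v, q (u, v) ∂κ) := by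
  ext s hs
  rw [Measure.map_apply measurable_fst hs, withDensity_apply _ (measurable_fst hs),
    withDensity_apply _ hs, ← Set.prod_univ, ← Measure.prod_restrict,
    lintegral_prod _ hq.measurable.ennreal_ofReal.aemeasurable, Measure.restrict_univ]
  exact lintegral_congr_ae (ae_restrict_of_ae hq.lintegral_eq_marginal)

end IsProbDensity

end Densities

/-! ### Laws of `X` and `Y`, and the information inequality for the latent part. -/

namespace AuxModel

variable {d f : ℕ} {𝒴 𝒵 𝒜 : Type*} [MeasurableSpace 𝒴] [MeasurableSpace 𝒵] [MeasurableSpace 𝒜]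

lemma measurable_toB : Measurable (toB : 𝒴 × 𝒵 × 𝒜 → 𝒴 × 𝒜) := by unfold toB; fun_prop

lemma measurable_toX : Measurable (toX : 𝒴 × 𝒵 × 𝒜 → 𝒴 × 𝒵) := by unfold toX; fun_prop

variable (M : AuxModel d f 𝒴 𝒵 𝒜) {βbar β : Param d f}

instance : SigmaFinite M.muY := M.sigmaFiniteY
instance : SigmaFinite M.muZ := M.sigmaFiniteZ
instance : SigmaFinite M.muA := M.sigmaFiniteA
instance : IsProbabilityMeasure M.law := M.isDensity_q.isProbabilityMeasure

lemma isDensity_assoc {g : 𝒴 × 𝒵 × 𝒜 → ℝ} (hg : IsProbDensity (M.muY.prod (M.muZ.prod M.muA)) g) :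
    IsProbDensity ((M.muY.prod M.muZ).prod M.muA) fun w => g (w.1.1, w.1.2, w.2) :=
  hg.comp_measurePreserving (e := MeasurableEquiv.prodAssoc)
    (measurePreserving_prodAssoc M.muY M.muZ M.muA)

lemma isDensity_qX : IsProbDensity (M.muY.prod M.muZ) M.qX :=
  (M.isDensity_assoc M.isDensity_q).marginal

lemma isDensity_qY : IsProbDensity M.muY M.qY := M.isDensity_qX.marginal

lemma map_toX_law : M.law.map toX
    = (M.muY.prod M.muZ).withDensity fun x => ENNReal.ofReal (M.qX x) := by
  have h1 := (M.isDensity_assoc M.isDensity_q).map_fst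
  have he : MeasurePreserving (MeasurableEquiv.prodAssoc : (𝒴 × 𝒵) × 𝒜 ≃ᵐ _)
    ((M.muY.prod M.muZ).prod M.muA) (M.muY.prod (M.muZ.prod M.muA)) :=
    measurePreserving_prodAssoc M.muY M.muZ M.muA
  have h2 : M.law = (((M.muY.prod M.muZ).prod M.muA).withDensity fun w =>
      ENNReal.ofReal (M.q (w.1.1, w.1.2, w.2))).map MeasurableEquiv.prodAssoc := by
    ext s hs
    rw [law, withDensity_apply _ hs, Measure.map_apply he.measurable hs,
      withDensity_apply _ (he.measurable hs), ← he.setLIntegral_comp_preimage hs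
        M.isDensity_q.measurable.ennreal_ofReal]
    rfl
  rw [h2, Measure.map_map measurable_toX he.measurable]
  exact h1

lemma map_fst_law : M.law.map Prod.fst = M.muY.withDensity fun y => ENNReal.ofReal (M.qY y) := by
  have h := M.isDensity_qX.map_fst
  rw [← map_toX_law, Measure.map_map measurable_fst measurable_toX] at h
  exact h

lemma ae_qX_pos : ∀ᵐ c ∂M.law, 0 < M.qX (toX c) := by
  have h := M.isDensity_qX.ae_pos
  rw [← map_toX_law] at h
  exact ae_of_ae_map measurable_toX.aemeasurable h

lemma ae_qY_pos : ∀ᵐ c ∂M.law, 0 < M.qY c.1 := by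
  have h := M.isDensity_qY.ae_pos
  rw [← map_fst_law] at h
  exact ae_of_ae_map measurable_fst.aemeasurable h

variable {M}

/-- The law of `X` is absolutely continuous with respect to the reference measure, and `q_y` is
almost surely positive, so the proviso in the hypothesis disappears under the true law. -/
lemma LatentCorrect.ae_eq (h : M.LatentCorrect βbar) :
    ∀ᵐ c ∂M.law, M.qZY (toX c) = M.pZY (toX c) βbar := by
  have h1 : ∀ᵐ c ∂M.law, 0 < M.qY (toX c).1 → M.qZY (toX c) = M.pZY (toX c) βbar := by
    refine ae_of_ae_map measurable_toX.aemeasurable ?_ (p := fun x => 0 < M.qY x.1 →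
      M.qZY x = M.pZY x βbar)
    rw [map_toX_law]
    exact (withDensity_absolutelyContinuous _ _).ae_le h
  filter_upwards [h1, M.ae_qY_pos] with c hc hy
  exact hc hy

namespace Regular

variable (hreg : M.Regular βbar)
include hreg

lemma mem_paramSet : βbar ∈ M.paramSet := interior_subset hreg.mem_interior

lemma domB : IsDominatedFamily M.law M.paramSet fun c => M.pB (toB c) :=
  hreg.familyB.comp measurable_toB

lemma domX : IsDominatedFamily M.law M.paramSet fun c => M.pX (toX c) :=
  hreg.familyX.comp measurable_toX

lemma domY : IsDominatedFamily M.law M.paramSet fun c => M.pY c.1 :=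
  hreg.familyY.comp measurable_fst

lemma log_pZY (x : 𝒴 × 𝒵) (hβ : β ∈ M.paramSet) :
    Real.log (M.pZY x β) = Real.log (M.pX x β) - Real.log (M.pY x.1 β) :=
  Real.log_div (hreg.familyX.pos x β hβ).ne' (hreg.familyY.pos x.1 β hβ).ne'

lemma pZY_pos (x : 𝒴 × 𝒵) (hβ : β ∈ M.paramSet) : 0 < M.pZY x β :=
  div_pos (hreg.familyX.pos x β hβ) (hreg.familyY.pos x.1 β hβ)

lemma measurable_pZY (hβ : β ∈ M.paramSet) : Measurable fun x => M.pZY x β :=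
  (hreg.familyX.measurable β hβ).div ((hreg.familyY.measurable β hβ).comp measurable_fst)

lemma integrable_log_pZY (hβ : β ∈ M.paramSet) :
    Integrable (fun c => Real.log (M.pX (toX c) β) - Real.log (M.pY c.1 β)) M.law :=
  (hreg.domX.integrable_log hβ).sub' (hreg.domY.integrable_log hβ)

lemma ae_log_qZY (hlatent : M.LatentCorrect βbar) :
    ∀ᵐ c ∂M.law, Real.log (M.qZY (toX c))
      = Real.log (M.pX (toX c) βbar) - Real.log (M.pY c.1 βbar) := by
  filter_upwards [hlatent.ae_eq] with c hc
  rw [hc, hreg.log_pZY _ hreg.mem_paramSet]; rfl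

lemma lintegral_pX (y : 𝒴) (hβ : β ∈ M.paramSet) :
    ∫⁻ z, ENNReal.ofReal (M.pX (y, z) β) ∂M.muZ = ENNReal.ofReal (M.pY y β) := by
  rw [pY, ofReal_integral_eq_lintegral_ofReal]
  -- A nonintegrable section would have Bochner integral `0`, against the positivity of `p_y`.
  · by_contra h
    have := hreg.familyY.pos y β hβ
    rw [pY, integral_undef h] at this
    exact lt_irrefl _ this
  · exact ae_of_all _ fun z => (hreg.familyX.pos _ β hβ).le

/-- Weighted by `q_x`, the ratio is at most `q_y(y) p_{z|y}(z | y)`, with equality where `q_x > 0`;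
integrating out `z` leaves the mass of `q_y`. Equality may fail because the candidate can charge
points where `q_x` vanishes. -/
lemma lintegral_ratio_le (hβ : β ∈ M.paramSet) :
    ∫⁻ c, ENNReal.ofReal (M.pZY (toX c) β / M.qZY (toX c)) ∂M.law ≤ 1 := by
  have hmq : Measurable M.qZY :=
    M.isDensity_qX.measurable.div (M.isDensity_qY.measurable.comp measurable_fst)
  have hm : Measurable fun x => ENNReal.ofReal (M.pZY x β / M.qZY x) :=
    ((hreg.measurable_pZY hβ).div hmq).ennreal_ofReal
  have hmX := hreg.familyX.measurable β hβ
  have hmY := hreg.familyY.measurable β hβ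
  rw [← lintegral_map hm measurable_toX, map_toX_law, lintegral_withDensity_eq_lintegral_mul _
    M.isDensity_qX.measurable.ennreal_ofReal hm]
  calc ∫⁻ x, ENNReal.ofReal (M.qX x) * ENNReal.ofReal (M.pZY x β / M.qZY x) ∂(M.muY.prod M.muZ)
      ≤ ∫⁻ x, ENNReal.ofReal (M.qY x.1 / M.pY x.1 β) * ENNReal.ofReal (M.pX x β)
          ∂(M.muY.prod M.muZ) := by
        refine lintegral_mono fun x => ?_
        have hy := hreg.familyY.pos x.1 β hβ
        have hx := hreg.familyX.pos x β hβ
        have hqy := M.isDensity_qY.nonneg x.1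
        rw [← ENNReal.ofReal_mul (M.isDensity_qX.nonneg x), ← ENNReal.ofReal_mul (by positivity)]
        refine ENNReal.ofReal_le_ofReal ?_
        rcases (M.isDensity_qX.nonneg x).eq_or_lt with h0 | h0
        · rw [← h0, zero_mul]; positivity
        · refine le_of_eq ?_
          rw [qZY, pZY]
          field_simp
    _ = ∫⁻ y, ENNReal.ofReal (M.qY y) ∂M.muY := by
        rw [lintegral_prod _ (by
          exact (((M.isDensity_qY.measurable.div hmY).comp measurable_fst).ennreal_ofReal.mul
            hmX.ennreal_ofReal).aemeasurable)]
        refine lintegral_congr fun y => ?_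
        have hy := hreg.familyY.pos y β hβ
        have hz : Measurable fun z => ENNReal.ofReal (M.pX (y, z) β) :=
          (hmX.comp measurable_prodMk_left).ennreal_ofReal
        simp only
        rw [lintegral_const_mul _ hz,
          hreg.lintegral_pX y hβ,
          ← ENNReal.ofReal_mul (div_nonneg (M.isDensity_qY.nonneg y) hy.le),
          div_mul_cancel₀ _ hy.ne']
    _ ≤ 1 := M.isDensity_qY.lintegral_eq_one.le

/-- The information inequality for the conditional density of the latent part. -/
lemma integral_log_pZY_le (hlatent : M.LatentCorrect βbar) (hβ : β ∈ M.paramSet) :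
    ∫ c, (Real.log (M.pX (toX c) β) - Real.log (M.pY c.1 β)) ∂M.law
      ≤ ∫ c, (Real.log (M.pX (toX c) βbar) - Real.log (M.pY c.1 βbar)) ∂M.law := by
  have hmq : Measurable M.qZY :=
    M.isDensity_qX.measurable.div (M.isDensity_qY.measurable.comp measurable_fst)
  set R : 𝒴 × 𝒵 × 𝒜 → ℝ := fun c => M.pZY (toX c) β / M.qZY (toX c) with hR
  have hRm : Measurable R := ((hreg.measurable_pZY hβ).div hmq).comp measurable_toX
  have hpos : ∀ᵐ c ∂M.law, 0 < R c := by
    filter_upwards [M.ae_qX_pos, M.ae_qY_pos] with c hx hy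
    exact div_pos (hreg.pZY_pos _ hβ) (div_pos hx hy)
  have hle := hreg.lintegral_ratio_le hβ
  have hRi : Integrable R M.law := by
    refine ⟨hRm.aestronglyMeasurable, ?_⟩
    rw [hasFiniteIntegral_iff_ofReal (hpos.mono fun c hc => hc.le)]
    exact hle.trans_lt ENNReal.one_lt_top
  have hR1 : ∫ c, R c ∂M.law ≤ 1 := by
    rw [integral_eq_lintegral_of_nonneg_ae (hpos.mono fun c hc => hc.le) hRm.aestronglyMeasurable]
    exact ENNReal.toReal_mono ENNReal.one_ne_top hle
  rw [← sub_nonpos, ← integral_sub (hreg.integrable_log_pZY hβ)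
    (hreg.integrable_log_pZY hreg.mem_paramSet)]
  calc _ ≤ ∫ c, (R c - 1) ∂M.law := by
        refine integral_mono_ae ((hreg.integrable_log_pZY hβ).sub'
          (hreg.integrable_log_pZY hreg.mem_paramSet)) (hRi.sub' (integrable_const 1)) ?_
        filter_upwards [hpos, hreg.ae_log_qZY hlatent, M.ae_qX_pos, M.ae_qY_pos] with c hc hl hx hy
        -- `log r ≤ r - 1` for the ratio `R`, of mean at most `1`; correct specification turns `log
        -- q_{z|y}` into the candidate's logarithm at `βbar`.
        have h1 := Real.log_le_sub_one_of_pos hc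
        have hq : 0 < M.qZY (toX c) := div_pos hx hy
        rw [hR, Real.log_div (hreg.pZY_pos _ hβ).ne' hq.ne', hreg.log_pZY _ hβ, hl] at h1
        exact h1
    _ ≤ 0 := by
        rw [integral_sub hRi (integrable_const 1)]
        simpa using hR1

/-- Domination is assumed for `p_x` and `p_y` but not for `p_{z|y}` itself, so its information
matrix is reached through the difference of the two logarithms. -/
lemma matIzy_apply (i j : Fin d ⊕ Fin f) : M.matIzy βbar i j
    = -((∫ c, partialDeriv₂ (fun β' => Real.log (M.pX (toX c) β')) i j βbar ∂M.law)
      - ∫ c, partialDeriv₂ (fun β' => Real.log (M.pY c.1 β')) i j βbar ∂M.law) := by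
  rw [matIzy, Matrix.of_apply, ← integral_sub (hreg.domX.integrable_partialDeriv₂
    hreg.mem_interior i j) (hreg.domY.integrable_partialDeriv₂ hreg.mem_interior i j)]
  congr 1
  refine integral_congr_ae (ae_of_all _ fun c => ?_)
  have h : Set.EqOn (fun β' => Real.log (M.pZY (toX c) β'))
      (fun β' => Real.log (M.pX (toX c) β') - Real.log (M.pY c.1 β')) (interior M.paramSet) :=
    fun β hβ => hreg.log_pZY _ (interior_subset hβ)
  simp only
  rw [partialDeriv₂_congr isOpen_interior h i j hreg.mem_interior,
    partialDeriv₂_sub isOpen_interior (hreg.domX.contDiffOn c) (hreg.domY.contDiffOn c)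
      hreg.mem_interior]

lemma matIb_isSymm : (M.matIb βbar).IsSymm := by
  ext i j
  simp only [Matrix.transpose_apply, matIb, Matrix.of_apply]
  congr 1
  exact integral_congr_ae (ae_of_all _ fun c =>
    partialDeriv₂_comm isOpen_interior (hreg.domB.contDiffOn c) hreg.mem_interior j i)

end Regular

/-! ### Trivial latent and auxiliary variables: reduction to Takeuchi's criterion. -/

section Trivial

variable [Subsingleton 𝒵] [Subsingleton 𝒜] (hreg : M.Regular βbar)
include hreg

/-- On a one-point space integration is multiplication by the mass of the point, which need not be
`1`. So `p_y` is a constant multiple of `p_b`, and the additive constant `κ` affects neither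
maximizers nor derivatives. -/
lemma Regular.exists_log_pB_eq : ∃ κ : ℝ, ∀ b, ∀ β ∈ M.paramSet,
    Real.log (M.pB b β) = Real.log (M.pY b.1 β) - κ := by
  obtain ⟨⟨-, z, a⟩⟩ : Nonempty (𝒴 × 𝒵 × 𝒜) := nonempty_of_isProbabilityMeasure M.law
  let _ : Unique 𝒵 := ⟨⟨z⟩, fun _ => Subsingleton.elim _ _⟩
  let _ : Unique 𝒜 := ⟨⟨a⟩, fun _ => Subsingleton.elim _ _⟩
  refine ⟨Real.log (M.muA.real Set.univ), fun b β hβ => ?_⟩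
  have hb := hreg.familyB.pos b β hβ
  have hy := hreg.familyY.pos b.1 β hβ
  have h : M.pY b.1 β = M.muA.real Set.univ * M.pB b β := by
    simp only [pY, pX, pB, integral_unique, smul_eq_mul]
    rw [Subsingleton.elim b.2 default]
    ring
  have hA : M.muA.real Set.univ ≠ 0 := fun h0 => by
    rw [h, h0, zero_mul] at hy; exact lt_irrefl _ hy
  rw [h, Real.log_mul hA hb.ne']
  ring

omit [Subsingleton 𝒜] in
-- The conditional density is the reciprocal mass of the single point, whatever the parameter. Hence
-- `I_{z|y}` vanishes and the last term of the criterion drops out.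
lemma Regular.exists_pZY_eq : ∃ κ : ℝ, ∀ x, ∀ β ∈ M.paramSet, Real.log (M.pZY x β) = κ := by
  obtain ⟨⟨-, z, -⟩⟩ : Nonempty (𝒴 × 𝒵 × 𝒜) := nonempty_of_isProbabilityMeasure M.law
  let _ : Unique 𝒵 := ⟨⟨z⟩, fun _ => Subsingleton.elim _ _⟩
  refine ⟨Real.log (1 / M.muZ.real Set.univ), fun x β hβ => ?_⟩
  have hx := hreg.familyX.pos x β hβ
  have hy := hreg.familyY.pos x.1 β hβ
  have h : M.pY x.1 β = M.muZ.real Set.univ * M.pX x β := by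
    simp only [pY, integral_unique, smul_eq_mul]
    rw [Subsingleton.elim default x.2]
  rw [pZY, h, mul_comm, div_mul_cancel_left₀ hx.ne', one_div]

lemma Regular.isMaxOn_ellY {n : ℕ} {b : Fin n → 𝒴 × 𝒜} {β : Param d f} (hβ : β ∈ M.paramSet)
    (hmax : IsMaxOn (M.ellB b) M.paramSet β) : IsMaxOn (M.ellY b) M.paramSet β := by
  obtain ⟨κ, hκ⟩ := hreg.exists_log_pB_eq
  have h : ∀ β ∈ M.paramSet, M.ellB b β = M.ellY b β - 1 / (n : ℝ) * (n * κ) := fun β hβ => by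
    simp only [ellB, ellY]
    rw [Finset.sum_congr rfl fun i _ => hκ (b i) β hβ, Finset.sum_sub_distrib]
    simp
    ring
  intro β' hβ'
  have := hmax hβ'
  simp only [Set.mem_ofPred_eq] at this ⊢
  rw [h β' hβ', h β hβ] at this
  linarith

lemma Regular.unique_max_pY (hβ : β ∈ M.paramSet) (hne : β ≠ βbar) :
    ∫ c, Real.log (M.pY c.1 β) ∂M.law < ∫ c, Real.log (M.pY c.1 βbar) ∂M.law := by
  obtain ⟨κ, hκ⟩ := hreg.exists_log_pB_eq
  have h : ∀ β ∈ M.paramSet, ∫ c, Real.log (M.pB (toB c) β) ∂M.law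
      = (∫ c, Real.log (M.pY c.1 β) ∂M.law) - κ := fun β hβ => by
    have : ∀ c : 𝒴 × 𝒵 × 𝒜, Real.log (M.pB (toB c) β) = Real.log (M.pY c.1 β) - κ :=
      fun c => hκ (toB c) β hβ
    simp_rw [this]
    rw [integral_sub (hreg.domY.integrable_log hβ) (integrable_const κ)]
    simp
  have := hreg.unique_max β hβ hne
  rw [h β hβ, h βbar hreg.mem_paramSet] at this
  linarith

lemma Regular.criterion_eq_tic {n : ℕ} (b : Fin n → 𝒴 × 𝒜) (β : Param d f) :
    M.criterion βbar b β = M.tic βbar b β := by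
  obtain ⟨κ, hκ⟩ := hreg.exists_log_pB_eq
  obtain ⟨κ', hκ'⟩ := hreg.exists_pZY_eq
  have hE : ∀ c : 𝒴 × 𝒵 × 𝒜, Set.EqOn (fun β' => Real.log (M.pB (toB c) β'))
      (fun β' => Real.log (M.pY c.1 β') - κ) (interior M.paramSet) :=
    fun c β hβ => hκ (toB c) β (interior_subset hβ)
  have h1 : ∀ (c : 𝒴 × 𝒵 × 𝒜) i, partialDeriv (fun β' => Real.log (M.pB (toB c) β')) i βbar
      = partialDeriv (fun β' => Real.log (M.pY c.1 β')) i βbar := fun c i => by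
    rw [partialDeriv_congr isOpen_interior (hE c) i hreg.mem_interior, partialDeriv_sub_const]
  have h2 : ∀ (c : 𝒴 × 𝒵 × 𝒜) i j, partialDeriv₂ (fun β' => Real.log (M.pB (toB c) β')) i j βbar
      = partialDeriv₂ (fun β' => Real.log (M.pY c.1 β')) i j βbar := fun c i j => by
    rw [partialDeriv₂_congr isOpen_interior (hE c) i j hreg.mem_interior, partialDeriv₂_sub_const]
  have h3 : M.matIzy βbar = 0 := by
    ext i j
    simp only [matIzy, Matrix.of_apply, Matrix.zero_apply, neg_eq_zero]
    refine integral_eq_zero_of_ae (ae_of_all _ fun c => ?_)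
    have hE' : Set.EqOn (fun β' => Real.log (M.pZY (toX c) β')) (fun _ => κ')
        (interior M.paramSet) := fun β hβ => hκ' _ β (interior_subset hβ)
    simp only [Pi.zero_apply]
    rw [partialDeriv₂_congr isOpen_interior hE' i j hreg.mem_interior, partialDeriv₂_const]
  have h4 : M.matIb βbar = M.matIy βbar := by simp only [matIb, matIy, h2]
  have h5 : M.matKby βbar = M.matJy βbar := by simp only [matKby, matJy, h1]
  rw [criterion, tic, h3, h4, h5]
  simp

end Trivial

end AuxModel

/-! ### Expansions of the model's mean log-likelihoods and the centred estimator. -/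

lemma eventually_add_mem {E : Type*} [NormedAddCommGroup E] {B : Set E} {x : E}
    (hx : x ∈ interior B) : ∀ᶠ s in 𝓝 (0 : E), x + s ∈ B := by
  have t : Tendsto (fun s => x + s) (𝓝 (0 : E)) (𝓝 x) := by
    simpa using (continuous_const_add x).tendsto 0
  exact (t.eventually (isOpen_interior.mem_nhds hx)).mono fun _ hs => interior_subset hs

lemma ContinuousOn.measurable_comp {E Ω : Type*} [TopologicalSpace E] [MeasurableSpace E]
    [BorelSpace E] [MeasurableSpace Ω] {B : Set E} {g : E → ℝ} (hg : ContinuousOn g B) {X : Ω → E}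
    (hX : Measurable X) (hXB : ∀ ω, X ω ∈ B) : Measurable fun ω => g (X ω) :=
  (continuousOn_iff_continuous_domRestrict.1 hg).measurable.comp (hX.subtype_mk (h := hXB))

namespace IsDominatedFamily

variable {𝒰 ι : Type*} [MeasurableSpace 𝒰] [Fintype ι] [DecidableEq ι]
  {ν : Measure 𝒰} [IsFiniteMeasure ν] {B : Set (EuclideanSpace ℝ ι)} {βbar : EuclideanSpace ℝ ι}
  {p : 𝒰 → EuclideanSpace ℝ ι → ℝ} (hp : IsDominatedFamily ν B p)
include hp

/-- The mean log-likelihood differs from its linearization by a quadratic error on the whole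
parameter space. -/
lemma exists_abs_integral_log_sub_le (hB : Convex ℝ B) (hβ : βbar ∈ interior B) :
    ∃ K : ℝ, ∀ s, βbar + s ∈ B →
      |(∫ u, Real.log (p u (βbar + s)) ∂ν) - (∫ u, Real.log (p u βbar) ∂ν)
        - ∑ k, s k * ∫ u, partialDeriv (fun β' => Real.log (p u β')) k βbar ∂ν|
        ≤ K * ‖s‖ ^ 2 := by
  obtain ⟨f, D, H, hf, hae⟩ := hp.exists_smoothFamily hB hβ
  have hβB := interior_subset hβ
  refine ⟨∫ u, H u ∂ν, fun s hs => ?_⟩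
  have i0 : ∀ k ∈ Finset.univ, Integrable (fun u => s k
      * partialDeriv (fun β' => Real.log (p u β')) k βbar) ν := fun k _ =>
    (hp.integrable_partialDeriv hβ k).const_mul _
  have l1 := hp.integrable_log hs
  have l2 := hp.integrable_log hβB
  have e : (∫ u, Real.log (p u (βbar + s)) ∂ν) - (∫ u, Real.log (p u βbar) ∂ν)
        - ∑ k, s k * ∫ u, partialDeriv (fun β' => Real.log (p u β')) k βbar ∂ν
      = ∫ u, (Real.log (p u (βbar + s)) - Real.log (p u βbar)
        - ∑ k, s k * partialDeriv (fun β' => Real.log (p u β')) k βbar) ∂ν := by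
    rw [integral_sub (l1.sub' l2) (integrable_finsetSum _ i0), integral_sub l1 l2,
      integral_finsetSum _ i0]
    simp_rw [integral_const_mul]
  rw [e, ← integral_mul_const, ← Real.norm_eq_abs]
  refine norm_integral_le_of_norm_le (hf.env_int.mul_const _) ?_
  filter_upwards [hae] with u hu
  have h := hf.lip_sub_linear u s hs 0 (by simpa using hβB) ‖s‖ le_rfl (by simp)
  rw [hf.zero, sub_zero, sub_zero, hu.1, hu.2, PiLp.inner_apply] at h
  rw [Real.norm_eq_abs]
  refine (le_of_eq ?_).trans (h.trans (le_of_eq (by ring)))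
  congr 2

/-- The mean score vanishes at an interior maximizer of the mean log-likelihood. -/
lemma integral_partialDeriv_eq_zero (hB : Convex ℝ B) (hβ : βbar ∈ interior B)
    (hmax : ∀ β ∈ B, ∫ u, Real.log (p u β) ∂ν ≤ ∫ u, Real.log (p u βbar) ∂ν) (k : ι) :
    ∫ u, partialDeriv (fun β' => Real.log (p u β')) k βbar ∂ν = 0 :=
  linear_coeff_eq_zero_of_isLocalMax (hp.isLittleO_integral_log hB hβ) (by
    filter_upwards [eventually_add_mem hβ] with s hs
    linarith [hmax _ hs]) k

end IsDominatedFamily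

namespace AuxModel

variable {d f : ℕ} {𝒴 𝒵 𝒜 Ω : Type*} [MeasurableSpace 𝒴] [MeasurableSpace 𝒵] [MeasurableSpace 𝒜]
  [MeasurableSpace Ω] {P : Measure Ω} [IsProbabilityMeasure P] {M : AuxModel d f 𝒴 𝒵 𝒜}
  {βbar : Param d f} {C : ℕ → Ω → 𝒴 × 𝒵 × 𝒜} {betaHat : ∀ n : ℕ, (Fin n → 𝒴 × 𝒜) → Param d f}
  {data : ∀ n : ℕ, Ω → Fin n → 𝒴 × 𝒜}

namespace Regular

variable (hreg : M.Regular βbar)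
include hreg

/-- Excess of the mean conditional log-likelihood of the latent part at `βbar + s`. -/
lemma latent_expansion (hlatent : M.LatentCorrect βbar) :
    (fun s => ((∫ c, Real.log (M.pX (toX c) (βbar + s)) ∂M.law)
        - ∫ c, Real.log (M.pY c.1 (βbar + s)) ∂M.law)
      - ((∫ c, Real.log (M.pX (toX c) βbar) ∂M.law) - ∫ c, Real.log (M.pY c.1 βbar) ∂M.law)
      - 1 / 2 * quadForm (-M.matIzy βbar) s) =o[𝓝 0] (fun s => ‖s‖ ^ 2) ∧
    ∃ K : ℝ, ∀ s, βbar + s ∈ M.paramSet →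
      |((∫ c, Real.log (M.pX (toX c) (βbar + s)) ∂M.law)
          - ∫ c, Real.log (M.pY c.1 (βbar + s)) ∂M.law)
        - ((∫ c, Real.log (M.pX (toX c) βbar) ∂M.law) - ∫ c, Real.log (M.pY c.1 βbar) ∂M.law)|
        ≤ K * ‖s‖ ^ 2 := by
  have hX := hreg.domX.isLittleO_integral_log hreg.convex hreg.mem_interior
  have hY := hreg.domY.isLittleO_integral_log hreg.convex hreg.mem_interior
  -- The decisive use of correct specification: `βbar` is defined by the likelihood of `B` alone,
  -- yet it maximizes the mean of `log p_{z|y}` too. It need not maximize the means of `log p_x` or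
  -- `log p_y`; only the difference of their linear terms vanishes.
  have hmax : ∀ s, βbar + s ∈ M.paramSet →
      ((∫ c, Real.log (M.pX (toX c) (βbar + s)) ∂M.law)
          - ∫ c, Real.log (M.pY c.1 (βbar + s)) ∂M.law)
        - ((∫ c, Real.log (M.pX (toX c) βbar) ∂M.law)
          - ∫ c, Real.log (M.pY c.1 βbar) ∂M.law) ≤ 0 := fun s hs => by
    rw [← integral_sub (hreg.domX.integrable_log hs) (hreg.domY.integrable_log hs),
      ← integral_sub (hreg.domX.integrable_log hreg.mem_paramSet)
        (hreg.domY.integrable_log hreg.mem_paramSet)]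
    exact sub_nonpos.2 (hreg.integral_log_pZY_le hlatent hs)
  set a : Fin d ⊕ Fin f → ℝ := fun k =>
    (∫ c, partialDeriv (fun β' => Real.log (M.pX (toX c) β')) k βbar ∂M.law)
      - ∫ c, partialDeriv (fun β' => Real.log (M.pY c.1 β')) k βbar ∂M.law with ha
  have hsum : ∀ s : Param d f, ∑ k, s k * a k
      = (∑ k, s k * ∫ c, partialDeriv (fun β' => Real.log (M.pX (toX c) β')) k βbar ∂M.law)
        - ∑ k, s k * ∫ c, partialDeriv (fun β' => Real.log (M.pY c.1 β')) k βbar ∂M.law :=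
    fun s => by rw [← Finset.sum_sub_distrib]; exact Finset.sum_congr rfl fun k _ => by
                  rw [ha]; ring
  have hquad : ∀ s : Param d f, quadForm (-M.matIzy βbar) s
      = quadForm (Matrix.of fun i j =>
          ∫ c, partialDeriv₂ (fun β' => Real.log (M.pX (toX c) β')) i j βbar ∂M.law) s
        - quadForm (Matrix.of fun i j =>
          ∫ c, partialDeriv₂ (fun β' => Real.log (M.pY c.1 β')) i j βbar ∂M.law) s := fun s => by
    simp only [quadForm, ← Finset.sum_sub_distrib]
    refine Finset.sum_congr rfl fun i _ => Finset.sum_congr rfl fun j _ => ?_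
    rw [Matrix.neg_apply, hreg.matIzy_apply, Matrix.of_apply, Matrix.of_apply]
    ring
  have hO := (hX.sub hY).congr_left (f₂ := fun s =>
    ((∫ c, Real.log (M.pX (toX c) (βbar + s)) ∂M.law)
        - ∫ c, Real.log (M.pY c.1 (βbar + s)) ∂M.law)
      - ((∫ c, Real.log (M.pX (toX c) βbar) ∂M.law) - ∫ c, Real.log (M.pY c.1 βbar) ∂M.law)
      - ∑ k, s k * a k - 1 / 2 * quadForm (-M.matIzy βbar) s) fun s => by
    rw [hsum, hquad]; ring
  have ha0 : ∀ k, a k = 0 := linear_coeff_eq_zero_of_isLocalMax hO (by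
    filter_upwards [eventually_add_mem hreg.mem_interior] with s hs using hmax s hs)
  refine ⟨hO.congr_left fun s => by simp [ha0], ?_⟩
  -- Each bound contains its own linear term; in the difference they cancel because `a = 0`.
  obtain ⟨K, hK⟩ := hreg.domX.exists_abs_integral_log_sub_le hreg.convex hreg.mem_interior
  obtain ⟨K', hK'⟩ := hreg.domY.exists_abs_integral_log_sub_le hreg.convex hreg.mem_interior
  refine ⟨K + K', fun s hs => ?_⟩
  have h0 := hsum s
  simp only [ha0, mul_zero, Finset.sum_const_zero] at h0
  rw [add_mul]
  refine le_trans (le_of_eq ?_) ((abs_sub _ _).trans (add_le_add (hK s hs) (hK' s hs)))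
  congr 1
  linarith

lemma isCompact_shift : IsCompact {s | βbar + s ∈ M.paramSet} :=
  (Homeomorph.addLeft βbar).isClosedEmbedding.isCompact_preimage hreg.isCompact

omit [IsProbabilityMeasure P] in
/-- The centred maximum likelihood estimator satisfies the hypotheses of `QuadraticArgmax`. -/
lemma exists_quadraticArgmax (hC : ∀ i, Measurable (C i)) (hindep : iIndepFun C P)
    (hlaw : ∀ i, P.map (C i) = M.law) (hMLE : M.IsMLE betaHat)
    (hdata : ∀ n ω i, data n ω i = toB (C i ω)) :
    ∃ (g : 𝒴 × 𝒵 × 𝒜 → Param d f → ℝ) (D : 𝒴 × 𝒵 × 𝒜 → Param d f) (H : 𝒴 × 𝒵 × 𝒜 → ℝ),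
      QuadraticArgmax P M.law C {s | βbar + s ∈ M.paramSet} g D H (M.matIb βbar)
        (fun n ω => betaHat n (data n ω) - βbar) ∧
      ∀ᵐ c ∂M.law, D c = gradVec (fun β' => Real.log (M.pB (toB c) β')) βbar := by
  obtain ⟨g, D, H, hg, hae⟩ := hreg.domB.exists_smoothFamily hreg.convex hreg.mem_interior
  refine ⟨g, D, H, ?_, hae.mono fun c hc => hc.2⟩
  have hS : IsIIDSample P M.law C := ⟨hC, hindep, hlaw⟩
  have hmean : ∀ s, βbar + s ∈ M.paramSet → ∫ c, g c s ∂M.law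
      = (∫ c, Real.log (M.pB (toB c) (βbar + s)) ∂M.law)
        - ∫ c, Real.log (M.pB (toB c) βbar) ∂M.law := fun s hs => by
    rw [← integral_sub (hreg.domB.integrable_log hs) (hreg.domB.integrable_log hreg.mem_paramSet)]
    exact integral_congr_ae (hae.mono fun c hc => hc.1 s)
  have hmax : ∀ β ∈ M.paramSet, ∫ c, Real.log (M.pB (toB c) β) ∂M.law
      ≤ ∫ c, Real.log (M.pB (toB c) βbar) ∂M.law := fun β hβ => by
    rcases eq_or_ne β βbar with rfl | hne
    · exact le_rfl
    · exact (hreg.unique_max β hβ hne).le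
  have hscore := hreg.domB.integral_partialDeriv_eq_zero hreg.convex hreg.mem_interior hmax
  have hnhds : {s | βbar + s ∈ M.paramSet} ∈ 𝓝 (0 : Param d f) :=
    eventually_add_mem hreg.mem_interior
  have hexp : (fun s => (∫ c, g c s ∂M.law) + 1 / 2 * quadForm (M.matIb βbar) s)
      =o[𝓝 0] fun s => ‖s‖ ^ 2 := by
    refine (hreg.domB.isLittleO_integral_log hreg.convex hreg.mem_interior).congr' ?_
      EventuallyEq.rfl
    filter_upwards [hnhds] with s hs
    rw [hmean s hs]
    have hq : quadForm (M.matIb βbar) s = -quadForm (Matrix.of fun i j =>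
        ∫ c, partialDeriv₂ (fun β' => Real.log (M.pB (toB c) β')) i j βbar ∂M.law) s := by
      simp only [quadForm, matIb, Matrix.of_apply, neg_mul, Finset.sum_neg_distrib]
    rw [hq]
    simp only [hscore, mul_zero, Finset.sum_const_zero]
    ring
  have hcont : ContinuousOn (fun s => ∫ c, g c s ∂M.law) {s | βbar + s ∈ M.paramSet} := by
    have h := (hreg.domB.continuousOn_integral_log.comp (continuous_const_add βbar).continuousOn
      fun s (hs : βbar + s ∈ M.paramSet) => hs).sub
      (continuousOn_const (c := ∫ c, Real.log (M.pB (toB c) βbar) ∂M.law))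
    exact h.congr fun s hs => hmean s hs
  exact {
    sample := hS
    family := hg
    mem_nhds := hnhds
    bounded := hreg.isCompact_shift.isBounded.exists_norm_le
    score_mean := fun k => by
      rw [← hscore k]
      exact integral_congr_ae (hae.mono fun c hc => by simp only [hc.2]; rfl)
    symm := hreg.matIb_isSymm
    det_ne_zero := hreg.nonsingular
    expansion := hexp
    decay := exists_quadratic_decay hreg.isCompact_shift hnhds hcont (fun s hs hs0 => by
      rw [hmean s hs]
      exact sub_neg.2 (hreg.unique_max _ hs (by simpa using hs0)))
      hreg.matIb_isSymm hreg.nonsingular hexp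
    est_meas := fun n => by
      refine ((hMLE.measurable n).comp (measurable_pi_iff.2 fun i => ?_)).sub_const βbar
      simp only [hdata]
      exact measurable_toB.comp (hC i)
    est_mem := fun n ω => by simpa using hMLE.mem n (data n ω)
    argmax := by
      filter_upwards [hS.ae_comp hae] with ω hω n s hs
      rcases Nat.eq_zero_or_pos n with rfl | hn
      · simp
      have h1 := hMLE.isMaxOn n (data n ω) hs
      simp only [Set.mem_ofPred_eq, ellB, hdata] at h1
      have h2 := le_of_mul_le_mul_left h1 (by positivity)
      rw [Fin.sum_univ_eq_sum_range (fun i => Real.log (M.pB (toB (C i ω)) (βbar + s))),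
        Fin.sum_univ_eq_sum_range (fun i => Real.log (M.pB (toB (C i ω))
          (betaHat n (data n ω))))] at h2
      simp only [(hω _).1, add_sub_cancel, Finset.sum_sub_distrib]
      linarith }

end Regular

end AuxModel

lemma Matrix.trace_mul_eq_sum {ι : Type*} [Fintype ι] (A B : Matrix ι ι ℝ) :
    (A * B).trace = ∑ k, ∑ l, A k l * B l k := by
  simp [Matrix.trace, Matrix.mul_apply]

/-! ### Expectation of the criterion. -/

namespace AuxModel

variable {d f : ℕ} {𝒴 𝒵 𝒜 Ω : Type*} [MeasurableSpace 𝒴] [MeasurableSpace 𝒵] [MeasurableSpace 𝒜]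
  [MeasurableSpace Ω] {P : Measure Ω} [IsProbabilityMeasure P] {M : AuxModel d f 𝒴 𝒵 𝒜}
  {βbar : Param d f} {C : ℕ → Ω → 𝒴 × 𝒵 × 𝒜} {betaHat : ∀ n : ℕ, (Fin n → 𝒴 × 𝒜) → Param d f}
  {data : ∀ n : ℕ, Ω → Fin n → 𝒴 × 𝒜}

omit [MeasurableSpace Ω] in
lemma mul_ellY (hdata : ∀ n ω i, data n ω i = toB (C i ω)) (n : ℕ) (ω : Ω) (β : Param d f) :
    (n : ℝ) * M.ellY (data n ω) β = ∑ i ∈ Finset.range n, Real.log (M.pY (C i ω).1 β) := by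
  rcases Nat.eq_zero_or_pos n with rfl | hn
  · simp
  rw [ellY, ← mul_assoc, mul_one_div_cancel (by positivity), one_mul]
  simp only [hdata]
  exact Fin.sum_univ_eq_sum_range (fun i => Real.log (M.pY (toB (C i ω)).1 β)) n

lemma measurable_data (hC : ∀ i, Measurable (C i))
    (hdata : ∀ n ω i, data n ω i = toB (C i ω)) (n : ℕ) : Measurable (data n) := by
  refine measurable_pi_iff.2 fun i => ?_
  simp only [hdata]
  exact measurable_toB.comp (hC i)

namespace Regular

variable (hreg : M.Regular βbar)
include hreg

lemma integrable_log_qZY (hlatent : M.LatentCorrect βbar) :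
    Integrable (fun c => Real.log (M.qZY (toX c))) M.law :=
  (hreg.integrable_log_pZY hreg.mem_paramSet).congr
    ((hreg.ae_log_qZY hlatent).mono fun _ hc => hc.symm)

lemma constC_eq (hlatent : M.LatentCorrect βbar) : M.constC
    = (∫ c, Real.log (M.pX (toX c) βbar) ∂M.law) - ∫ c, Real.log (M.pY c.1 βbar) ∂M.law := by
  rw [constC, integral_congr_ae (hreg.ae_log_qZY hlatent),
    integral_sub (hreg.domX.integrable_log hreg.mem_paramSet)
      (hreg.domY.integrable_log hreg.mem_paramSet)]

variable (hC : ∀ i, Measurable (C i)) (hlaw : ∀ i, P.map (C i) = M.law)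
  (hMLE : M.IsMLE betaHat) (hdata : ∀ n ω i, data n ω i = toB (C i ω))
include hC hMLE hdata

lemma integrable_mean_log_comp {g : Param d f → ℝ} (hg : ContinuousOn g M.paramSet) (n : ℕ) :
    Integrable (fun ω => g (betaHat n (data n ω))) P := by
  obtain ⟨K, hK⟩ := hreg.isCompact.exists_bound_of_continuousOn hg
  exact .of_bound (hg.measurable_comp ((hMLE.measurable n).comp (measurable_data hC hdata n))
    fun ω => hMLE.mem n _).aestronglyMeasurable K (ae_of_all _ fun ω => hK _ (hMLE.mem n _))

include hlaw in
lemma integrable_criterion (n : ℕ) :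
    Integrable (fun ω => M.criterion βbar (data n ω) (betaHat n (data n ω))) P := by
  obtain ⟨m, hm, hb⟩ := hreg.domY.log_dominated
  simp only [criterion, mul_assoc, mul_ellY hdata]
  refine Integrable.fun_add (Integrable.fun_add (Integrable.const_mul
    (integrable_finsetSum _ fun i _ => ?_) _) (integrable_const _)) (integrable_const _)
  have hmi : Integrable (fun ω => m (C i ω)) P := by
    rw [← hlaw i] at hm; exact hm.comp_measurable (hC i)
  exact hmi.mono' (hreg.domY.measurable_log_eval (hC i) ((hMLE.measurable n).comp
    (measurable_data hC hdata n)) fun ω => hMLE.mem n _).aestronglyMeasurable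
    (ae_of_all _ fun ω => hb (C i ω) _ (hMLE.mem n _))

include hlaw in
theorem tendsto_integral_criterion (hlatent : M.LatentCorrect βbar) (hindep : iIndepFun C P) :
    Tendsto (fun n : ℕ =>
        ∫ ω, M.criterion βbar (data n ω) (betaHat n (data n ω)) ∂P
          - (2 * (n : ℝ) * ∫ ω, M.lossX (betaHat n (data n ω)) ∂P + 2 * (n : ℝ) * M.constC))
      atTop (𝓝 0) := by
  obtain ⟨g, D, H, hq, hD⟩ := hreg.exists_quadraticArgmax hC hindep hlaw hMLE hdata
  obtain ⟨g', D', H', hg', hae'⟩ := hreg.domY.exists_smoothFamily hreg.convex hreg.mem_interior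
  obtain ⟨hΦo, K, hK⟩ := hreg.latent_expansion hlatent
  set LX : Param d f → ℝ := fun β => ∫ c, Real.log (M.pX (toX c) β) ∂M.law with hLX
  set LY : Param d f → ℝ := fun β => ∫ c, Real.log (M.pY c.1 β) ∂M.law with hLY
  set Φ : Param d f → ℝ := fun s => LX (βbar + s) - LY (βbar + s) - (LX βbar - LY βbar) with hΦ
  set est : ℕ → Ω → Param d f := fun n ω => betaHat n (data n ω) - βbar with hest
  set τ₁ := ((M.matIb βbar)⁻¹ * M.matKby βbar).trace with hτ₁
  set τ₂ := (M.matIzy βbar * (M.matIb βbar)⁻¹ * M.matJb βbar * (M.matIb βbar)⁻¹).trace with hτ₂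
  have hcX : ContinuousOn LX M.paramSet := hreg.domX.continuousOn_integral_log
  have hcY : ContinuousOn LY M.paramSet := hreg.domY.continuousOn_integral_log
  have hΦe : ∀ n ω, Φ (est n ω) = LX (betaHat n (data n ω)) - LY (betaHat n (data n ω))
      - (LX βbar - LY βbar) := fun n ω => by simp only [hΦ, hest, add_sub_cancel]
  have hcΦ : ContinuousOn (fun β => LX β - LY β - (LX βbar - LY βbar)) M.paramSet :=
    (hcX.sub hcY).sub continuousOn_const
  have hΦi : ∀ n, Integrable (fun ω => Φ (est n ω)) P := fun n => by
    simp only [hΦe]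
    exact hreg.integrable_mean_log_comp hC hMLE hdata hcΦ n
  have hΦm : ∀ n, Measurable fun ω => Φ (est n ω) := fun n => by
    simp only [hΦe]
    exact hcΦ.measurable_comp ((hMLE.measurable n).comp (measurable_data hC hdata n))
      fun ω => hMLE.mem n _
  have hlossi : ∀ n, Integrable (fun ω => M.lossX (betaHat n (data n ω))) P := fun n =>
    hreg.integrable_mean_log_comp hC hMLE hdata hcX.neg n
  have hcriti := hreg.integrable_criterion hC hlaw hMLE hdata
  -- The value of `log p_y` at `βbar` is split off because only its first moment is available; its
  -- centred sum has mean exactly `0`, and the increments have a square-integrable envelope.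
  set W : ℕ → Ω → ℝ := fun n => centeredSum M.law C (fun c => Real.log (M.pY c.1 βbar)) n with hW
  have hWi : ∀ n, Integrable (W n) P := fun n =>
    hq.sample.integrable_centeredSum (hreg.domY.integrable_log hreg.mem_paramSet) n
  have hW0 : ∀ n, ∫ ω, W n ω ∂P = 0 := fun n =>
    hq.sample.integral_centeredSum (hreg.domY.measurable_log hreg.mem_paramSet)
      (hreg.domY.integrable_log hreg.mem_paramSet) n
  -- An exact identity for every `n`. After taking expectations, the left side and the term `n * Φ`
  -- are the only quantities that need a limit theorem.
  have hae : ∀ n, ∀ᵐ ω ∂P, centeredSum M.law C (fun c => g' c (est n ω)) n ω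
      = -(1 / 2) * M.criterion βbar (data n ω) (betaHat n (data n ω))
        + n * M.lossX (betaHat n (data n ω)) + n * M.constC - W n ω + n * Φ (est n ω)
        + (τ₁ + 1 / 2 * τ₂) := fun n => by
    filter_upwards [hq.sample.ae_comp hae'] with ω hω
    have h1 : ∫ c, g' c (est n ω) ∂M.law = LY (betaHat n (data n ω)) - LY βbar := by
      rw [integral_congr_ae (hae'.mono fun c hc => hc.1 (est n ω))]
      simp only [hest, add_sub_cancel]
      rw [integral_sub (hreg.domY.integrable_log (hMLE.mem n _))
        (hreg.domY.integrable_log hreg.mem_paramSet)]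
    have h2 := mul_ellY (M := M) hdata n ω (betaHat n (data n ω))
    rw [hW]
    simp only [centeredSum_eq_sub]
    rw [h1, hΦe, hreg.constC_eq hlatent, criterion, ← hτ₁, ← hτ₂, lossX, mul_assoc, h2,
      Finset.sum_congr rfl fun i _ => (hω i).1 (est n ω), Finset.sum_sub_distrib]
    simp only [hest, add_sub_cancel]
    ring
  have hcsi : ∀ n, ∫ ω, centeredSum M.law C (fun c => g' c (est n ω)) n ω ∂P
      = -(1 / 2) * (∫ ω, M.criterion βbar (data n ω) (betaHat n (data n ω)) ∂P)
        + n * (∫ ω, M.lossX (betaHat n (data n ω)) ∂P) + n * M.constC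
        + (∫ ω, n * Φ (est n ω) ∂P) + (τ₁ + 1 / 2 * τ₂) := fun n => by
    have j1 := (hcriti n).const_mul (-(1 / 2))
    have j2 := (hlossi n).const_mul (n : ℝ)
    have j3 : Integrable (fun _ : Ω => n * M.constC) P := integrable_const _
    have j4 := (hΦi n).const_mul (n : ℝ)
    have j5 : Integrable (fun _ : Ω => τ₁ + 1 / 2 * τ₂) P := integrable_const _
    have k2 := j1.fun_add j2
    have k3 := k2.fun_add j3
    have k4 := k3.sub' (hWi n)
    have k5 := k4.fun_add j4
    rw [integral_congr_ae (hae n), integral_add k5 j5, integral_add k4 j4, integral_sub k3 (hWi n),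
      integral_add k2 j3, integral_add j1 j2, hW0, integral_const, integral_const,
      integral_const_mul, integral_const_mul]
    simp
  have hDk : ∀ k, ∀ᵐ c ∂M.law, D c k
      = partialDeriv (fun β' => Real.log (M.pB (toB c) β')) k βbar := fun k =>
    hD.mono fun c hc => by rw [hc]; rfl
  have hlim1 := hq.tendsto_integral_centeredSum hg'
  have hlim2 := hq.tendsto_integral_quadratic hΦm hΦo hK
  have e1 : ∑ k, ∑ l, (M.matIb βbar)⁻¹ k l * ∫ c, D' c k * D c l ∂M.law = τ₁ := by
    rw [hτ₁, Matrix.trace_mul_eq_sum]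
    refine Finset.sum_congr rfl fun k _ => Finset.sum_congr rfl fun l _ => ?_
    congr 1
    rw [matKby, Matrix.of_apply]
    refine integral_congr_ae ?_
    filter_upwards [hDk l, hae'] with c hc hc'
    rw [hc, hc'.2, mul_comm]
    rfl
  -- The limiting second moments contain `(M.matIb βbar)⁻¹` with the two indices in the other order;
  -- symmetry brings them into the form of a trace.
  have hsymm : ∀ i j, (M.matIb βbar)⁻¹ i j = (M.matIb βbar)⁻¹ j i := fun i j => by
    have h : ((M.matIb βbar)⁻¹).IsSymm := by
      rw [Matrix.IsSymm, Matrix.transpose_nonsing_inv, hreg.matIb_isSymm.eq]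
    exact (h.apply i j).symm
  have e2 : 1 / 2 * ∑ i, ∑ j, (-M.matIzy βbar) i j * ∑ k, (M.matIb βbar)⁻¹ i k
      * ∑ l, (M.matIb βbar)⁻¹ j l * ∫ c, D c k * D c l ∂M.law = -(1 / 2) * τ₂ := by
    rw [hτ₂, mul_assoc (M.matIzy βbar), mul_assoc (M.matIzy βbar), Matrix.trace_mul_eq_sum,
      neg_mul, ← mul_neg, ← Finset.sum_neg_distrib]
    congr 1
    refine Finset.sum_congr rfl fun i _ => ?_
    rw [← Finset.sum_neg_distrib]
    refine Finset.sum_congr rfl fun j _ => ?_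
    rw [Matrix.neg_apply, neg_mul, Matrix.mul_apply]
    congr 2
    refine Finset.sum_congr rfl fun k _ => ?_
    rw [hsymm i k, mul_comm, Matrix.mul_apply]
    congr 1
    refine Finset.sum_congr rfl fun l _ => ?_
    congr 1
    rw [matJb, Matrix.of_apply]
    refine integral_congr_ae ?_
    filter_upwards [hDk l, hDk k] with c hl hk
    rw [hl, hk, mul_comm]
  rw [e1] at hlim1
  rw [e2] at hlim2
  -- The penalties of the criterion are exactly the two limits, so all constants cancel.
  have hlim := ((hlim2.sub hlim1).add_const (τ₁ + 1 / 2 * τ₂)).const_mul 2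
  rw [show 2 * (-(1 / 2) * τ₂ - τ₁ + (τ₁ + 1 / 2 * τ₂)) = 0 by ring] at hlim
  refine hlim.congr fun n => ?_
  rw [hcsi]
  ring

end Regular

end AuxModel

theorem mainTheorem1 {d f : ℕ} {𝒴 𝒵 𝒜 Ω : Type*} [MeasurableSpace 𝒴] [MeasurableSpace 𝒵]
    [MeasurableSpace 𝒜] [MeasurableSpace Ω] (P : Measure Ω) [IsProbabilityMeasure P]
    (M : AuxModel d f 𝒴 𝒵 𝒜) (βbar : Param d f)
    (hreg : M.Regular βbar) (hlatent : M.LatentCorrect βbar)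
    (C : ℕ → Ω → 𝒴 × 𝒵 × 𝒜) (hC : ∀ i, Measurable (C i)) (hindep : iIndepFun C P)
    (hlaw : ∀ i, P.map (C i) = M.law)
    (betaHat : ∀ n : ℕ, (Fin n → 𝒴 × 𝒜) → Param d f) (hMLE : M.IsMLE betaHat)
    (data : ∀ n : ℕ, Ω → Fin n → 𝒴 × 𝒜)
    (hdata : ∀ n ω i, data n ω i = AuxModel.toB (C i ω)) :
    -- all expectations involved exist
    Integrable (fun c => Real.log (M.qZY (AuxModel.toX c))) M.law ∧
    (∀ n, Integrable (fun ω => M.criterion βbar (data n ω) (betaHat n (data n ω))) P) ∧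
    (∀ n, Integrable (fun ω => M.lossX (betaHat n (data n ω))) P) ∧
    -- the criterion has expectation `2 n R_x(θ̂_b) + 2 n C(q_x) + o(1)`
    Tendsto (fun n : ℕ =>
        ∫ ω, M.criterion βbar (data n ω) (betaHat n (data n ω)) ∂P
          - (2 * (n : ℝ) * ∫ ω, M.lossX (betaHat n (data n ω)) ∂P + 2 * (n : ℝ) * M.constC))
      atTop (𝓝 0) ∧
    -- if `Z` and `A` are trivial, i.e. `X = B = Y`, the estimator is the maximum likelihood
    -- estimator from `y_1, …, y_n`, `βbar` is its population counterpart, and the criterion is TIC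
    (Subsingleton 𝒵 → Subsingleton 𝒜 →
      (∀ n b, IsMaxOn (M.ellY b) M.paramSet (betaHat n b)) ∧
      (∀ β ∈ M.paramSet, β ≠ βbar →
        ∫ c, Real.log (M.pY c.1 β) ∂M.law < ∫ c, Real.log (M.pY c.1 βbar) ∂M.law) ∧
      ∀ n (b : Fin n → 𝒴 × 𝒜),
        M.criterion βbar b (betaHat n b) = M.tic βbar b (betaHat n b)) := by
  refine ⟨hreg.integrable_log_qZY hlatent, hreg.integrable_criterion hC hlaw hMLE hdata,
    hreg.integrable_mean_log_comp hC hMLE hdata hreg.domX.continuousOn_integral_log.neg,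
    hreg.tendsto_integral_criterion hC hlaw hMLE hdata hlatent hindep, fun _ _ => ?_⟩
  exact ⟨fun n b => hreg.isMaxOn_ellY (hMLE.mem n b) (hMLE.isMaxOn n b),
    fun β hβ hne => hreg.unique_max_pY hβ hne, fun n b => hreg.criterion_eq_tic b _⟩
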